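/- **Theorem (Bayesian regret bound for RLSVI).** Let $H\ge 1$, let $\mathcal X,\mathcal A$ be finite non-empty sets and let $\rho$ be a probability distribution on $\mathcal X$. Consider an episodic MDP $\mathcal M$ with periods $t=0,\dots,H-1$: in every episode $x_0\sim\rho$; when action $a_t=a$ is chosen in state $x_t=x$ in period $t$, an outcome $(r_{t+1},x_{t+1})\in\{0,1\}\times\mathcal X$ is drawn from a distribution $\mathcal P^O_{t,x,a}$; the episode ends after period $H-1$ (so the last next state is irrelevant). Assume that the distributions $\mathcal P^O_{t,x,a}$, $(t,x,a)\in\{0,\dots,H-1\}\times\mathcal X\times\mathcal A$, are random and independent, $\mathcal P^O_{t,x,a}\sim\mathrm{Dirichlet}(\alpha_{0,t,x,a})$ with $\alpha_{0,t,x,a}\in\mathbb R_{\ge 0}^{2|\mathcal X|}$ (a coordinate with parameter $0$ vanishes almost surely), and that there is $\beta\ge 2$ such that the entries of $\alpha_{0,t,x,a}$ sum to $\beta$ for every $(t,x,a)$. For a policy $\pi=(\pi_0,\dots,\pi_{H-1})$, $\pi_t:\mathcal X\to\mathcal A$, let $V^\pi_{\mathcal M,0}(x)$ be the expected total reward of an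 episode of $\pi$ in $\mathcal M$ with $x_0=x$, and let $V^*_{\mathcal M,0}(x)=\max_\pi V^\pi_{\mathcal M,0}(x)$. For an agent that follows policy $\pi_\ell$ in episode $\ell$ from the initial state $x_0^\ell$, $$\mathrm{BayesRegret}(\mathrm{agent},L)=\mathbb E\Big[\sum_{\ell=1}^{L}\big(V^*_{\mathcal M,0}(x_0^\ell)-V^{\pi_\ell}_{\mathcal M,0}(x_0^\ell)\big)\Big],$$ the expectation being over the prior of $\mathcal M$, the outcomes and the agent's randomization. The agent $\mathrm{RLSVI}_{\bar\theta,v,\lambda}$ (tabular, infinite buffer, Gaussian noise, greedy actions, planning horizon $H$) works as follows. Before episode $\ell$, for each $y=(t,x,a)$ let $D_{\ell-1}(y)$ be the collection (with multiplicity) of the outcomes $(r,x')$ observed in earlier episodes when $a$ was chosen in state $x$ in period $t$, let $n_\ell(y)=|D_{\ell-1}(y)|$ and $\sigma_\ell^2(y)=\big(\tfrac1\lambda+\tfrac{n_\ell(y)}{v}\big)^{-1}$. Set $Q_{\ell,H}=0$ and, for $t=H-1,\dots,0$, $$Q_{\ell,t}(x,a)=\sigma_\ell^2(y)\Big(\frac{\bar\theta_y}{\lambda}+\frac1v\sum_{(r,x')\in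 D_{\ell-1}(y)}\big(r+\max_{a'\in\mathcal A}Q_{\ell,t+1}(x',a')\big)\Big)+w_\ell(y),\qquad y=(t,x,a),$$ where $w_\ell(y)=\sigma_\ell(y)\,\xi_\ell(y)$ and the $\xi_\ell(y)$ are standard Gaussians, independent over $\ell$ and $y$ and, for each $\ell$, independent of $\mathcal M$ and of the data of the earlier episodes. In episode $\ell$ the agent follows the policy that is greedy for $Q_{\ell,0},\dots,Q_{\ell,H-1}$, i.e. $\pi_{\ell,t}(x)\in\arg\max_{a}Q_{\ell,t}(x,a)$ (almost surely unique). If $v=H^2$, $\bar\theta_y=H$ for all $y$, and $v/\lambda=\beta$, then for every $L\in\mathbb N$ $$\mathrm{BayesRegret}(\mathrm{RLSVI}_{\bar\theta,v,\lambda},L)\le 4H^2\sqrt{\beta|\mathcal X||\mathcal A|L\,\log_+(1+|\mathcal X||\mathcal A|HL)}\;\log_+\!\Big(1+\frac{L}{|\mathcal X||\mathcal A|}\Big)$$ and $$\mathrm{BayesRegret}(\mathrm{RLSVI}_{\bar\theta,v,\lambda},L)\le 4\beta H^3|\mathcal X||\mathcal A|\sqrt{\log_+(1+|\mathcal X||\mathcal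 A|HL)}\;\log_+\!\Big(1+\frac{L}{|\mathcal X||\mathcal A|}\Big)+2H^2\sqrt{2|\mathcal X||\mathcal A|L\log(|\mathcal X||\mathcal A|)},$$ where $\log_+(x)=\max\{1,\log x\}$. -/

import Mathlib

open MeasureTheory ProbabilityTheory

noncomputable section

/-- `log₊ x = max {1, log x}`. -/
def logPlus (x : ℝ) : ℝ := max 1 (Real.log x)

/-- The Gamma law with shape `a` and rate `1`; for shape `0` it is the point mass at `0`. -/
def gammaLaw (a : ℝ) : Measure ℝ :=
  if 0 < a then gammaMeasure a 1 else Measure.dirac 0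

/-- The Dirichlet law on `ℝ^ι`: the law of `(g i / ∑ j, g j)_i` for independent Gamma variables
`g i` of shapes `α i`. A coordinate with parameter `0` vanishes almost surely. -/
def dirichlet {ι : Type*} [Fintype ι] (α : ι → ℝ) : Measure (ι → ℝ) :=
  (Measure.pi fun i => gammaLaw (α i)).map fun g i => g i / ∑ j, g j

/-- An outcome `(r, x')`: a reward in `{0, 1}` and a next state. -/
abbrev Outcome (X : Type*) := Bool × X

/-- The numerical reward of an outcome. -/
def reward {X : Type*} (o : Outcome X) : ℝ := if o.1 then 1 else 0

/-- The outcome distributions of a time-inhomogeneous MDP with horizon `H`, state set `X` in every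
period and action set `A`: `M (t, x, a) o` is the probability of the outcome `o` when `a` is
chosen in state `x` in period `t`. The episode ends after period `H - 1`, so the next state in an
outcome of that period influences nothing. -/
abbrev MDP (H : ℕ) (X A : Type*) := Fin H × X × A → Outcome X → ℝ

/-- A deterministic, time-dependent policy. -/
abbrev Policy (H : ℕ) (X A : Type*) := Fin H → X → A

/-- The record of an episode: the initial state, and for every period the action taken and the
outcome observed. -/
abbrev Trajectory (H : ℕ) (X A : Type*) := X × (Fin H → A × Outcome X)

/-- The state visited in period `t`. -/
def Trajectory.state {H : ℕ} {X A : Type*} (τ : Trajectory H X A) (t : Fin H) : X :=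
  if t.val = 0 then τ.1 else (τ.2 ⟨t.val - 1, by omega⟩).2.2

/-- The action taken in period `t`. -/
def Trajectory.action {H : ℕ} {X A : Type*} (τ : Trajectory H X A) (t : Fin H) : A :=
  (τ.2 t).1

/-- The outcome observed in period `t`. -/
def Trajectory.outcome {H : ℕ} {X A : Type*} (τ : Trajectory H X A) (t : Fin H) : Outcome X :=
  (τ.2 t).2

section Model

variable {H : ℕ} {X A : Type*} [Fintype X] [DecidableEq X] [Fintype A] [DecidableEq A]

/-- The probability of the trajectory `τ` when the initial state has distribution `ρ` and the
policy `π` is followed in `M`. -/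
def trajProb (ρ : X → ℝ) (M : MDP H X A) (π : Policy H X A) (τ : Trajectory H X A) : ℝ :=
  ρ τ.1 * ∏ t : Fin H,
    if τ.action t = π t (τ.state t) then M (t, τ.state t, τ.action t) (τ.outcome t) else 0

/-- `V^π_{M,0}(x)`: the expected total reward of an episode of `π` in `M` started in `x`. -/
def value (M : MDP H X A) (π : Policy H X A) (x : X) : ℝ :=
  ∑ τ : Trajectory H X A,
    trajProb (fun x' => if x' = x then 1 else 0) M π τ * ∑ t : Fin H, reward (τ.outcome t)

/-- `V^*_{M,0}(x)`: the maximum of `V^π_{M,0}(x)` over all policies. -/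
def optValue (M : MDP H X A) (x : X) : ℝ := ⨆ π : Policy H X A, value M π x

/-- The records of the first `ℓ` episodes. -/
abbrev History (H : ℕ) (X A : Type*) (ℓ : ℕ) := Fin ℓ → Trajectory H X A

/-- An agent: after `ℓ` episodes with history `h` it follows the policy `π` throughout the next
episode with probability `agent ℓ h π`. -/
abbrev Agent (H : ℕ) (X A : Type*) := (ℓ : ℕ) → History H X A ℓ → Policy H X A → ℝ

/-- The probability, given `M`, that the first `ℓ` episodes of the agent produce `h`. -/
def historyProb (ρ : X → ℝ) (agent : Agent H X A) (M : MDP H X A) {ℓ : ℕ}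
    (h : History H X A ℓ) : ℝ :=
  ∏ k : Fin ℓ, ∑ π : Policy H X A,
    agent k.val (fun j => h (Fin.castLE k.isLt.le j)) π * trajProb ρ M π (h k)

/-- The expected regret of the agent over `L` episodes, given `M`. -/
def regret (ρ : X → ℝ) (agent : Agent H X A) (L : ℕ) (M : MDP H X A) : ℝ :=
  ∑ ℓ ∈ Finset.range L, ∑ h : History H X A ℓ, historyProb ρ agent M h *
    ∑ π : Policy H X A, agent ℓ h π * ∑ x : X, ρ x * (optValue M x - value M π x)

/-- The prior of the MDP: independent Dirichlet outcome distributions. -/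
def prior (α : Fin H × X × A → Outcome X → ℝ) : Measure (MDP H X A) :=
  Measure.pi fun y => dirichlet (α y)

/-- The Bayesian regret of the agent over `L` episodes. -/
def bayesRegret (ρ : X → ℝ) (α : Fin H × X × A → Outcome X → ℝ) (agent : Agent H X A)
    (L : ℕ) : ℝ :=
  ∫ M, regret ρ agent L M ∂(prior α)

/-- The past episodes in which the action `a` was chosen in state `x` in period `t`. -/
def visits {ℓ : ℕ} (h : History H X A ℓ) (y : Fin H × X × A) : Finset (Fin ℓ) :=
  {k | (h k).state y.1 = y.2.1 ∧ (h k).action y.1 = y.2.2}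

/-- `σ²(y) = (1 / lam + n(y) / v)⁻¹`, where `n(y)` is the number of past visits to `y`. -/
def rlsviVar (v lam : ℝ) {ℓ : ℕ} (h : History H X A ℓ) (y : Fin H × X × A) : ℝ :=
  (1 / lam + ((visits h y).card : ℝ) / v)⁻¹

/-- The randomized state-action value functions of RLSVI, computed backwards in time from the
history `h` and a vector `ξ` of standard Gaussians: they vanish in period `H`, and
`Q_t(x, a) = σ²(y) (θbar(y) / lam + (1 / v) ∑_{(r, x')} (r + max_a' Q_{t+1}(x', a'))) + σ(y) ξ(y)`
with `y = (t, x, a)` and the sum over all outcomes observed at `y` so far. -/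
def rlsviQ (θbar : Fin H × X × A → ℝ) (v lam : ℝ) {ℓ : ℕ} (h : History H X A ℓ)
    (ξ : Fin H × X × A → ℝ) (t : ℕ) (x : X) (a : A) : ℝ :=
  if ht : t < H then
    rlsviVar v lam h (⟨t, ht⟩, x, a) *
        (θbar (⟨t, ht⟩, x, a) / lam +
          (1 / v) * ∑ k ∈ visits h (⟨t, ht⟩, x, a),
            (reward ((h k).outcome ⟨t, ht⟩) +
              ⨆ a' : A, rlsviQ θbar v lam h ξ (t + 1) ((h k).outcome ⟨t, ht⟩).2 a')) +
      Real.sqrt (rlsviVar v lam h (⟨t, ht⟩, x, a)) * ξ (⟨t, ht⟩, x, a)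
  else 0
termination_by H - t

/-- RLSVI with greedy actions: the probability of following `π` is the probability, over
independent standard Gaussians drawn afresh in every episode, that `π` is greedy for the sampled
value functions. For `v, lam > 0` ties have probability zero, so these probabilities add up to one
and no tie-breaking rule is needed. -/
def rlsvi (θbar : Fin H × X × A → ℝ) (v lam : ℝ) : Agent H X A := fun _ h π =>
  (Measure.pi fun _ : Fin H × X × A => gaussianReal 0 1).real
    {ξ | ∀ (t : Fin H) (x : X) (a : A),
      rlsviQ θbar v lam h ξ t.val x a ≤ rlsviQ θbar v lam h ξ t.val x (π t x)}

end Model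

end

/-!
# A Bayesian regret bound for randomized least-squares value iteration

Dirichlet priors are conjugate (`integral_mul_dirichlet`). Hence, averaged over the prior, the law
of the history can be generated episode by episode from posterior mean models (`predProb_snoc`),
and the Bayesian regret is a finite sum over histories in which the unknown model is replaced by
its posterior mean in the value of the policy that is followed, while the optimal value is averaged
over the posterior (`bayesRegret_eq`).

*Optimism.* If `P` is Dirichlet with parameters of total mass `n` and `f` takes values in `[0, R]`,
then `P · f` is dominated in the convex order by a Gaussian of the same mean and of standard
deviation `R / √n` (`integral_dirichlet_le_stdGaussian`): decompose `P` by its Pólya urn, and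
compare one bounded increment at a time with a Gaussian increment. With `v = H²` and `v / λ = β`
this is the noise of the algorithm, and with `θ̄ = H` its regression targets are at least the
posterior means. Since Bellman backups are monotone, convex and Lipschitz, the comparison passes
backwards through the periods, one layer of independent variables at a time: the expectation of
any increasing convex Lipschitz function of the optimal state-action values under the posterior is
at most its expectation at the sampled values (`integral_optQ_le_integral_rlsviQ`).

*Regret of an episode.* Ties have probability zero (`ae_existsUnique_greedy`), so the policy is the
greedy one, and by optimism the regret of the episode is at most the expected gap between the
sampled value and the value of the greedy policy in the posterior mean model. That gap telescopes
into the Bellman errors of the sampled values along the trajectory (`sum_trajProb_mul_return`). The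
Bellman error at a triple with `n` data is at most `β / n` times the optimism of the prior data
plus `H / √n` times the Gaussian perturbation (`rlsviQ_sub_le`). Perturbations are split at a level
that depends on the history only; the part below the level is charged to the visit, and the
expected excess is a Gaussian tail summed over all triples (`sum_rlsvi_regret_le`).

*Summation.* For a triple with `n` among the `t` data of its period the level is half of
`k₀ + k₁ log (t / n)`, up to a bounded term, with `k₀` and `k₁` of order `√(log N)` and
`1 / √(log N)`, where `N = |X| |A|`. It then grows just enough for rarely sampled triples to make
the tails summable, and the charges are increments of `√n (k₀ + k₁ log (t / n))`. The sum of these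
over the `N` triples of a period is largest when the data are spread evenly, where it equals
`2 √(2 log N) √(N t)` (`sum_widthPotential_le`). Telescoping this potential in expectation gives
the second bound of the theorem. The first one follows, because it is weaker than the trivial bound
`H * L` unless `L` is so large that it dominates the second bound (`second_bound_le_first`).
-/

set_option linter.unusedSectionVars false

noncomputable section

/-! ### Resampling coordinates of product measures -/

section ProductMeasures

variable {ι E : Type*} [MeasurableSpace E]

theorem measurable_update_prod [DecidableEq ι] (y : ι) :
    Measurable fun q : (ι → E) × E => Function.update q.1 y q.2 := by
  refine measurable_pi_lambda _ fun i => ?_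
  by_cases h : i = y
  · subst h; simpa using measurable_snd
  · simpa [Function.update_of_ne h, Function.comp_def] using
      (measurable_pi_apply i).comp measurable_fst

variable [Fintype ι]

/-- Replacing the coordinate `y` of a product of probability measures by an independent sample
from `ν y` yields the product in which the `y`-th factor is `ν y`. -/
theorem map_update_pi_prod [DecidableEq ι] (μ ν : ι → Measure E)
    [∀ i, IsProbabilityMeasure (μ i)] [∀ i, IsProbabilityMeasure (ν i)] (y : ι)
    (h : ∀ i, i ≠ y → ν i = μ i) :
    ((Measure.pi μ).prod (ν y)).map (fun q : (ι → E) × E => Function.update q.1 y q.2) =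
      Measure.pi ν := by
  symm
  refine Measure.pi_eq fun s hs => ?_
  rw [Measure.map_apply (measurable_update_prod y) (MeasurableSet.univ_pi hs)]
  have : (fun q : (ι → E) × E => Function.update q.1 y q.2) ⁻¹' (Set.univ.pi s) =
      (Set.univ.pi (Function.update s y Set.univ)) ×ˢ s y := by
    ext ⟨x, z⟩
    simp only [Set.mem_preimage, Set.mem_pi, Set.mem_univ, true_imp_iff, Set.mem_prod]
    constructor
    · intro hx
      refine ⟨fun i => ?_, by simpa using hx y⟩
      by_cases hi : i = y
      · subst hi; simp
      · simpa [Function.update_of_ne hi] using hx i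
    · rintro ⟨h1, h2⟩ i
      by_cases hi : i = y
      · subst hi; simpa using h2
      · simpa [Function.update_of_ne hi] using h1 i
  rw [this, Measure.prod_prod, Measure.pi_pi, ← Finset.mul_prod_erase _ _ (Finset.mem_univ y),
    ← Finset.mul_prod_erase _ (fun i => ν i (s i)) (Finset.mem_univ y)]
  simp only [Function.update_self, measure_univ, one_mul]
  rw [mul_comm]
  congr 1
  refine Finset.prod_congr rfl fun i hi => ?_
  have hi' := Finset.ne_of_mem_erase hi
  rw [Function.update_of_ne hi', h i hi']

theorem lintegral_pi_update [DecidableEq ι] (μ ν : ι → Measure E)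
    [∀ i, IsProbabilityMeasure (μ i)] [∀ i, IsProbabilityMeasure (ν i)] (y : ι)
    (h : ∀ i, i ≠ y → ν i = μ i) {F : (ι → E) → ENNReal} (hF : Measurable F) :
    ∫⁻ x, F x ∂Measure.pi ν =
      ∫⁻ x, ∫⁻ z, F (Function.update x y z) ∂(ν y) ∂Measure.pi μ := by
  rw [← map_update_pi_prod μ ν y h, lintegral_map hF (measurable_update_prod y)]
  exact lintegral_prod _ (hF.comp (measurable_update_prod y)).aemeasurable

theorem integral_pi_update [DecidableEq ι] (μ ν : ι → Measure E)
    [∀ i, IsProbabilityMeasure (μ i)] [∀ i, IsProbabilityMeasure (ν i)] (y : ι)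
    (h : ∀ i, i ≠ y → ν i = μ i) {F : (ι → E) → ℝ} (hF : Integrable F (Measure.pi ν)) :
    ∫ x, F x ∂Measure.pi ν =
      ∫ x, ∫ z, F (Function.update x y z) ∂(ν y) ∂Measure.pi μ := by
  have hm := map_update_pi_prod μ ν y h
  have hF' := hF
  rw [← hm] at hF'
  have h2 := hF'.comp_measurable (measurable_update_prod y)
  conv_lhs => rw [← hm, integral_map (measurable_update_prod y).aemeasurable
    hF'.aestronglyMeasurable]
  exact integral_prod _ h2

theorem integrable_pi_update [DecidableEq ι] (μ ν : ι → Measure E)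
    [∀ i, IsProbabilityMeasure (μ i)] [∀ i, IsProbabilityMeasure (ν i)] (y : ι)
    (h : ∀ i, i ≠ y → ν i = μ i) {F : (ι → E) → ℝ} (hF : Integrable F (Measure.pi ν)) :
    Integrable (fun x => ∫ z, F (Function.update x y z) ∂(ν y)) (Measure.pi μ) := by
  have hm := map_update_pi_prod μ ν y h
  rw [← hm] at hF
  exact (hF.comp_measurable (measurable_update_prod y)).integral_prod_left

/-- Two independent samples of a product of probability measures may be merged along a set of
coordinates. -/
theorem map_piecewise_pi_prod (μ : ι → Measure E) [∀ i, IsProbabilityMeasure (μ i)]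
    (T : ι → Prop) [DecidablePred T] :
    ((Measure.pi μ).prod (Measure.pi μ)).map
      (fun q : (ι → E) × (ι → E) => fun i => if T i then q.1 i else q.2 i) = Measure.pi μ := by
  have hmeas : Measurable
      (fun q : (ι → E) × (ι → E) => fun i => if T i then q.1 i else q.2 i) := by
    refine measurable_pi_lambda _ fun i => ?_
    by_cases h : T i
    · simpa [h, Function.comp_def] using (measurable_pi_apply i).comp measurable_fst
    · simpa [h, Function.comp_def] using (measurable_pi_apply i).comp measurable_snd
  symm
  refine Measure.pi_eq fun s hs => ?_
  rw [Measure.map_apply hmeas (MeasurableSet.univ_pi hs)]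
  have : (fun q : (ι → E) × (ι → E) => fun i => if T i then q.1 i else q.2 i) ⁻¹'
      (Set.univ.pi s) =
      (Set.univ.pi (fun i => if T i then s i else Set.univ)) ×ˢ
        (Set.univ.pi (fun i => if T i then Set.univ else s i)) := by
    ext ⟨x, z⟩
    simp only [Set.mem_preimage, Set.mem_pi, Set.mem_univ, true_imp_iff, Set.mem_prod]
    rw [← forall_and]
    refine forall_congr' fun i => ?_
    by_cases h : T i <;> simp [h]
  rw [this, Measure.prod_prod, Measure.pi_pi, Measure.pi_pi, ← Finset.prod_mul_distrib]
  refine Finset.prod_congr rfl fun i _ => ?_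
  by_cases h : T i <;> simp [h]

/-- Fubini for a product measure split along a set `T` of coordinates: the coordinates in `T`
are taken from the outer variable, the others from the inner one. -/
theorem integral_pi_piecewise (μ : ι → Measure E) [∀ i, IsProbabilityMeasure (μ i)]
    (T : ι → Prop) [DecidablePred T] {F : (ι → E) → ℝ} (hF : Integrable F (Measure.pi μ)) :
    ∫ x, F x ∂Measure.pi μ =
      ∫ x, ∫ z, F (fun i => if T i then x i else z i) ∂Measure.pi μ ∂Measure.pi μ := by
  have hmeas : Measurable
      (fun q : (ι → E) × (ι → E) => fun i => if T i then q.1 i else q.2 i) := by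
    refine measurable_pi_lambda _ fun i => ?_
    by_cases h : T i
    · simpa [h, Function.comp_def] using (measurable_pi_apply i).comp measurable_fst
    · simpa [h, Function.comp_def] using (measurable_pi_apply i).comp measurable_snd
  have hm := map_piecewise_pi_prod μ T
  have hF' := hF
  rw [← hm] at hF'
  have h2 := hF'.comp_measurable hmeas
  conv_lhs => rw [← hm, integral_map hmeas.aemeasurable hF'.aestronglyMeasurable]
  exact integral_prod _ h2

theorem lintegral_prod_pi (μ : ι → Measure E) [∀ i, IsProbabilityMeasure (μ i)]
    {f : ι → E → ENNReal} (hf : ∀ i, Measurable (f i)) :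
    ∫⁻ x, ∏ i, f i (x i) ∂Measure.pi μ = ∏ i, ∫⁻ z, f i z ∂(μ i) := by
  have hind : iIndepFun (fun i (x : ι → E) => f i (x i)) (Measure.pi μ) :=
    iIndepFun_pi fun i => (hf i).aemeasurable
  rw [lintegral_prod_eq_prod_lintegral_of_indepFun Finset.univ _ hind
    fun i => (hf i).comp (measurable_pi_apply i)]
  refine Finset.prod_congr rfl fun i _ => ?_
  exact (measurePreserving_eval μ i).lintegral_comp (hf i)

end ProductMeasures

/-! ### Gamma laws: size bias and exponential tilting -/

section GammaLaw

instance isProbabilityMeasure_gammaLaw (a : ℝ) : IsProbabilityMeasure (gammaLaw a) := by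
  unfold gammaLaw
  split_ifs with h
  · exact isProbabilityMeasure_gammaMeasure h one_pos
  · infer_instance

theorem gammaLaw_ae_nonneg (a : ℝ) : ∀ᵐ x ∂gammaLaw a, 0 ≤ x := by
  unfold gammaLaw
  split_ifs with h
  · rw [gammaMeasure, ae_withDensity_iff (by unfold gammaPDF; fun_prop)]
    refine Filter.Eventually.of_forall fun x hx => ?_
    by_contra hlt
    exact hx (gammaPDF_of_neg (not_le.1 hlt))
  · simp

theorem gammaLaw_ae_pos {a : ℝ} (ha : 0 < a) : ∀ᵐ x ∂gammaLaw a, 0 < x := by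
  have h0 : ∀ᵐ x ∂gammaLaw a, x ≠ 0 := by
    rw [gammaLaw, if_pos ha, gammaMeasure]
    refine (withDensity_absolutelyContinuous _ _).ae_le ?_
    exact Measure.ae_ne volume 0
  filter_upwards [h0, gammaLaw_ae_nonneg a] with x h1 h2
  exact lt_of_le_of_ne h2 (Ne.symm h1)

theorem lintegral_gammaLaw {a : ℝ} (ha : 0 < a) {f : ℝ → ENNReal} (hf : Measurable f) :
    ∫⁻ x, f x ∂gammaLaw a = ∫⁻ x, gammaPDF a 1 x * f x := by
  rw [gammaLaw, if_pos ha, gammaMeasure,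
    lintegral_withDensity_eq_lintegral_mul _ (by unfold gammaPDF; fun_prop) hf]
  rfl

/-- Size-biasing a Gamma variable raises its shape by one. -/
theorem lintegral_mul_gammaLaw {a : ℝ} (ha : 0 ≤ a) {f : ℝ → ENNReal} (hf : Measurable f) :
    ∫⁻ x, ENNReal.ofReal x * f x ∂gammaLaw a =
      ENNReal.ofReal a * ∫⁻ x, f x ∂gammaLaw (a + 1) := by
  rcases ha.eq_or_lt with rfl | ha
  · simp [gammaLaw]
  rw [lintegral_gammaLaw ha (by fun_prop), lintegral_gammaLaw (by positivity) hf,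
    ← lintegral_const_mul _ (by unfold gammaPDF; fun_prop)]
  refine lintegral_congr_ae ?_
  filter_upwards [Measure.ae_ne (volume : Measure ℝ) 0] with x hx0
  rcases lt_or_gt_of_ne hx0 with hx | hx
  · simp [gammaPDF_of_neg hx]
  · rw [gammaPDF_of_nonneg hx.le, gammaPDF_of_nonneg hx.le, ← mul_assoc, ← mul_assoc]
    congr 1
    rw [← ENNReal.ofReal_mul' hx.le, ← ENNReal.ofReal_mul ha.le]
    congr 1
    rw [Real.Gamma_add_one ha.ne', Real.one_rpow, Real.one_rpow, add_sub_cancel_right,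
      Real.rpow_sub_one hx0]
    have := (Real.Gamma_pos_of_pos ha).ne'
    field_simp

/-- Exponential tilting of a Gamma law amounts to a change of scale. -/
theorem lintegral_exp_gammaLaw {a c : ℝ} (ha : 0 ≤ a) (hc : 0 < c) {f : ℝ → ENNReal}
    (hf : Measurable f) :
    ∫⁻ x, f (x / c) ∂gammaLaw a =
      ENNReal.ofReal (c ^ a) *
        ∫⁻ x, ENNReal.ofReal (Real.exp (-((c - 1) * x))) * f x ∂gammaLaw a := by
  rcases ha.eq_or_lt with rfl | ha
  · simp [gammaLaw]
  have hg : Measurable fun x => gammaPDF a 1 x * f (x / c) := by unfold gammaPDF; fun_prop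
  rw [lintegral_gammaLaw ha (by fun_prop), lintegral_gammaLaw ha (by fun_prop),
    ← lintegral_const_mul _ (by unfold gammaPDF; fun_prop)]
  conv_lhs => rw [← Real.smul_map_volume_mul_left hc.ne', lintegral_smul_measure,
    lintegral_map hg (by fun_prop)]
  rw [smul_eq_mul, ← lintegral_const_mul _ (by unfold gammaPDF; fun_prop)]
  refine lintegral_congr_ae ?_
  filter_upwards [Measure.ae_ne (volume : Measure ℝ) 0] with x hx0
  rcases lt_or_gt_of_ne hx0 with hx | hx
  · have : c * x < 0 := mul_neg_of_pos_of_neg hc hx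
    simp [gammaPDF_of_neg hx, gammaPDF_of_neg this]
  · have hcx : 0 < c * x := mul_pos hc hx
    have hG := Real.Gamma_pos_of_pos ha
    suffices h : ENNReal.ofReal |c| * gammaPDF a 1 (c * x) =
        ENNReal.ofReal (c ^ a) * (gammaPDF a 1 x * ENNReal.ofReal (Real.exp (-((c - 1) * x)))) by
      rw [mul_div_cancel_left₀ _ hc.ne', ← mul_assoc, h]
      ring
    rw [gammaPDF_of_nonneg hx.le, gammaPDF_of_nonneg hcx.le, abs_of_pos hc,
      ← ENNReal.ofReal_mul hc.le, ← ENNReal.ofReal_mul (by positivity),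
      ← ENNReal.ofReal_mul (by positivity)]
    congr 1
    rw [Real.one_rpow, Real.mul_rpow hc.le hx.le, Real.rpow_sub_one hc.ne']
    have : Real.exp (-(1 * (c * x))) = Real.exp (-(1 * x)) * Real.exp (-((c - 1) * x)) := by
      rw [← Real.exp_add]; congr 1; ring
    rw [this]
    field_simp

end GammaLaw

/-! ### Dirichlet laws: support and conjugacy -/

section Dirichlet

variable {ι : Type*} [Fintype ι]

/-- A product of Gamma laws, seen through a scale-invariant function, does not change under
exponential tilting by the sum of the coordinates, up to normalization. -/
theorem lintegral_exp_pi_gammaLaw {α : ι → ℝ} (hα : ∀ i, 0 ≤ α i) {c : ℝ} (hc : 0 < c)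
    {F : (ι → ℝ) → ENNReal} (hF : Measurable F) (hinv : ∀ g, F (fun i => g i / c) = F g) :
    ∫⁻ g, ENNReal.ofReal (Real.exp (-((c - 1) * ∑ i, g i))) * F g
        ∂(Measure.pi fun i => gammaLaw (α i)) =
      ENNReal.ofReal (c ^ (-∑ i, α i)) * ∫⁻ g, F g ∂(Measure.pi fun i => gammaLaw (α i)) := by
  have hE : Measurable fun g : ι → ℝ => ENNReal.ofReal (Real.exp (-((c - 1) * ∑ i, g i))) := by
    fun_prop
  have hdiv : Measurable fun x : ℝ => x / c := by fun_prop
  have key : Measure.pi (fun i => (gammaLaw (α i)).map (fun x => x / c)) =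
      ENNReal.ofReal (c ^ (∑ i, α i)) • (Measure.pi fun i => gammaLaw (α i)).withDensity
        fun g => ENNReal.ofReal (Real.exp (-((c - 1) * ∑ i, g i))) := by
    have : ∀ i, IsProbabilityMeasure ((gammaLaw (α i)).map (fun x => x / c)) := fun i =>
      Measure.isProbabilityMeasure_map hdiv.aemeasurable
    refine Measure.pi_eq fun s hs => ?_
    have hbox : MeasurableSet (Set.univ.pi s) := MeasurableSet.univ_pi hs
    rw [Measure.smul_apply, withDensity_apply _ hbox, ← lintegral_indicator hbox, smul_eq_mul]
    have h1 : ∀ g : ι → ℝ, (Set.univ.pi s).indicator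
        (fun g => ENNReal.ofReal (Real.exp (-((c - 1) * ∑ i, g i)))) g =
        ∏ i, (ENNReal.ofReal (Real.exp (-((c - 1) * g i))) * (s i).indicator 1 (g i)) := by
      intro g
      rw [Finset.prod_mul_distrib]
      by_cases hg : g ∈ Set.univ.pi s
      · rw [Set.indicator_of_mem hg, Finset.prod_eq_one (f := fun i => (s i).indicator 1 (g i)),
          mul_one, ← ENNReal.ofReal_prod_of_nonneg (fun _ _ => (Real.exp_pos _).le),
          ← Real.exp_sum, Finset.mul_sum, Finset.sum_neg_distrib]
        intro i _
        rw [Set.indicator_of_mem (hg i (Set.mem_univ i))]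
        rfl
      · rw [Set.indicator_of_notMem hg]
        simp only [Set.mem_pi, Set.mem_univ, true_imp_iff, not_forall] at hg
        obtain ⟨i, hi⟩ := hg
        rw [Finset.prod_eq_zero (f := fun i => (s i).indicator 1 (g i)) (Finset.mem_univ i)
          (Set.indicator_of_notMem hi _), mul_zero]
    have hm : ∀ i, Measurable fun x : ℝ =>
        ENNReal.ofReal (Real.exp (-((c - 1) * x))) * (s i).indicator (1 : ℝ → ENNReal) x :=
      fun i => Measurable.mul (by fun_prop) (measurable_one.indicator (hs i))
    simp_rw [h1]
    rw [lintegral_prod_pi _ hm, Real.rpow_sum_of_pos hc,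
      ENNReal.ofReal_prod_of_nonneg (fun i _ => (Real.rpow_pos_of_pos hc _).le),
      ← Finset.prod_mul_distrib]
    refine Finset.prod_congr rfl fun i _ => ?_
    rw [← lintegral_exp_gammaLaw (hα i) hc (measurable_one.indicator (hs i)),
      Measure.map_apply hdiv (hs i), ← lintegral_indicator_one (hdiv (hs i))]
    rfl
  have h2 : ∫⁻ g, F g ∂(Measure.pi fun i => gammaLaw (α i)) =
      ∫⁻ g, F g ∂(Measure.pi fun i => (gammaLaw (α i)).map (fun x => x / c)) := by
    have : ∀ i, IsProbabilityMeasure ((gammaLaw (α i)).map (fun x => x / c)) := fun i =>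
      Measure.isProbabilityMeasure_map hdiv.aemeasurable
    rw [← Measure.pi_map_pi (f := fun _ x => x / c) fun i => hdiv.aemeasurable,
      lintegral_map hF (by fun_prop)]
    simp_rw [hinv]
  rw [h2, key, lintegral_smul_measure, lintegral_withDensity_eq_lintegral_mul _ hE hF,
    smul_eq_mul, ← mul_assoc, ← ENNReal.ofReal_mul (by positivity), ← Real.rpow_add hc]
  simp

theorem lintegral_Ioi_one_rpow {n : ℝ} (hn : 0 < n) :
    ∫⁻ c in Set.Ioi (1 : ℝ), ENNReal.ofReal (c ^ (-(n + 1))) = ENNReal.ofReal (1 / n) := by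
  rw [← ofReal_integral_eq_lintegral_ofReal]
  · rw [integral_Ioi_rpow_of_lt (by linarith) one_pos]
    congr 1
    rw [Real.one_rpow, neg_add, neg_add_cancel_right, neg_div_neg_eq]
  · exact integrableOn_Ioi_rpow_of_lt (by linarith) one_pos
  · filter_upwards [ae_restrict_mem measurableSet_Ioi] with c hc
    exact Real.rpow_nonneg (zero_le_one.trans (le_of_lt hc)) _

theorem lintegral_Ioi_one_exp {S : ℝ} (hS : 0 < S) :
    ∫⁻ c in Set.Ioi (1 : ℝ), ENNReal.ofReal (Real.exp (-((c - 1) * S))) =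
      ENNReal.ofReal (1 / S) := by
  have h : ∀ c : ℝ, Real.exp (-((c - 1) * S)) = Real.exp S * Real.exp (-S * c) := fun c => by
    rw [← Real.exp_add]; congr 1; ring
  simp_rw [h]
  rw [← ofReal_integral_eq_lintegral_ofReal]
  · rw [integral_const_mul, integral_exp_mul_Ioi (by linarith)]
    congr 1
    rw [mul_one, Real.exp_neg]
    have := (Real.exp_pos S).ne'
    field_simp
  · exact (integrableOn_exp_mul_Ioi (by linarith) 1).const_mul _
  · exact Filter.Eventually.of_forall fun c => by positivity

theorem measurable_normalize :
    Measurable fun (g : ι → ℝ) (i : ι) => g i / ∑ j, g j := by fun_prop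

instance isProbabilityMeasure_dirichlet (α : ι → ℝ) : IsProbabilityMeasure (dirichlet α) :=
  Measure.isProbabilityMeasure_map measurable_normalize.aemeasurable

theorem pi_gammaLaw_ae_sum_pos {α : ι → ℝ} (hs : 0 < ∑ i, α i) :
    ∀ᵐ g ∂(Measure.pi fun i => gammaLaw (α i)), (∀ i, 0 ≤ g i) ∧ 0 < ∑ i, g i := by
  obtain ⟨i, -, hi⟩ : ∃ i ∈ Finset.univ, 0 < α i := by
    by_contra! h
    exact absurd (Finset.sum_nonpos h) (not_le.2 hs)
  have h1 : ∀ᵐ g ∂(Measure.pi fun i => gammaLaw (α i)), ∀ j, 0 ≤ g j :=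
    ae_all_iff.2 fun j => Measure.tendsto_eval_ae_ae.eventually (gammaLaw_ae_nonneg (α j))
  have h2 : ∀ᵐ g ∂(Measure.pi fun i => gammaLaw (α i)), 0 < g i :=
    Measure.tendsto_eval_ae_ae.eventually (gammaLaw_ae_pos hi)
  filter_upwards [h1, h2] with g hg hgi
  exact ⟨hg, Finset.sum_pos' (fun j _ => hg j) ⟨i, Finset.mem_univ i, hgi⟩⟩

theorem dirichlet_ae_mem_stdSimplex {α : ι → ℝ} (hs : 0 < ∑ i, α i) :
    ∀ᵐ p ∂dirichlet α, p ∈ stdSimplex ℝ ι := by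
  unfold dirichlet
  refine (ae_map_iff measurable_normalize.aemeasurable
    (isClosed_stdSimplex (𝕜 := ℝ) ι).measurableSet).2 ?_
  filter_upwards [pi_gammaLaw_ae_sum_pos hs] with g hg
  refine ⟨fun i => div_nonneg (hg.1 i) hg.2.le, ?_⟩
  rw [← Finset.sum_div, div_self hg.2.ne']

theorem integrable_dirichlet_of_continuous {α : ι → ℝ}
    (hs : 0 < ∑ i, α i) {f : (ι → ℝ) → ℝ} (hf : Continuous f) :
    Integrable f (dirichlet α) := by
  obtain ⟨C, hC⟩ := (isCompact_stdSimplex ℝ ι).exists_bound_of_continuousOn hf.continuousOn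
  refine Integrable.of_bound hf.aestronglyMeasurable C ?_
  filter_upwards [dirichlet_ae_mem_stdSimplex hs] with p hp
  exact hC p hp

variable [DecidableEq ι]

/-- Conjugacy of the Dirichlet law: biasing by the probability of the outcome `o` adds one to the
parameter of `o`. The factor `1 / ∑ j, g j` is written as `∫ exp (-s ∑ j, g j) ds`, so that no
independence of the normalized vector and the normalizer is needed. -/
theorem lintegral_mul_dirichlet {α : ι → ℝ} (hα : ∀ i, 0 ≤ α i) (hs : 0 < ∑ i, α i) (o : ι)
    {F : (ι → ℝ) → ENNReal} (hF : Measurable F) :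
    ∫⁻ p, ENNReal.ofReal (p o) * F p ∂dirichlet α =
      ENNReal.ofReal (α o / ∑ i, α i) * ∫⁻ p, F p ∂dirichlet (α + Pi.single o 1) := by
  set F' : (ι → ℝ) → ENNReal := fun g => F fun i => g i / ∑ j, g j with hF'
  have hF'm : Measurable F' := hF.comp measurable_normalize
  have hα' : ∀ i, 0 ≤ (α + Pi.single o 1 : ι → ℝ) i := fun i => by
    by_cases h : i = o
    · subst h; simp; linarith [hα i]
    · simp [h, hα i]
  have hsum : ∑ i, (α + Pi.single o 1 : ι → ℝ) i = ∑ i, α i + 1 := by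
    simp [Finset.sum_add_distrib]
  have hbias : ∀ G : (ι → ℝ) → ENNReal, Measurable G →
      ∫⁻ g, ENNReal.ofReal (g o) * G g ∂(Measure.pi fun i => gammaLaw (α i)) =
        ENNReal.ofReal (α o) *
          ∫⁻ g, G g ∂(Measure.pi fun i => gammaLaw ((α + Pi.single o 1 : ι → ℝ) i)) := by
    intro G hG
    rw [lintegral_pi_update (fun i => gammaLaw (α i)) (fun i => gammaLaw (α i)) o
      (fun _ _ => rfl) (by fun_prop)]
    have h2 := lintegral_pi_update (fun i => gammaLaw (α i))
      (fun i => gammaLaw ((α + Pi.single o 1 : ι → ℝ) i)) o (fun i hi => by simp [hi]) hG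
    refine Eq.trans ?_ (congrArg (ENNReal.ofReal (α o) * ·) h2.symm)
    rw [← lintegral_const_mul]
    · refine lintegral_congr fun g => ?_
      simp only [Function.update_self, Pi.add_apply, Pi.single_eq_same]
      exact lintegral_mul_gammaLaw (hα o)
        (hG.comp ((measurable_update_prod o).comp (measurable_const.prodMk measurable_id)))
    · exact (hG.comp (measurable_update_prod o)).lintegral_prod_right'
  have hEm : Measurable fun q : (ι → ℝ) × ℝ =>
      ENNReal.ofReal (Real.exp (-((q.2 - 1) * ∑ i, q.1 i))) := by fun_prop
  calc ∫⁻ p, ENNReal.ofReal (p o) * F p ∂dirichlet α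
      = ∫⁻ g, ENNReal.ofReal (g o / ∑ j, g j) * F' g
          ∂(Measure.pi fun i => gammaLaw (α i)) := by
        unfold dirichlet
        rw [lintegral_map (by fun_prop) measurable_normalize]
    _ = ∫⁻ g, (∫⁻ c in Set.Ioi (1 : ℝ), ENNReal.ofReal (g o) *
          (ENNReal.ofReal (Real.exp (-((c - 1) * ∑ i, g i))) * F' g))
          ∂(Measure.pi fun i => gammaLaw (α i)) := by
        refine lintegral_congr_ae ?_
        filter_upwards [pi_gammaLaw_ae_sum_pos hs] with g hg
        rw [lintegral_const_mul _ (by fun_prop), lintegral_mul_const _ (by fun_prop),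
          lintegral_Ioi_one_exp hg.2, ← mul_assoc, ← ENNReal.ofReal_mul (hg.1 o), mul_one_div]
    _ = ∫⁻ c in Set.Ioi (1 : ℝ), ∫⁻ g, ENNReal.ofReal (g o) *
          (ENNReal.ofReal (Real.exp (-((c - 1) * ∑ i, g i))) * F' g)
          ∂(Measure.pi fun i => gammaLaw (α i)) := by
        refine lintegral_lintegral_swap (Measurable.aemeasurable ?_)
        exact Measurable.mul (by fun_prop) (hEm.mul (hF'm.comp measurable_fst))
    _ = ∫⁻ c in Set.Ioi (1 : ℝ), ENNReal.ofReal (c ^ (-(∑ i, α i + 1))) *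
          (ENNReal.ofReal (α o) *
          ∫⁻ g, F' g ∂(Measure.pi fun i => gammaLaw ((α + Pi.single o 1 : ι → ℝ) i))) := by
        refine setLIntegral_congr_fun measurableSet_Ioi fun c hc => ?_
        have hc0 : (0 : ℝ) < c := one_pos.trans hc
        rw [hbias _ (by fun_prop), lintegral_exp_pi_gammaLaw hα' hc0 hF'm, hsum]
        · ring
        · intro g
          simp only [hF', ← Finset.sum_div]
          congr 1
          ext i
          rw [div_div_div_cancel_right₀ hc0.ne']
    _ = ENNReal.ofReal (α o / ∑ i, α i) *
          ∫⁻ g, F' g ∂(Measure.pi fun i => gammaLaw ((α + Pi.single o 1 : ι → ℝ) i)) := by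
        rw [lintegral_mul_const _ (by fun_prop), lintegral_Ioi_one_rpow hs, ← mul_assoc,
          ← ENNReal.ofReal_mul (by positivity)]
        congr 2
        ring
    _ = _ := by
        unfold dirichlet
        rw [lintegral_map hF measurable_normalize]

theorem withDensity_dirichlet {α : ι → ℝ} (hα : ∀ i, 0 ≤ α i) (hs : 0 < ∑ i, α i) (o : ι) :
    (dirichlet α).withDensity (fun p => ENNReal.ofReal (p o)) =
      ENNReal.ofReal (α o / ∑ i, α i) • dirichlet (α + Pi.single o 1) := by
  ext s hs'
  rw [withDensity_apply _ hs', ← lintegral_indicator hs', Measure.smul_apply, smul_eq_mul,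
    ← lintegral_indicator_one hs',
    ← lintegral_mul_dirichlet hα hs o (measurable_one.indicator hs')]
  refine lintegral_congr fun p => ?_
  by_cases hp : p ∈ s <;> simp [hp]

theorem integral_mul_dirichlet {α : ι → ℝ} (hα : ∀ i, 0 ≤ α i) (hs : 0 < ∑ i, α i) (o : ι)
    (f : (ι → ℝ) → ℝ) :
    ∫ p, p o * f p ∂dirichlet α =
      α o / (∑ i, α i) * ∫ p, f p ∂dirichlet (α + Pi.single o 1) := by
  have h := integral_withDensity_eq_integral_toReal_smul (μ := dirichlet α)
    (f := fun p => ENNReal.ofReal (p o)) (by fun_prop)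
    (Filter.Eventually.of_forall fun p => ENNReal.ofReal_lt_top) f
  rw [withDensity_dirichlet hα hs o, integral_smul_measure,
    ENNReal.toReal_ofReal (div_nonneg (hα o) hs.le), smul_eq_mul] at h
  rw [h]
  refine integral_congr_ae ?_
  filter_upwards [dirichlet_ae_mem_stdSimplex hs] with p hp
  rw [ENNReal.toReal_ofReal (hp.1 o), smul_eq_mul]

/-- One step of the Pólya urn: a Dirichlet law is the mixture of its posteriors after one
observation. -/
theorem integral_dirichlet_eq_sum {α : ι → ℝ} (hα : ∀ i, 0 ≤ α i) (hs : 0 < ∑ i, α i)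
    {f : (ι → ℝ) → ℝ} (hf : Continuous f) :
    ∫ p, f p ∂dirichlet α =
      ∑ o, α o / (∑ i, α i) * ∫ p, f p ∂dirichlet (α + Pi.single o 1) := by
  simp_rw [← integral_mul_dirichlet hα hs]
  rw [← integral_finsetSum (f := fun o (p : ι → ℝ) => p o * f p) _ fun o _ =>
    integrable_dirichlet_of_continuous hs ((continuous_apply o).mul hf)]
  refine integral_congr_ae ?_
  filter_upwards [dirichlet_ae_mem_stdSimplex hs] with p hp
  rw [← Finset.sum_mul, hp.2, one_mul]

theorem integral_apply_dirichlet {α : ι → ℝ} (hα : ∀ i, 0 ≤ α i) (hs : 0 < ∑ i, α i) (o : ι) :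
    ∫ p, p o ∂dirichlet α = α o / ∑ i, α i := by
  simpa using integral_mul_dirichlet hα hs o fun _ => 1

end Dirichlet

/-! ### Convex order between bounded variables and Gaussians -/

section ConvexOrder

open scoped NNReal

theorem LipschitzWith.integrable_of_id {μ : Measure ℝ} [IsProbabilityMeasure μ]
    (hμ : Integrable (fun x => x) μ) {u : ℝ → ℝ} {C : ℝ≥0} (hu : LipschitzWith C u) :
    Integrable u μ := by
  refine Integrable.mono' ((integrable_const |u 0|).add (hμ.abs.const_mul (C : ℝ)))
    hu.continuous.aestronglyMeasurable (Filter.Eventually.of_forall fun x => ?_)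
  have h := hu.dist_le_mul x 0
  rw [Real.dist_eq, Real.dist_eq, sub_zero] at h
  have h2 := abs_sub_abs_le_abs_sub (u x) (u 0)
  simp only [Pi.add_apply, Real.norm_eq_abs]
  linarith

theorem integrable_id_stdGaussian : Integrable (fun x : ℝ => x) (gaussianReal 0 1) :=
  memLp_one_iff_integrable.1 (memLp_id_gaussianReal 1)

theorem LipschitzWith.integrable_stdGaussian {u : ℝ → ℝ} {C : ℝ≥0} (hu : LipschitzWith C u) :
    Integrable u (gaussianReal 0 1) :=
  hu.integrable_of_id integrable_id_stdGaussian

theorem lipschitzWith_affine (x s : ℝ) : LipschitzWith ‖s‖₊ fun z : ℝ => x + s * z := by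
  refine LipschitzWith.of_dist_le_mul fun a b => ?_
  rw [Real.dist_eq, Real.dist_eq, coe_nnnorm, Real.norm_eq_abs, ← abs_mul]
  exact le_of_eq (congrArg abs (by ring))

theorem ConvexOn.comp_affine_real {u : ℝ → ℝ} (hu : ConvexOn ℝ Set.univ u) (x s : ℝ) :
    ConvexOn ℝ Set.univ fun z : ℝ => u (x + s * z) := by
  refine ⟨convex_univ, fun a _ b _ p q hp hq hpq => ?_⟩
  have h := hu.2 (Set.mem_univ (x + s * a)) (Set.mem_univ (x + s * b)) hp hq hpq
  refine le_trans (le_of_eq (congrArg u ?_)) h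
  simp only [smul_eq_mul]
  linear_combination -x * hpq

theorem integral_neg_stdGaussian (u : ℝ → ℝ) :
    ∫ z, u (-z) ∂gaussianReal 0 1 = ∫ z, u z ∂gaussianReal 0 1 := by
  have h := gaussianReal_map_neg (μ := 0) (v := 1)
  rw [neg_zero] at h
  conv_rhs => rw [← h]
  exact ((MeasurableEquiv.neg ℝ).measurableEmbedding.integral_map u).symm

/-- Left half of the Hermite–Hadamard inequality. -/
theorem ConvexOn.mul_midpoint_le_integral {u : ℝ → ℝ} (hu : ConvexOn ℝ Set.univ u)
    (hc : Continuous u) {a b : ℝ} (hab : a ≤ b) :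
    (b - a) * u ((a + b) / 2) ≤ ∫ x in a..b, u x := by
  have hr : ∫ x in a..b, u (a + b - x) = ∫ x in a..b, u x := by
    rw [intervalIntegral.integral_comp_sub_left]
    congr 1 <;> ring
  have h2 : ∫ _ in a..b, 2 * u ((a + b) / 2) ≤ ∫ x in a..b, (u x + u (a + b - x)) := by
    refine intervalIntegral.integral_mono_on hab (by simp)
      (Continuous.intervalIntegrable (by fun_prop) _ _) fun x _ => ?_
    have := hu.2 (Set.mem_univ x) (Set.mem_univ (a + b - x)) (by norm_num : (0 : ℝ) ≤ 1 / 2)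
      (by norm_num : (0 : ℝ) ≤ 1 / 2) (by norm_num)
    simp only [smul_eq_mul] at this
    rw [show 1 / 2 * x + 1 / 2 * (a + b - x) = (a + b) / 2 by ring] at this
    linarith
  rw [intervalIntegral.integral_add (hc.intervalIntegrable _ _)
    (Continuous.intervalIntegrable (by fun_prop) _ _), hr,
    intervalIntegral.integral_const, smul_eq_mul] at h2
  linarith

/-- A standard Gaussian dominates the uniform law on `[-1, 1]` in the convex order: its density
is at most `1/2`, and relative to the chord over `[-1, 1]` a convex function is nonpositive on this
interval and nonnegative outside of it. -/
theorem half_integral_le_stdGaussian {u : ℝ → ℝ} (hu : ConvexOn ℝ Set.univ u) {C : ℝ≥0}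
    (hL : LipschitzWith C u) :
    (1 / 2) * ∫ x in (-1 : ℝ)..1, u x ≤ ∫ z, u z ∂gaussianReal 0 1 := by
  set p := (u 1 + u (-1)) / 2 with hp
  set q := (u 1 - u (-1)) / 2 with hq
  set w : ℝ → ℝ := fun x => u x - (p + q * x) with hw
  have hwc : Continuous w := hL.continuous.sub (by fun_prop)
  have hlin : Integrable (fun x : ℝ => p + q * x) (gaussianReal 0 1) :=
    (integrable_const p).add (integrable_id_stdGaussian.const_mul q)
  have hwi : Integrable w (gaussianReal 0 1) := hL.integrable_stdGaussian.sub hlin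
  have h1 : ∫ z, w z ∂gaussianReal 0 1 = (∫ z, u z ∂gaussianReal 0 1) - p := by
    rw [integral_sub hL.integrable_stdGaussian hlin,
      integral_add (integrable_const p) (integrable_id_stdGaussian.const_mul q),
      integral_const_mul]
    simp
  have h2 : ∫ x in (-1 : ℝ)..1, w x = (∫ x in (-1 : ℝ)..1, u x) - 2 * p := by
    rw [intervalIntegral.integral_sub (hL.continuous.intervalIntegrable _ _)
      (Continuous.intervalIntegrable (by fun_prop) _ _),
      intervalIntegral.integral_add (by simp)
        (Continuous.intervalIntegrable (by fun_prop) _ _), intervalIntegral.integral_const_mul]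
    simp
    norm_num
  have hin : ∀ x, -1 ≤ x → x ≤ 1 → w x ≤ 0 := fun x hx1 hx2 => by
    have := hu.2 (Set.mem_univ (1 : ℝ)) (Set.mem_univ (-1 : ℝ))
      (by linarith : (0 : ℝ) ≤ (1 + x) / 2) (by linarith : (0 : ℝ) ≤ (1 - x) / 2) (by ring)
    simp only [smul_eq_mul] at this
    rw [show (1 + x) / 2 * 1 + (1 - x) / 2 * -1 = x by ring] at this
    simp only [hw, hp, hq]
    linarith
  have hout1 : ∀ x, 1 < x → 0 ≤ w x := fun x hx => by
    have hx0 : 0 < 1 + x := by linarith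
    have := hu.2 (Set.mem_univ x) (Set.mem_univ (-1 : ℝ))
      (by positivity : (0 : ℝ) ≤ 2 / (1 + x))
      (div_nonneg (by linarith) hx0.le : (0 : ℝ) ≤ (x - 1) / (1 + x)) (by field_simp; ring)
    simp only [smul_eq_mul] at this
    rw [show 2 / (1 + x) * x + (x - 1) / (1 + x) * -1 = 1 by field_simp; ring,
      div_mul_eq_mul_div, div_mul_eq_mul_div, ← add_div, le_div_iff₀ hx0] at this
    simp only [hw, hp, hq]
    linarith
  have hout2 : ∀ x, x < -1 → 0 ≤ w x := fun x hx => by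
    have hx0 : 0 < 1 - x := by linarith
    have := hu.2 (Set.mem_univ x) (Set.mem_univ (1 : ℝ))
      (by positivity : (0 : ℝ) ≤ 2 / (1 - x))
      (div_nonneg (by linarith) hx0.le : (0 : ℝ) ≤ (-1 - x) / (1 - x)) (by field_simp; ring)
    simp only [smul_eq_mul] at this
    rw [show 2 / (1 - x) * x + (-1 - x) / (1 - x) * 1 = -1 by field_simp; ring,
      div_mul_eq_mul_div, div_mul_eq_mul_div, ← add_div, le_div_iff₀ hx0] at this
    simp only [hw, hp, hq]
    linarith
  have hpdf : ∀ x, gaussianPDFReal 0 1 x ≤ 1 / 2 := fun x => by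
    rw [gaussianPDFReal]
    have h4 : (2 : ℝ) ≤ √(2 * Real.pi * (1 : ℝ≥0)) := by
      apply Real.le_sqrt_of_sq_le
      have := Real.pi_gt_three
      simp only [NNReal.coe_one]
      linarith
    have h5 : Real.exp (-(x - 0) ^ 2 / (2 * (1 : ℝ≥0))) ≤ 1 := by
      rw [Real.exp_le_one_iff]
      simp only [NNReal.coe_one]
      have := sq_nonneg (x - 0)
      linarith
    have h6 : (√(2 * Real.pi * (1 : ℝ≥0)))⁻¹ ≤ 1 / 2 := by
      rw [inv_eq_one_div]
      exact one_div_le_one_div_of_le two_pos h4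
    have := mul_le_mul h6 h5 (Real.exp_pos _).le (by norm_num)
    linarith
  have h3 : (1 / 2) * ∫ x in (-1 : ℝ)..1, w x ≤ ∫ z, w z ∂gaussianReal 0 1 := by
    rw [integral_gaussianReal_eq_integral_smul one_ne_zero,
      intervalIntegral.integral_of_le (by norm_num), ← integral_const_mul,
      ← integral_indicator measurableSet_Ioc]
    refine integral_mono ?_ ?_ fun x => ?_
    · rw [integrable_indicator_iff measurableSet_Ioc]
      exact ((hwc.intervalIntegrable (-1) 1).1).const_mul _
    · rw [gaussianReal_of_var_ne_zero _ one_ne_zero,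
        integrable_withDensity_iff_integrable_smul' (measurable_gaussianPDF _ _)
          (Filter.Eventually.of_forall fun _ => gaussianPDF_lt_top)] at hwi
      simpa only [toReal_gaussianPDF] using hwi
    · simp only [smul_eq_mul]
      by_cases hx : x ∈ Set.Ioc (-1 : ℝ) 1
      · rw [Set.indicator_of_mem hx]
        exact mul_le_mul_of_nonpos_right (hpdf x) (hin x hx.1.le hx.2)
      · rw [Set.indicator_of_notMem hx]
        refine mul_nonneg (gaussianPDFReal_nonneg _ _ _) ?_
        rw [Set.mem_Ioc, not_and_or, not_lt, not_le] at hx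
        rcases hx with hx | hx
        · rcases hx.eq_or_lt with rfl | hx
          · simp only [hw, hp, hq]; linarith
          · exact hout2 x hx
        · exact hout1 x hx
  rw [h1, h2] at h3
  linarith

/-- A centred Bernoulli variable is a conditional expectation of a uniform variable on `[-1, 1]`,
hence dominated by a standard Gaussian in the convex order. -/
theorem bernoulli_le_stdGaussian {u : ℝ → ℝ} (hu : ConvexOn ℝ Set.univ u) {C : ℝ≥0}
    (hL : LipschitzWith C u) {m : ℝ} (h0 : 0 ≤ m) (h1 : m ≤ 1) :
    m * u (1 - m) + (1 - m) * u (-m) ≤ ∫ z, u z ∂gaussianReal 0 1 := by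
  refine le_trans ?_ (half_integral_le_stdGaussian hu hL)
  have ha := hu.mul_midpoint_le_integral hL.continuous (show (-1 : ℝ) ≤ 1 - 2 * m by linarith)
  have hb := hu.mul_midpoint_le_integral hL.continuous (show 1 - 2 * m ≤ (1 : ℝ) by linarith)
  rw [show (-1 + (1 - 2 * m)) / 2 = -m by ring] at ha
  rw [show (1 - 2 * m + 1) / 2 = 1 - m by ring] at hb
  rw [← intervalIntegral.integral_add_adjacent_intervals
    (hL.continuous.intervalIntegrable (-1) (1 - 2 * m))
    (hL.continuous.intervalIntegrable (1 - 2 * m) 1)]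
  linarith

/-- A centred variable with values in an interval of length one is dominated by a standard Gaussian
in the convex order, since it is dominated by a Bernoulli variable. -/
theorem sum_centred_le_stdGaussian {ι : Type*} [Fintype ι] {u : ℝ → ℝ}
    (hu : ConvexOn ℝ Set.univ u) {C : ℝ≥0} (hL : LipschitzWith C u) {w f : ι → ℝ}
    (hw : w ∈ stdSimplex ℝ ι) (hf0 : ∀ i, 0 ≤ f i) (hf1 : ∀ i, f i ≤ 1) (x s : ℝ) :
    ∑ i, w i * u (x + s * (f i - ∑ j, w j * f j)) ≤ ∫ z, u (x + s * z) ∂gaussianReal 0 1 := by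
  set m := ∑ j, w j * f j with hm
  have hm0 : 0 ≤ m := Finset.sum_nonneg fun i _ => mul_nonneg (hw.1 i) (hf0 i)
  have hm1 : m ≤ 1 := by
    rw [← hw.2]
    exact Finset.sum_le_sum fun i _ => mul_le_of_le_one_right (hw.1 i) (hf1 i)
  have hg := hu.comp_affine_real x s
  refine le_trans ?_ (bernoulli_le_stdGaussian hg (hL.comp (lipschitzWith_affine x s)) hm0 hm1)
  have hi : ∀ i ∈ Finset.univ, w i * u (x + s * (f i - m)) ≤
      w i * f i * u (x + s * (1 - m)) + (w i - w i * f i) * u (x + s * -m) := fun i _ => by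
    have := hg.2 (Set.mem_univ (1 - m)) (Set.mem_univ (-m)) (hf0 i)
      (sub_nonneg.2 (hf1 i)) (by ring)
    simp only [smul_eq_mul] at this
    rw [show f i * (1 - m) + (1 - f i) * -m = f i - m by ring] at this
    have := mul_le_mul_of_nonneg_left this (hw.1 i)
    linarith
  refine (Finset.sum_le_sum hi).trans (le_of_eq ?_)
  rw [Finset.sum_add_distrib, ← Finset.sum_mul, ← Finset.sum_mul, Finset.sum_sub_distrib, hw.2]

theorem map_prod_stdGaussian {a b c : ℝ} (h : a ^ 2 + b ^ 2 = c ^ 2) :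
    ((gaussianReal 0 1).prod (gaussianReal 0 1)).map (fun q : ℝ × ℝ => a * q.1 + b * q.2) =
      (gaussianReal 0 1).map (c * ·) := by
  have h1 : ((gaussianReal 0 1).map (a * ·)) ∗ ((gaussianReal 0 1).map (b * ·)) =
      (gaussianReal 0 1).map (c * ·) := by
    rw [gaussianReal_map_const_mul, gaussianReal_map_const_mul, gaussianReal_map_const_mul,
      gaussianReal_conv_gaussianReal]
    congr 1
    · simp
    · ext
      simpa using h
  rw [← h1, Measure.conv, Measure.map_prod_map _ _ (by fun_prop) (by fun_prop),
    Measure.map_map (by fun_prop) (by fun_prop)]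
  rfl

theorem ConvexOn.integral_mul_stdGaussian_mono {u : ℝ → ℝ} (hu : ConvexOn ℝ Set.univ u) {C : ℝ≥0}
    (hL : LipschitzWith C u) (x : ℝ) {d c : ℝ} (hd : 0 ≤ d) (hdc : d ≤ c) :
    ∫ z, u (x + d * z) ∂gaussianReal 0 1 ≤ ∫ z, u (x + c * z) ∂gaussianReal 0 1 := by
  rcases hd.eq_or_lt with rfl | hd
  · have := hu.map_integral_le (μ := gaussianReal 0 1) (f := fun z => x + c * z)
      hL.continuous.continuousOn isClosed_univ (by simp)
      ((integrable_const x).add (integrable_id_stdGaussian.const_mul c))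
      (hL.comp (lipschitzWith_affine x c)).integrable_stdGaussian
    rw [integral_add (integrable_const x) (integrable_id_stdGaussian.const_mul c),
      integral_const_mul] at this
    simpa using this
  have hc : 0 < c := hd.trans_le hdc
  have hi : ∀ s : ℝ, Integrable (fun z => u (x + s * z)) (gaussianReal 0 1) := fun s =>
    (hL.comp (lipschitzWith_affine x s)).integrable_stdGaussian
  have hneg : ∫ z, u (x + -c * z) ∂gaussianReal 0 1 = ∫ z, u (x + c * z) ∂gaussianReal 0 1 := by
    rw [← integral_neg_stdGaussian fun z => u (x + c * z)]
    simp
  set p := (1 + d / c) / 2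
  set q := (1 - d / c) / 2
  have hp : 0 ≤ p := by positivity
  have hq : 0 ≤ q := div_nonneg (sub_nonneg.2 ((div_le_one hc).2 hdc)) two_pos.le
  have hpq : p + q = 1 := by simp only [p, q]; ring
  calc ∫ z, u (x + d * z) ∂gaussianReal 0 1
      ≤ ∫ z, (p * u (x + c * z) + q * u (x + -c * z)) ∂gaussianReal 0 1 := by
        refine integral_mono (hi d) (((hi c).const_mul p).add ((hi (-c)).const_mul q))
          fun z => ?_
        have := hu.2 (Set.mem_univ (x + c * z)) (Set.mem_univ (x + -c * z)) hp hq hpq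
        simp only [smul_eq_mul] at this
        refine le_trans (le_of_eq (congrArg u ?_)) this
        have : p - q = d / c := by simp only [p, q]; ring
        have h3 : (p - q) * c = d := by rw [this]; field_simp
        linear_combination (-x) * hpq - z * h3
    _ = ∫ z, u (x + c * z) ∂gaussianReal 0 1 := by
        rw [integral_add ((hi c).const_mul p) ((hi (-c)).const_mul q), integral_const_mul,
          integral_const_mul, hneg, ← add_mul, hpq, one_mul]

theorem integral_integral_stdGaussian_le {u : ℝ → ℝ} (hu : ConvexOn ℝ Set.univ u) {C : ℝ≥0}
    (hL : LipschitzWith C u) (x : ℝ) {a b c : ℝ} (hc : 0 ≤ c) (h : a ^ 2 + b ^ 2 ≤ c ^ 2) :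
    ∫ z, ∫ z', u (x + a * z + b * z') ∂gaussianReal 0 1 ∂gaussianReal 0 1 ≤
      ∫ z, u (x + c * z) ∂gaussianReal 0 1 := by
  set d := √(a ^ 2 + b ^ 2)
  have hd : a ^ 2 + b ^ 2 = d ^ 2 := (Real.sq_sqrt (by positivity)).symm
  have hdc : d ≤ c := Real.sqrt_le_iff.2 ⟨hc, h⟩
  refine le_trans (le_of_eq ?_)
    (hu.integral_mul_stdGaussian_mono hL x (Real.sqrt_nonneg (a ^ 2 + b ^ 2)) hdc)
  have hm := map_prod_stdGaussian hd
  have hux : Continuous fun t => u (x + t) := hL.continuous.comp (by fun_prop)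
  have hi : Integrable (fun t => u (x + t)) ((gaussianReal 0 1).map (d * ·)) := by
    rw [integrable_map_measure hux.aestronglyMeasurable (by fun_prop)]
    exact (hL.comp (lipschitzWith_affine x d)).integrable_stdGaussian
  have h1 : ∫ z, u (x + d * z) ∂gaussianReal 0 1 =
      ∫ t, u (x + t) ∂((gaussianReal 0 1).map (d * ·)) := by
    rw [integral_map (by fun_prop) hux.aestronglyMeasurable]
  rw [h1]
  rw [← hm] at hi ⊢
  rw [integral_map (by fun_prop) hux.aestronglyMeasurable, integral_prod]
  · simp_rw [add_assoc]
  · exact hi.comp_measurable (by fun_prop)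

theorem LipschitzWith.integral_add_stdGaussian {u : ℝ → ℝ} {C : ℝ≥0} (hL : LipschitzWith C u)
    (s : ℝ) : LipschitzWith C fun x => ∫ z, u (x + s * z) ∂gaussianReal 0 1 := by
  have hi : ∀ x : ℝ, Integrable (fun z => u (x + s * z)) (gaussianReal 0 1) := fun x =>
    (hL.comp (lipschitzWith_affine x s)).integrable_stdGaussian
  refine LipschitzWith.of_dist_le_mul fun x y => ?_
  rw [Real.dist_eq, ← integral_sub (hi x) (hi y)]
  refine (abs_integral_le_integral_abs).trans ?_
  calc ∫ z, |u (x + s * z) - u (y + s * z)| ∂gaussianReal 0 1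
      ≤ ∫ _, C * dist x y ∂gaussianReal 0 1 := by
        refine integral_mono ((hi x).sub (hi y)).abs (integrable_const _) fun z => ?_
        have := hL.dist_le_mul (x + s * z) (y + s * z)
        rwa [Real.dist_eq, dist_add_right] at this
    _ = _ := by simp

theorem ConvexOn.integral_add_stdGaussian {u : ℝ → ℝ} (hu : ConvexOn ℝ Set.univ u) {C : ℝ≥0}
    (hL : LipschitzWith C u) (s : ℝ) :
    ConvexOn ℝ Set.univ fun x => ∫ z, u (x + s * z) ∂gaussianReal 0 1 := by
  have hi : ∀ x : ℝ, Integrable (fun z => u (x + s * z)) (gaussianReal 0 1) := fun x =>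
    (hL.comp (lipschitzWith_affine x s)).integrable_stdGaussian
  refine ⟨convex_univ, fun x _ y _ p q hp hq hpq => ?_⟩
  simp only [smul_eq_mul]
  rw [← integral_const_mul, ← integral_const_mul,
    ← integral_add ((hi x).const_mul p) ((hi y).const_mul q)]
  refine integral_mono (hi _) (((hi x).const_mul p).add ((hi y).const_mul q)) fun z => ?_
  have := hu.2 (Set.mem_univ (x + s * z)) (Set.mem_univ (y + s * z)) hp hq hpq
  simp only [smul_eq_mul] at this
  refine le_trans (le_of_eq (congrArg u ?_)) this
  linear_combination (-s * z) * hpq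

end ConvexOrder

/-! ### Gaussian domination of Dirichlet averages -/

section DirichletGaussian

open scoped NNReal

theorem add_single_nonneg {ι : Type*} [DecidableEq ι] {α : ι → ℝ} (hα : ∀ i, 0 ≤ α i) (o : ι) :
    ∀ i, 0 ≤ (α + Pi.single o 1 : ι → ℝ) i := fun i => by
  by_cases h : i = o
  · subst h; simp; linarith [hα i]
  · simp [h, hα i]

variable {ι : Type*} [Fintype ι] [DecidableEq ι]

theorem integral_sum_mul_dirichlet {α : ι → ℝ} (hα : ∀ i, 0 ≤ α i) (hs : 0 < ∑ i, α i)
    (f : ι → ℝ) : ∫ p, ∑ i, p i * f i ∂dirichlet α = (∑ i, α i * f i) / ∑ i, α i := by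
  rw [integral_finsetSum (f := fun i (p : ι → ℝ) => p i * f i) _ fun i _ =>
    integrable_dirichlet_of_continuous hs (by fun_prop), Finset.sum_div]
  refine Finset.sum_congr rfl fun i _ => ?_
  rw [integral_mul_const, integral_apply_dirichlet hα hs]
  ring

theorem sum_add_single (α : ι → ℝ) (o : ι) :
    ∑ i, (α + Pi.single o 1 : ι → ℝ) i = ∑ i, α i + 1 := by
  simp [Finset.sum_add_distrib]

theorem sum_add_single_mul (α f : ι → ℝ) (o : ι) :
    ∑ i, (α + Pi.single o 1 : ι → ℝ) i * f i = ∑ i, α i * f i + f o := by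
  simp [add_mul, Finset.sum_add_distrib, Pi.single_apply]

/-- A crude variance bound for Dirichlet averages. -/
theorem integral_sq_sum_mul_dirichlet_le {α : ι → ℝ} (hα : ∀ i, 0 ≤ α i) (hs : 0 < ∑ i, α i)
    {f : ι → ℝ} (hf0 : ∀ i, 0 ≤ f i) (hf1 : ∀ i, f i ≤ 1) :
    ∫ p, (∑ i, p i * f i - (∑ i, α i * f i) / ∑ i, α i) ^ 2 ∂dirichlet α ≤
      1 / ∑ i, α i := by
  set n := ∑ i, α i with hn
  set m := (∑ i, α i * f i) / n with hm
  have hnm : ∑ i, α i * f i = n * m := by rw [hm]; field_simp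
  have hm0 : 0 ≤ m := div_nonneg (Finset.sum_nonneg fun i _ => mul_nonneg (hα i) (hf0 i)) hs.le
  have hint : ∀ g : (ι → ℝ) → ℝ, Continuous g → Integrable g (dirichlet α) := fun g hg =>
    integrable_dirichlet_of_continuous hs hg
  have hsq : ∫ p, (∑ i, p i * f i) ^ 2 ∂dirichlet α ≤ (n * m ^ 2 + m) / (n + 1) := by
    have h1 : ∀ p : ι → ℝ, (∑ i, p i * f i) ^ 2 = ∑ o, p o * (f o * ∑ i, p i * f i) := by
      intro p
      rw [sq, Finset.sum_mul]
      exact Finset.sum_congr rfl fun o _ => by ring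
    simp_rw [h1]
    rw [integral_finsetSum (f := fun o (p : ι → ℝ) => p o * (f o * ∑ i, p i * f i)) _
      fun o _ => hint _ (by fun_prop)]
    have h2 : ∀ o ∈ Finset.univ, ∫ p, p o * (f o * ∑ i, p i * f i) ∂dirichlet α ≤
        (α o * f o) * ((n * m + 1) / (n * (n + 1))) := fun o _ => by
      rw [integral_mul_dirichlet hα hs, integral_const_mul,
        integral_sum_mul_dirichlet (add_single_nonneg hα o) (by rw [sum_add_single]; linarith),
        sum_add_single, sum_add_single_mul, ← hn, hnm]
      have h3 : n * m + f o ≤ n * m + 1 := by linarith [hf1 o]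
      have h4 : 0 ≤ α o * f o := mul_nonneg (hα o) (hf0 o)
      calc α o / n * (f o * ((n * m + f o) / (n + 1)))
          = (α o * f o) * ((n * m + f o) / (n * (n + 1))) := by field_simp
        _ ≤ _ := by gcongr
    refine (Finset.sum_le_sum h2).trans (le_of_eq ?_)
    rw [← Finset.sum_mul, hnm]
    field_simp
  have hexp : ∫ p, (∑ i, p i * f i - m) ^ 2 ∂dirichlet α =
      (∫ p, (∑ i, p i * f i) ^ 2 ∂dirichlet α) - m ^ 2 := by
    have h1 : ∀ p : ι → ℝ, (∑ i, p i * f i - m) ^ 2 =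
        (∑ i, p i * f i) ^ 2 - 2 * m * (∑ i, p i * f i) + m ^ 2 := fun p => by ring
    simp_rw [h1]
    rw [integral_add (hint _ (by fun_prop)) (hint _ (by fun_prop)),
      integral_sub (hint _ (by fun_prop)) (hint _ (by fun_prop)), integral_const_mul,
      integral_sum_mul_dirichlet hα hs, ← hm]
    simp
    ring
  rw [hexp]
  have h5 : (n * m ^ 2 + m) / (n + 1) - m ^ 2 ≤ 1 / n := by
    rw [div_sub' (by positivity), div_le_div_iff₀ (by positivity) hs]
    nlinarith [sq_nonneg (m - 1), sq_nonneg m, mul_nonneg hs.le (sq_nonneg m),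
      mul_nonneg hs.le (sq_nonneg (m - 1))]
  linarith

theorem integral_abs_sum_mul_dirichlet_le {α : ι → ℝ} (hα : ∀ i, 0 ≤ α i) (hs : 0 < ∑ i, α i)
    {f : ι → ℝ} (hf0 : ∀ i, 0 ≤ f i) (hf1 : ∀ i, f i ≤ 1) :
    ∫ p, |∑ i, p i * f i - (∑ i, α i * f i) / ∑ i, α i| ∂dirichlet α ≤
      1 / √(∑ i, α i) := by
  set n := ∑ i, α i with hn
  set m := (∑ i, α i * f i) / n with hm
  have hr : 0 < √n := Real.sqrt_pos.2 hs
  have hint : ∀ g : (ι → ℝ) → ℝ, Continuous g → Integrable g (dirichlet α) := fun g hg =>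
    integrable_dirichlet_of_continuous hs hg
  calc ∫ p, |∑ i, p i * f i - m| ∂dirichlet α
      ≤ ∫ p, (√n / 2 * (∑ i, p i * f i - m) ^ 2 + 1 / (2 * √n)) ∂dirichlet α := by
        refine integral_mono (hint _ (by fun_prop)) (hint _ (by fun_prop)) fun p => ?_
        simp only
        generalize ∑ i, p i * f i - m = x
        have h2 : √n / 2 * x ^ 2 + 1 / (2 * √n) = ((√n * |x|) ^ 2 + 1) / (2 * √n) := by
          rw [mul_pow, sq_abs]; field_simp
        rw [h2, le_div_iff₀ (by positivity)]
        nlinarith [sq_nonneg (√n * |x| - 1)]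
    _ = √n / 2 * (∫ p, (∑ i, p i * f i - m) ^ 2 ∂dirichlet α) + 1 / (2 * √n) := by
        rw [integral_add (hint _ (by fun_prop)) (integrable_const _), integral_const_mul]
        simp
    _ ≤ √n / 2 * (1 / n) + 1 / (2 * √n) := by
        gcongr
        exact integral_sq_sum_mul_dirichlet_le hα hs hf0 hf1
    _ = 1 / √n := by
        have : n = √n ^ 2 := (Real.sq_sqrt hs.le).symm
        rw [this, Real.sqrt_sq hr.le]
        field_simp
        ring

/-- Gaussian domination up to the error of stopping the Pólya urn after `k` draws, when the
composition of the urn replaces its random limit. Each draw moves the composition by a centred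
bounded amount, which is exchanged for a Gaussian one. -/
theorem integral_dirichlet_le_stdGaussian_add {u : ℝ → ℝ} (hu : ConvexOn ℝ Set.univ u) {C : ℝ≥0}
    (hL : LipschitzWith C u) {f : ι → ℝ} (hf0 : ∀ i, 0 ≤ f i) (hf1 : ∀ i, f i ≤ 1) (k : ℕ) :
    ∀ {α : ι → ℝ}, (∀ i, 0 ≤ α i) → 0 < ∑ i, α i →
      ∫ p, u (∑ i, p i * f i) ∂dirichlet α ≤
        ∫ z, u ((∑ i, α i * f i) / (∑ i, α i) + 1 / √(∑ i, α i) * z) ∂gaussianReal 0 1 +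
          C / √(∑ i, α i + k) := by
  have hcont : Continuous fun p : ι → ℝ => u (∑ i, p i * f i) :=
    hL.continuous.comp (by fun_prop)
  induction k with
  | zero =>
    intro α hα hs
    set n := ∑ i, α i with hn
    set m := (∑ i, α i * f i) / n with hm
    have h1 : u m ≤ ∫ z, u (m + 1 / √n * z) ∂gaussianReal 0 1 := by
      have := hu.integral_mul_stdGaussian_mono hL m le_rfl (by positivity : 0 ≤ 1 / √n)
      simpa using this
    have h2 : ∫ p, u (∑ i, p i * f i) ∂dirichlet α ≤
        ∫ p, (u m + C * |∑ i, p i * f i - m|) ∂dirichlet α := by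
      refine integral_mono (integrable_dirichlet_of_continuous hs hcont)
        (integrable_dirichlet_of_continuous hs (by fun_prop)) fun p => ?_
      have := hL.dist_le_mul (∑ i, p i * f i) m
      rw [Real.dist_eq, Real.dist_eq] at this
      have := le_abs_self (u (∑ i, p i * f i) - u m)
      simp only
      linarith
    rw [integral_add (integrable_const _)
      (integrable_dirichlet_of_continuous hs (by fun_prop)), integral_const_mul] at h2
    have h3 := mul_le_mul_of_nonneg_left (integral_abs_sum_mul_dirichlet_le hα hs hf0 hf1) C.2
    simp only [integral_const, probReal_univ, one_smul] at h2
    simp only [NNReal.val_eq_coe, mul_one_div, ← hn, ← hm] at h3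
    simp only [Nat.cast_zero, add_zero]
    linarith
  | succ k ih =>
    intro α hα hs
    rw [integral_dirichlet_eq_sum hα hs hcont]
    set n := ∑ i, α i with hn
    set m := (∑ i, α i * f i) / n with hm
    have hnm : ∑ i, α i * f i = n * m := by rw [hm]; field_simp
    have hw : (fun o => α o / n) ∈ stdSimplex ℝ ι :=
      ⟨fun o => div_nonneg (hα o) hs.le, by rw [← Finset.sum_div, div_self hs.ne']⟩
    have hwm : ∑ o, α o / n * f o = m := by
      rw [hm, Finset.sum_div]
      exact Finset.sum_congr rfl fun o _ => by ring
    set v : ℝ → ℝ := fun x => ∫ z, u (x + 1 / √(n + 1) * z) ∂gaussianReal 0 1 with hv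
    have hvL : LipschitzWith C v := hL.integral_add_stdGaussian _
    have hstep : ∀ o ∈ Finset.univ, α o / n *
        ∫ p, u (∑ i, p i * f i) ∂dirichlet (α + Pi.single o 1) ≤
        α o / n * v (m + 1 / (n + 1) * (f o - m)) + α o / n * (C / √(n + (k + 1 : ℕ))) := by
      intro o _
      have := ih (add_single_nonneg hα o) (by rw [sum_add_single]; linarith)
      rw [sum_add_single, sum_add_single_mul, ← hn, hnm] at this
      rw [← mul_add]
      refine mul_le_mul_of_nonneg_left (this.trans (le_of_eq ?_)) (hw.1 o)
      have e1 : (n * m + f o) / (n + 1) = m + 1 / (n + 1) * (f o - m) := by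
        field_simp; ring
      have e2 : n + 1 + (k : ℝ) = n + (k + 1 : ℕ) := by push_cast; ring
      rw [e1, e2]
    refine (Finset.sum_le_sum hstep).trans ?_
    rw [Finset.sum_add_distrib, ← Finset.sum_mul, hw.2, one_mul]
    gcongr
    have h4 := sum_centred_le_stdGaussian (hu.integral_add_stdGaussian hL (1 / √(n + 1))) hvL hw
      hf0 hf1 m (1 / (n + 1))
    rw [hwm] at h4
    refine h4.trans ?_
    refine integral_integral_stdGaussian_le hu hL m (by positivity) ?_
    -- `1 / (n + 1) ^ 2 + 1 / (n + 1) ≤ 1 / n`: the variance budget of one urn step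
    rw [div_pow, div_pow, div_pow, Real.sq_sqrt (by positivity), Real.sq_sqrt hs.le,
      div_add_div _ _ (by positivity) (by positivity),
      div_le_div_iff₀ (by positivity) hs]
    nlinarith

/-- **Gaussian–Dirichlet domination.** In the convex order, the mean of `f` under a random
Dirichlet distribution is dominated by a Gaussian of the same mean and variance
`1 / ∑ i, α i`, if `f` takes values in `[0, 1]`. -/
theorem integral_dirichlet_le_stdGaussian {u : ℝ → ℝ} (hu : ConvexOn ℝ Set.univ u) {C : ℝ≥0}
    (hL : LipschitzWith C u) {f : ι → ℝ} (hf0 : ∀ i, 0 ≤ f i) (hf1 : ∀ i, f i ≤ 1)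
    {α : ι → ℝ} (hα : ∀ i, 0 ≤ α i) (hs : 0 < ∑ i, α i) :
    ∫ p, u (∑ i, p i * f i) ∂dirichlet α ≤
      ∫ z, u ((∑ i, α i * f i) / (∑ i, α i) + 1 / √(∑ i, α i) * z) ∂gaussianReal 0 1 := by
  refine ge_of_tendsto' (x := Filter.atTop) (f := fun k : ℕ =>
    ∫ z, u ((∑ i, α i * f i) / (∑ i, α i) + 1 / √(∑ i, α i) * z) ∂gaussianReal 0 1 +
          C / √(∑ i, α i + k)) ?_
    fun k => integral_dirichlet_le_stdGaussian_add hu hL hf0 hf1 k hα hs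
  have h : Filter.Tendsto (fun k : ℕ => (C : ℝ) / √(∑ i, α i + k)) Filter.atTop (nhds 0) :=
    Filter.Tendsto.div_atTop tendsto_const_nhds (Real.tendsto_sqrt_atTop.comp
      (Filter.tendsto_atTop_add_const_left _ _ tendsto_natCast_atTop_atTop))
  simpa using h.const_add
    (∫ z, u ((∑ i, α i * f i) / (∑ i, α i) + 1 / √(∑ i, α i) * z) ∂gaussianReal 0 1)

end DirichletGaussian

/-! ### Finite Markov chains of records -/

section Chains

variable {S B : Type*}

/-- The state before step `t` of the chain of records `b` started in `s`, where `nxt` reads the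
next state off a record. -/
def chainState (nxt : B → S) {n : ℕ} (s : S) (b : Fin n → B) (t : Fin n) : S :=
  if t.val = 0 then s else nxt (b ⟨t.val - 1, by omega⟩)

/-- The probability of the records `b` under the kernels `K`, started in `s`. -/
def chainProb (nxt : B → S) {n : ℕ} (K : Fin n → S → B → ℝ) (s : S) (b : Fin n → B) : ℝ :=
  ∏ t, K t (chainState nxt s b t) (b t)

variable (nxt : B → S) {n : ℕ}

theorem chainState_cons_zero (s : S) (b₀ : B) (b : Fin n → B) :
    chainState nxt s (Fin.cons b₀ b : Fin (n + 1) → B) 0 = s := by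
  simp [chainState]

theorem chainState_cons_succ (s : S) (b₀ : B) (b : Fin n → B) (t : Fin n) :
    chainState nxt s (Fin.cons b₀ b : Fin (n + 1) → B) t.succ = chainState nxt (nxt b₀) b t := by
  rcases t with ⟨_ | k, hk⟩
  · simp [chainState]
  · simp only [chainState, Fin.succ_mk]
    rw [if_neg (by omega), if_neg (by omega)]
    rfl

theorem chainProb_cons (K : Fin (n + 1) → S → B → ℝ) (s : S) (b₀ : B) (b : Fin n → B) :
    chainProb nxt K s (Fin.cons b₀ b : Fin (n + 1) → B) =
      K 0 s b₀ * chainProb nxt (fun t => K t.succ) (nxt b₀) b := by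
  simp [chainProb, Fin.prod_univ_succ, chainState_cons_zero, chainState_cons_succ]

variable [Fintype B]

theorem sum_fin_succ_arrow (g : (Fin (n + 1) → B) → ℝ) :
    ∑ b, g b = ∑ b₀, ∑ b, g (Fin.cons b₀ b) := by
  rw [← (Fin.consEquiv fun _ : Fin (n + 1) => B).sum_comp, Fintype.sum_prod_type]
  rfl

theorem sum_chainProb (K : Fin n → S → B → ℝ) (hK : ∀ t s, ∑ b, K t s b = 1) (s : S) :
    ∑ b, chainProb nxt K s b = 1 := by
  induction n generalizing s with
  | zero => simp [chainProb]
  | succ n ih =>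
    rw [sum_fin_succ_arrow]
    simp_rw [chainProb_cons, ← Finset.mul_sum]
    rw [Finset.sum_congr rfl fun b₀ _ => by
      rw [ih (fun t => K t.succ) (fun t => hK t.succ) (nxt b₀), mul_one]]
    exact hK 0 s

/-- A function of the record of step `t` may be replaced by its conditional expectation given the
state before that step. -/
theorem sum_chainProb_mul (K : Fin n → S → B → ℝ) (hK : ∀ t s, ∑ b, K t s b = 1) (s : S)
    (t : Fin n) (f : B → ℝ) :
    ∑ b, chainProb nxt K s b * f (b t) =
      ∑ b, chainProb nxt K s b * ∑ b', K t (chainState nxt s b t) b' * f b' := by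
  induction n generalizing s with
  | zero => exact t.elim0
  | succ n ih =>
    rw [sum_fin_succ_arrow, sum_fin_succ_arrow]
    simp_rw [chainProb_cons, mul_assoc]
    refine Fin.cases ?_ (fun t => ?_) t
    · simp_rw [chainState_cons_zero, Fin.cons_zero, ← Finset.mul_sum, ← Finset.sum_mul]
      have h1 : ∀ b₀, ∑ b, chainProb nxt (fun t => K t.succ) (nxt b₀) b = 1 := fun b₀ =>
        sum_chainProb nxt (fun t => K t.succ) (fun t => hK t.succ) (nxt b₀)
      simp_rw [h1, one_mul]
      rw [← Finset.sum_mul, hK 0 s, one_mul]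
    · simp_rw [chainState_cons_succ, Fin.cons_succ, ← Finset.mul_sum]
      exact Finset.sum_congr rfl fun b₀ _ => by
        rw [ih (fun t => K t.succ) (fun t => hK t.succ) (nxt b₀) t]

end Chains

/-! ### Trajectories and values of policies -/

section Trajectories

variable {H : ℕ} {X A : Type*} [Fintype X] [DecidableEq X] [Fintype A] [DecidableEq A]

/-- The transition kernel of actions and outcomes when the policy `π` is followed in `M`. -/
def policyKernel (M : MDP H X A) (π : Policy H X A) (t : Fin H) (s : X) (b : A × Outcome X) : ℝ :=
  if b.1 = π t s then M (t, s, b.1) b.2 else 0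

theorem trajProb_eq_chainProb (ρ : X → ℝ) (M : MDP H X A) (π : Policy H X A)
    (τ : Trajectory H X A) :
    trajProb ρ M π τ =
      ρ τ.1 * chainProb (fun b : A × Outcome X => b.2.2) (policyKernel M π) τ.1 τ.2 :=
  rfl

theorem sum_policyKernel_mul (M : MDP H X A) (π : Policy H X A) (t : Fin H) (s : X)
    (f : A × Outcome X → ℝ) :
    ∑ b, policyKernel M π t s b * f b = ∑ o, M (t, s, π t s) o * f (π t s, o) := by
  rw [Fintype.sum_prod_type, Finset.sum_eq_single (π t s)]
  · simp [policyKernel]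
  · intro a _ ha
    simp [policyKernel, ha]
  · simp

theorem sum_policyKernel {M : MDP H X A} (hM : ∀ y, M y ∈ stdSimplex ℝ (Outcome X))
    (π : Policy H X A) (t : Fin H) (s : X) : ∑ b, policyKernel M π t s b = 1 := by
  simpa [(hM _).2] using sum_policyKernel_mul M π t s fun _ => 1

theorem trajProb_nonneg {ρ : X → ℝ} (hρ : ∀ x, 0 ≤ ρ x) {M : MDP H X A}
    (hM : ∀ y, M y ∈ stdSimplex ℝ (Outcome X)) (π : Policy H X A) (τ : Trajectory H X A) :
    0 ≤ trajProb ρ M π τ := by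
  refine mul_nonneg (hρ _) (Finset.prod_nonneg fun t _ => ?_)
  split_ifs
  · exact (hM _).1 _
  · exact le_rfl

theorem trajProb_eq_zero {ρ : X → ℝ} {M : MDP H X A} {π : Policy H X A} {τ : Trajectory H X A}
    {t : Fin H} (h : τ.action t ≠ π t (τ.state t)) : trajProb ρ M π τ = 0 := by
  unfold trajProb
  rw [Finset.prod_eq_zero (Finset.mem_univ t) (if_neg h), mul_zero]

theorem sum_trajProb (ρ : X → ℝ) {M : MDP H X A} (hM : ∀ y, M y ∈ stdSimplex ℝ (Outcome X))
    (π : Policy H X A) : ∑ τ, trajProb ρ M π τ = ∑ x, ρ x := by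
  rw [Fintype.sum_prod_type]
  simp_rw [trajProb_eq_chainProb, ← Finset.mul_sum,
    sum_chainProb _ _ (sum_policyKernel hM π), mul_one]

theorem sum_trajProb_mul_initial (ρ : X → ℝ) {M : MDP H X A}
    (hM : ∀ y, M y ∈ stdSimplex ℝ (Outcome X)) (π : Policy H X A) (f : X → ℝ) :
    ∑ τ, trajProb ρ M π τ * f τ.1 = ∑ x, ρ x * f x := by
  rw [← sum_trajProb (fun x => ρ x * f x) hM π]
  exact Finset.sum_congr rfl fun τ _ => by unfold trajProb; ring

theorem sum_trajProb_mul_outcome (ρ : X → ℝ) {M : MDP H X A}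
    (hM : ∀ y, M y ∈ stdSimplex ℝ (Outcome X)) (π : Policy H X A) (t : Fin H)
    (f : Outcome X → ℝ) :
    ∑ τ, trajProb ρ M π τ * f (τ.outcome t) =
      ∑ τ, trajProb ρ M π τ * ∑ o, M (t, τ.state t, τ.action t) o * f o := by
  have h1 : ∀ τ : Trajectory H X A,
      trajProb ρ M π τ * ∑ o, M (t, τ.state t, τ.action t) o * f o =
      trajProb ρ M π τ * ∑ b, policyKernel M π t (τ.state t) b * f b.2 := by
    intro τ
    by_cases h : τ.action t = π t (τ.state t)
    · rw [sum_policyKernel_mul M π t (τ.state t) fun b => f b.2, ← h]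
    · rw [trajProb_eq_zero h, zero_mul, zero_mul]
  rw [Finset.sum_congr rfl fun τ _ => h1 τ, Fintype.sum_prod_type, Fintype.sum_prod_type]
  refine Finset.sum_congr rfl fun x _ => ?_
  simp_rw [trajProb_eq_chainProb, mul_assoc, ← Finset.mul_sum]
  congr 1
  exact sum_chainProb_mul (fun b : A × Outcome X => b.2.2) (policyKernel M π)
    (sum_policyKernel hM π) x t fun b => f b.2

theorem Trajectory.sum_telescope (τ : Trajectory H X A) (V : ℕ → X → ℝ) (hV : ∀ x, V H x = 0) :
    ∑ t : Fin H, (V t (τ.state t) - V (t + 1) (τ.outcome t).2) = V 0 τ.1 := by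
  set z : ℕ → ℝ := fun t =>
    if t = 0 then V 0 τ.1 else if h : t - 1 < H then V t (τ.2 ⟨t - 1, h⟩).2.2 else 0 with hz
  have h1 : ∀ t : Fin H, V t (τ.state t) - V (t + 1) (τ.outcome t).2 = z t - z (t + 1) := by
    intro t
    congr 1
    · simp only [hz, Trajectory.state]
      by_cases h : t.val = 0
      · simp [h]
      · have : t.val - 1 < H := by omega
        simp [h, this]
    · simp [hz, Trajectory.outcome]
  rw [Finset.sum_congr rfl fun t _ => h1 t,
    Fin.sum_univ_eq_sum_range (fun t => z t - z (t + 1)), Finset.sum_range_sub']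
  have h0 : z 0 = V 0 τ.1 := by simp [hz]
  have hH : H ≠ 0 → z H = 0 := fun h => by simp [hz, h, hV]
  rcases Nat.eq_zero_or_pos H with rfl | h
  · simp [h0, hV]
  · rw [h0, hH h.ne', sub_zero]

/-- The expected return of `π`, as the gap between `V 0` and the accumulated expected one-step
Bellman errors of an arbitrary sequence `V` of functions that vanishes at the horizon. -/
theorem sum_trajProb_mul_return (ρ : X → ℝ) {M : MDP H X A}
    (hM : ∀ y, M y ∈ stdSimplex ℝ (Outcome X)) (π : Policy H X A) (V : ℕ → X → ℝ)
    (hV : ∀ x, V H x = 0) :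
    ∑ τ, trajProb ρ M π τ * ∑ t : Fin H, reward (τ.outcome t) =
      ∑ x, ρ x * V 0 x - ∑ τ, trajProb ρ M π τ * ∑ t : Fin H, (V t (τ.state t) -
        ∑ o, M (t, τ.state t, τ.action t) o * (reward o + V (t + 1) o.2)) := by
  have h1 : ∑ τ, trajProb ρ M π τ * ∑ t : Fin H,
        ∑ o, M (t, τ.state t, τ.action t) o * (reward o + V (t + 1) o.2) =
      ∑ τ, trajProb ρ M π τ * ∑ t : Fin H,
        (reward (τ.outcome t) + V (t + 1) (τ.outcome t).2) := by
    simp_rw [Finset.mul_sum (Finset.univ : Finset (Fin H))]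
    rw [Finset.sum_comm, Finset.sum_comm (γ := Trajectory H X A)]
    exact Finset.sum_congr rfl fun t _ =>
      (sum_trajProb_mul_outcome ρ hM π t fun o => reward o + V (t + 1) o.2).symm
  simp_rw [Finset.sum_sub_distrib (s := (Finset.univ : Finset (Fin H))), mul_sub]
  rw [Finset.sum_sub_distrib, h1, ← sum_trajProb_mul_initial ρ hM π (V 0),
    ← Finset.sum_sub_distrib, ← Finset.sum_sub_distrib]
  refine Finset.sum_congr rfl fun τ _ => ?_
  have h := τ.sum_telescope V hV
  rw [Finset.sum_sub_distrib] at h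
  rw [Finset.sum_add_distrib]
  linear_combination (trajProb ρ M π τ) * h

theorem sum_mul_value (ρ : X → ℝ) (M : MDP H X A) (π : Policy H X A) :
    ∑ x, ρ x * value M π x =
      ∑ τ, trajProb ρ M π τ * ∑ t : Fin H, reward (τ.outcome t) := by
  unfold value
  simp_rw [Finset.mul_sum (Finset.univ : Finset (Trajectory H X A))]
  rw [Finset.sum_comm]
  refine Finset.sum_congr rfl fun τ _ => ?_
  simp [trajProb, mul_assoc]

theorem reward_nonneg (o : Outcome X) : 0 ≤ reward o := by
  unfold reward; split_ifs <;> norm_num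

theorem reward_le_one (o : Outcome X) : reward o ≤ 1 := by
  unfold reward; split_ifs <;> norm_num

theorem value_nonneg {M : MDP H X A} (hM : ∀ y, M y ∈ stdSimplex ℝ (Outcome X))
    (π : Policy H X A) (x : X) : 0 ≤ value M π x :=
  Finset.sum_nonneg fun τ _ => mul_nonneg
    (trajProb_nonneg (fun x' => by split_ifs <;> norm_num) hM π τ)
    (Finset.sum_nonneg fun t _ => reward_nonneg _)

theorem value_le {M : MDP H X A} (hM : ∀ y, M y ∈ stdSimplex ℝ (Outcome X))
    (π : Policy H X A) (x : X) : value M π x ≤ H := by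
  calc value M π x
      ≤ ∑ τ : Trajectory H X A, trajProb (fun x' => if x' = x then 1 else 0) M π τ * H := by
        refine Finset.sum_le_sum fun τ _ => mul_le_mul_of_nonneg_left ?_
          (trajProb_nonneg (fun x' => by split_ifs <;> norm_num) hM π τ)
        refine (Finset.sum_le_sum fun t _ => reward_le_one (τ.outcome t)).trans (le_of_eq ?_)
        simp
    _ = H := by
        rw [← Finset.sum_mul, sum_trajProb _ hM]
        simp

theorem value_le_optValue (M : MDP H X A) (π : Policy H X A) (x : X) :
    value M π x ≤ optValue M x :=
  le_ciSup (f := fun π => value M π x) (Set.finite_range _).bddAbove π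

theorem optValue_le [Nonempty A] {M : MDP H X A} (hM : ∀ y, M y ∈ stdSimplex ℝ (Outcome X))
    (x : X) : optValue M x ≤ H :=
  ciSup_le fun π => value_le hM π x

end Trajectories

/-! ### Posterior updates and the Bayesian regret as a sum over histories -/

section Posterior

variable {H : ℕ} {X A : Type*} [Fintype X] [DecidableEq X] [Fintype A] [DecidableEq A]

instance isProbabilityMeasure_prior (α : Fin H × X × A → Outcome X → ℝ) :
    IsProbabilityMeasure (prior α) := by
  unfold prior; infer_instance

theorem prior_ae_mem_stdSimplex {α : Fin H × X × A → Outcome X → ℝ}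
    (hs : ∀ y, 0 < ∑ o, α y o) :
    ∀ᵐ M ∂prior α, ∀ y, M y ∈ stdSimplex ℝ (Outcome X) :=
  ae_all_iff.2 fun y => Measure.tendsto_eval_ae_ae.eventually (dirichlet_ae_mem_stdSimplex (hs y))

theorem integrable_prior_of_continuous {α : Fin H × X × A → Outcome X → ℝ}
    (hs : ∀ y, 0 < ∑ o, α y o) {f : MDP H X A → ℝ} (hf : Continuous f) :
    Integrable f (prior α) := by
  obtain ⟨C, hC⟩ := (isCompact_univ_pi fun _ : Fin H × X × A =>
    isCompact_stdSimplex ℝ (Outcome X)).exists_bound_of_continuousOn hf.continuousOn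
  refine Integrable.of_bound hf.aestronglyMeasurable C ?_
  filter_upwards [prior_ae_mem_stdSimplex hs] with M hM
  exact hC M fun y _ => hM y

theorem continuous_trajProb (ρ : X → ℝ) (π : Policy H X A) (τ : Trajectory H X A) :
    Continuous fun M : MDP H X A => trajProb ρ M π τ := by
  unfold trajProb
  refine continuous_const.mul (continuous_finsetProd _ fun t _ => ?_)
  split_ifs <;> fun_prop

theorem continuous_value (π : Policy H X A) (x : X) :
    Continuous fun M : MDP H X A => value M π x := by
  unfold value
  exact continuous_finsetSum _ fun τ _ => (continuous_trajProb _ π τ).mul continuous_const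

theorem continuous_ciSup_fintype {ι E : Type*} [Fintype ι] [Nonempty ι] [TopologicalSpace E]
    {f : ι → E → ℝ} (hf : ∀ i, Continuous (f i)) : Continuous fun x => ⨆ i, f i x := by
  have : (fun x => ⨆ i, f i x) =
      fun x => Finset.univ.sup' Finset.univ_nonempty fun i => f i x := by
    ext x; rw [Finset.sup'_univ_eq_ciSup]
  rw [this]
  exact Continuous.finset_sup'_apply _ fun i _ => hf i

theorem continuous_optValue [Nonempty A] (x : X) :
    Continuous fun M : MDP H X A => optValue M x :=
  continuous_ciSup_fintype fun π => continuous_value π x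

theorem continuous_historyProb (ρ : X → ℝ) (agent : Agent H X A) {ℓ : ℕ} (h : History H X A ℓ) :
    Continuous fun M : MDP H X A => historyProb ρ agent M h := by
  unfold historyProb
  exact continuous_finsetProd _ fun k _ => continuous_finsetSum _ fun π _ =>
    continuous_const.mul (continuous_trajProb ρ π (h k))

theorem continuous_regret [Nonempty A] (ρ : X → ℝ) (agent : Agent H X A) (L : ℕ) :
    Continuous fun M : MDP H X A => regret ρ agent L M := by
  unfold regret
  refine continuous_finsetSum _ fun ℓ _ => continuous_finsetSum _ fun h _ =>
    (continuous_historyProb ρ agent h).mul (continuous_finsetSum _ fun π _ =>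
      continuous_const.mul (continuous_finsetSum _ fun x _ => continuous_const.mul
        ((continuous_optValue x).sub (continuous_value π x))))

/-- The number of times, zero or one, that `τ` records the outcome `o` of the action `y.2.2` in
the state `y.2.1` in period `y.1`. -/
def visitCount (τ : Trajectory H X A) (y : Fin H × X × A) (o : Outcome X) : ℝ :=
  if τ.state y.1 = y.2.1 ∧ τ.action y.1 = y.2.2 ∧ τ.outcome y.1 = o then 1 else 0

/-- The Dirichlet parameters of the posterior after the history `h`. -/
def postParam (α : Fin H × X × A → Outcome X → ℝ) {ℓ : ℕ} (h : History H X A ℓ)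
    (y : Fin H × X × A) (o : Outcome X) : ℝ :=
  α y o + ∑ k, visitCount (h k) y o

/-- The mean of a product of Dirichlet laws with parameters `α`. -/
def meanMDP (α : Fin H × X × A → Outcome X → ℝ) : MDP H X A :=
  fun y o => α y o / ∑ o', α y o'

theorem visitCount_nonneg (τ : Trajectory H X A) (y : Fin H × X × A) (o : Outcome X) :
    0 ≤ visitCount τ y o := by
  unfold visitCount; split_ifs <;> norm_num

theorem postParam_nonneg {α : Fin H × X × A → Outcome X → ℝ} (hα : ∀ y o, 0 ≤ α y o) {ℓ : ℕ}
    (h : History H X A ℓ) (y : Fin H × X × A) (o : Outcome X) : 0 ≤ postParam α h y o :=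
  add_nonneg (hα y o) (Finset.sum_nonneg fun _ _ => visitCount_nonneg _ _ _)

theorem sum_postParam_pos {α : Fin H × X × A → Outcome X → ℝ}
    (hs : ∀ y, 0 < ∑ o, α y o) {ℓ : ℕ} (h : History H X A ℓ) (y : Fin H × X × A) :
    0 < ∑ o, postParam α h y o :=
  (hs y).trans_le (Finset.sum_le_sum fun _ _ => le_add_of_nonneg_right
    (Finset.sum_nonneg fun _ _ => visitCount_nonneg _ _ _))

theorem sum_visitCount_mul (τ : Trajectory H X A) (y : Fin H × X × A) (f : Outcome X → ℝ) :
    ∑ o, visitCount τ y o * f o =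
      if τ.state y.1 = y.2.1 ∧ τ.action y.1 = y.2.2 then f (τ.outcome y.1) else 0 := by
  unfold visitCount
  by_cases h : τ.state y.1 = y.2.1 ∧ τ.action y.1 = y.2.2
  · simp [h]
  · rw [if_neg h]
    exact Finset.sum_eq_zero fun o _ => by
      rw [if_neg fun h' => h ⟨h'.1, h'.2.1⟩, zero_mul]

theorem sum_postParam_mul (α : Fin H × X × A → Outcome X → ℝ) {ℓ : ℕ} (h : History H X A ℓ)
    (y : Fin H × X × A) (f : Outcome X → ℝ) :
    ∑ o, postParam α h y o * f o =
      ∑ o, α y o * f o + ∑ k ∈ visits h y, f ((h k).outcome y.1) := by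
  unfold postParam visits
  simp_rw [add_mul, Finset.sum_add_distrib, Finset.sum_mul]
  rw [Finset.sum_comm, Finset.sum_filter]
  simp_rw [sum_visitCount_mul]

theorem sum_postParam (α : Fin H × X × A → Outcome X → ℝ) {ℓ : ℕ} (h : History H X A ℓ)
    (y : Fin H × X × A) :
    ∑ o, postParam α h y o = ∑ o, α y o + (visits h y).card := by
  simpa using sum_postParam_mul α h y fun _ => 1

theorem postParam_snoc (α : Fin H × X × A → Outcome X → ℝ) {ℓ : ℕ} (h : History H X A ℓ)
    (τ : Trajectory H X A) :
    postParam α (Fin.snoc h τ : History H X A (ℓ + 1)) =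
      fun y o => postParam α h y o + visitCount τ y o := by
  ext y o
  simp [postParam, Fin.sum_univ_castSucc, add_assoc]

theorem meanMDP_mem_stdSimplex {α : Fin H × X × A → Outcome X → ℝ} (hα : ∀ y o, 0 ≤ α y o)
    (hs : ∀ y, 0 < ∑ o, α y o) (y : Fin H × X × A) :
    meanMDP α y ∈ stdSimplex ℝ (Outcome X) :=
  ⟨fun o => div_nonneg (hα y o) (hs y).le, by
    simp only [meanMDP]; rw [← Finset.sum_div, div_self (hs y).ne']⟩

theorem integral_mul_prior {α : Fin H × X × A → Outcome X → ℝ} (hα : ∀ y o, 0 ≤ α y o)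
    (hs : ∀ y, 0 < ∑ o, α y o) (y : Fin H × X × A) (o : Outcome X) {f : MDP H X A → ℝ}
    (hf : Continuous f) :
    ∫ M, M y o * f M ∂prior α =
      meanMDP α y o * ∫ M, f M ∂prior (Function.update α y (α y + Pi.single o 1)) := by
  have hs' : ∀ y', 0 < ∑ o', Function.update α y (α y + Pi.single o 1) y' o' := by
    intro y'
    by_cases h : y' = y
    · subst h
      rw [Function.update_self, sum_add_single]
      linarith [hs y']
    · rw [Function.update_of_ne h]; exact hs y'
  have h1 := integral_pi_update (fun y => dirichlet (α y)) (fun y => dirichlet (α y)) y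
    (fun _ _ => rfl) (F := fun M : MDP H X A => M y o * f M)
    (integrable_prior_of_continuous hs (by fun_prop))
  have h2 := integral_pi_update (fun y => dirichlet (α y))
    (fun y' => dirichlet (Function.update α y (α y + Pi.single o 1) y')) y
    (fun i hi => by rw [Function.update_of_ne hi]) (F := f)
    (integrable_prior_of_continuous hs' hf)
  unfold prior
  rw [h1, h2, ← integral_const_mul]
  refine integral_congr_ae (Filter.Eventually.of_forall fun M => ?_)
  simp only [Function.update_self]
  rw [integral_mul_dirichlet (hα y) (hs y)]
  rfl

/-- Conjugacy for one trajectory: its probability, as a likelihood, turns the prior into the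
posterior. The factors are treated one by one, which is possible because the trajectory meets at
most one state-action pair in every period. -/
theorem integral_prod_mul_prior {α : Fin H × X × A → Outcome X → ℝ} (hα : ∀ y o, 0 ≤ α y o)
    (hs : ∀ y, 0 < ∑ o, α y o) (τ : Trajectory H X A) (T : Finset (Fin H)) :
    ∀ {f : MDP H X A → ℝ}, Continuous f →
    ∫ M, (∏ t ∈ T, M (t, τ.state t, τ.action t) (τ.outcome t)) * f M ∂prior α =
      (∏ t ∈ T, meanMDP α (t, τ.state t, τ.action t) (τ.outcome t)) *
        ∫ M, f M ∂prior fun y o => α y o + if y.1 ∈ T then visitCount τ y o else 0 := by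
  induction T using Finset.induction_on with
  | empty => intro f _; simp
  | insert t T ht ih =>
    intro f hf
    set α' : Fin H × X × A → Outcome X → ℝ :=
      fun y o => α y o + if y.1 ∈ T then visitCount τ y o else 0 with hα'
    have hle : ∀ y o, α y o ≤ α' y o := fun y o => by
      simp only [hα']
      split_ifs
      · linarith [visitCount_nonneg τ y o]
      · linarith
    have h0 : ∀ y o, 0 ≤ α' y o := fun y o => (hα y o).trans (hle y o)
    have hs' : ∀ y, 0 < ∑ o, α' y o := fun y =>
      (hs y).trans_le (Finset.sum_le_sum fun o _ => hle y o)
    set y := (t, τ.state t, τ.action t) with hy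
    have hαy : α' y = α y := by
      ext o
      simp [hα', hy, ht]
    have hup : Function.update α' y (α' y + Pi.single (τ.outcome t) 1) =
        fun y o => α y o + if y.1 ∈ insert t T then visitCount τ y o else 0 := by
      ext y' o
      by_cases h : y' = y
      · subst h
        rw [Function.update_self, hαy]
        simp [hy, visitCount, Pi.single_apply, eq_comm]
      · rw [Function.update_of_ne h]
        simp only [hα', Finset.mem_insert]
        by_cases h1 : y'.1 = t
        · have h2 : visitCount τ y' o = 0 := by
            unfold visitCount
            rw [if_neg]
            rintro ⟨h3, h4, -⟩
            refine h ?_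
            rw [hy, ← h1, h3, h4]
          simp [h2]
        · simp [h1]
    have h1 := ih (f := fun M => M y (τ.outcome t) * f M) (by fun_prop)
    rw [integral_mul_prior h0 hs' y (τ.outcome t) hf, hup] at h1
    rw [Finset.prod_insert ht]
    calc _ = ∫ M, (∏ t ∈ T, M (t, τ.state t, τ.action t) (τ.outcome t)) *
          (M y (τ.outcome t) * f M) ∂prior α := by
          refine integral_congr_ae (Filter.Eventually.of_forall fun M => ?_)
          simp only
          rw [Finset.prod_insert ht]
          ring
      _ = _ := by
          rw [h1]
          have : meanMDP α' y (τ.outcome t) = meanMDP α y (τ.outcome t) := by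
            simp only [meanMDP, hαy]
          rw [this]
          ring

theorem integral_trajProb_mul_prior {α : Fin H × X × A → Outcome X → ℝ}
    (hα : ∀ y o, 0 ≤ α y o) (hs : ∀ y, 0 < ∑ o, α y o) (ρ : X → ℝ) (π : Policy H X A)
    (τ : Trajectory H X A) {f : MDP H X A → ℝ} (hf : Continuous f) :
    ∫ M, trajProb ρ M π τ * f M ∂prior α =
      trajProb ρ (meanMDP α) π τ *
        ∫ M, f M ∂prior fun y o => α y o + visitCount τ y o := by
  by_cases h : ∀ t, τ.action t = π t (τ.state t)
  · have h1 : ∀ M : MDP H X A, trajProb ρ M π τ =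
        ρ τ.1 * ∏ t, M (t, τ.state t, τ.action t) (τ.outcome t) := fun M => by
      unfold trajProb
      exact congrArg _ (Finset.prod_congr rfl fun t _ => if_pos (h t))
    have h2 := integral_prod_mul_prior hα hs τ Finset.univ hf
    simp only [Finset.mem_univ, if_true] at h2
    simp_rw [h1, mul_assoc]
    rw [integral_const_mul, h2]
  · push Not at h
    obtain ⟨t, ht⟩ := h
    simp [trajProb_eq_zero ht]

theorem integral_value_prior {α : Fin H × X × A → Outcome X → ℝ}
    (hα : ∀ y o, 0 ≤ α y o) (hs : ∀ y, 0 < ∑ o, α y o) (π : Policy H X A) (x : X) :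
    ∫ M, value M π x ∂prior α = value (meanMDP α) π x := by
  unfold value
  rw [integral_finsetSum (f := fun τ (M : MDP H X A) =>
      trajProb (fun x' => if x' = x then 1 else 0) M π τ * ∑ t, reward (τ.outcome t)) _
    fun τ _ => integrable_prior_of_continuous hs ((continuous_trajProb _ π τ).mul continuous_const)]
  refine Finset.sum_congr rfl fun τ _ => ?_
  rw [integral_trajProb_mul_prior hα hs _ π τ continuous_const]
  simp

/-- The probability of the trajectory `τ` in `M` when the policy is drawn from `w`. -/
def mixProb (ρ : X → ℝ) (w : Policy H X A → ℝ) (M : MDP H X A) (τ : Trajectory H X A) : ℝ :=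
  ∑ π, w π * trajProb ρ M π τ

theorem historyProb_snoc (ρ : X → ℝ) (agent : Agent H X A) (M : MDP H X A) {ℓ : ℕ}
    (h : History H X A ℓ) (τ : Trajectory H X A) :
    historyProb ρ agent M (Fin.snoc h τ : History H X A (ℓ + 1)) =
      historyProb ρ agent M h * mixProb ρ (agent ℓ h) M τ := by
  unfold historyProb mixProb
  rw [Fin.prod_univ_castSucc]
  congr 1
  · refine Finset.prod_congr rfl fun k _ => ?_
    rw [Fin.snoc_castSucc]
    congr 1
    ext π
    congr 2
    ext j : 1
    exact Fin.snoc_castSucc (α := fun _ => Trajectory H X A) τ h (Fin.castLE k.isLt.le j)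
  · refine Finset.sum_congr rfl fun π _ => ?_
    rw [Fin.snoc_last]
    congr 2
    ext j : 1
    exact Fin.snoc_castSucc (α := fun _ => Trajectory H X A) τ h j

theorem sum_history_succ {ℓ : ℕ} (g : History H X A (ℓ + 1) → ℝ) :
    ∑ h, g h = ∑ h : History H X A ℓ, ∑ τ, g (Fin.snoc h τ : History H X A (ℓ + 1)) := by
  rw [← (Fin.snocEquiv fun _ : Fin (ℓ + 1) => Trajectory H X A).sum_comp,
    Fintype.sum_prod_type, Finset.sum_comm]
  rfl

/-- The probability of the history `h`, averaged over the prior. -/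
def predProb (ρ : X → ℝ) (α : Fin H × X × A → Outcome X → ℝ) (agent : Agent H X A) {ℓ : ℕ}
    (h : History H X A ℓ) : ℝ :=
  ∫ M, historyProb ρ agent M h ∂prior α

theorem integral_mixProb_mul_prior {α : Fin H × X × A → Outcome X → ℝ}
    (hα : ∀ y o, 0 ≤ α y o) (hs : ∀ y, 0 < ∑ o, α y o) (ρ : X → ℝ) (w : Policy H X A → ℝ)
    (τ : Trajectory H X A) {f : MDP H X A → ℝ} (hf : Continuous f) :
    ∫ M, mixProb ρ w M τ * f M ∂prior α =
      mixProb ρ w (meanMDP α) τ * ∫ M, f M ∂prior fun y o => α y o + visitCount τ y o := by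
  unfold mixProb
  simp_rw [Finset.sum_mul, mul_assoc]
  rw [integral_finsetSum (f := fun π (M : MDP H X A) => w π * (trajProb ρ M π τ * f M)) _
    fun π _ => (integrable_prior_of_continuous hs ((continuous_trajProb _ π τ).mul hf)).const_mul _]
  refine Finset.sum_congr rfl fun π _ => ?_
  rw [integral_const_mul, integral_trajProb_mul_prior hα hs ρ π τ hf]

theorem continuous_mixProb (ρ : X → ℝ) (w : Policy H X A → ℝ) (τ : Trajectory H X A) :
    Continuous fun M : MDP H X A => mixProb ρ w M τ :=
  continuous_finsetSum _ fun π _ => continuous_const.mul (continuous_trajProb ρ π τ)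

/-- Bayes' rule: weighting the prior by the likelihood of a history gives the posterior. -/
theorem integral_historyProb_mul {α : Fin H × X × A → Outcome X → ℝ}
    (hα : ∀ y o, 0 ≤ α y o) (hs : ∀ y, 0 < ∑ o, α y o) (ρ : X → ℝ) (agent : Agent H X A) {ℓ : ℕ} :
    ∀ (h : History H X A ℓ) {f : MDP H X A → ℝ}, Continuous f →
      ∫ M, historyProb ρ agent M h * f M ∂prior α =
        predProb ρ α agent h * ∫ M, f M ∂prior (postParam α h) := by
  induction ℓ with
  | zero =>
    intro h f _
    have : postParam α h = α := by ext y o; simp [postParam]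
    simp [historyProb, predProb, this]
  | succ ℓ ih =>
    intro h f hf
    obtain ⟨h, τ, rfl⟩ : ∃ (h' : History H X A ℓ) (τ : Trajectory H X A), Fin.snoc h' τ = h :=
      ⟨Fin.init h, h (Fin.last ℓ), Fin.snoc_init_self h⟩
    have key : ∀ {g : MDP H X A → ℝ}, Continuous g →
        ∫ M, historyProb ρ agent M (Fin.snoc h τ : History H X A (ℓ + 1)) * g M ∂prior α =
          predProb ρ α agent h * mixProb ρ (agent ℓ h) (meanMDP (postParam α h)) τ *
            ∫ M, g M ∂prior (postParam α (Fin.snoc h τ : History H X A (ℓ + 1))) := by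
      intro g hg
      simp_rw [historyProb_snoc, mul_assoc]
      rw [ih h (f := fun M => mixProb ρ (agent ℓ h) M τ * g M)
        ((continuous_mixProb ρ _ τ).mul hg),
        integral_mixProb_mul_prior (postParam_nonneg hα h) (sum_postParam_pos hs h) ρ _ τ hg,
        postParam_snoc]
    rw [key hf]
    have h1 := key (g := fun _ => 1) continuous_const
    simp only [mul_one, integral_const, probReal_univ, smul_eq_mul] at h1
    unfold predProb at h1 ⊢
    rw [h1]

theorem predProb_snoc {α : Fin H × X × A → Outcome X → ℝ}
    (hα : ∀ y o, 0 ≤ α y o) (hs : ∀ y, 0 < ∑ o, α y o) (ρ : X → ℝ) (agent : Agent H X A) {ℓ : ℕ}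
    (h : History H X A ℓ) (τ : Trajectory H X A) :
    predProb ρ α agent (Fin.snoc h τ : History H X A (ℓ + 1)) =
      predProb ρ α agent h * mixProb ρ (agent ℓ h) (meanMDP (postParam α h)) τ := by
  have h1 := integral_historyProb_mul hα hs ρ agent h (f := fun M => mixProb ρ (agent ℓ h) M τ)
    (continuous_mixProb ρ _ τ)
  have h2 := integral_mixProb_mul_prior (postParam_nonneg hα h) (sum_postParam_pos hs h) ρ
    (agent ℓ h) τ (f := fun _ => 1) continuous_const
  simp only [mul_one, integral_const, probReal_univ, smul_eq_mul] at h2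
  rw [h2] at h1
  rw [← h1]
  unfold predProb
  simp_rw [historyProb_snoc]

theorem predProb_zero (ρ : X → ℝ) (α : Fin H × X × A → Outcome X → ℝ) (agent : Agent H X A)
    (h : History H X A 0) : predProb ρ α agent h = 1 := by
  simp [predProb, historyProb]

theorem mixProb_nonneg {ρ : X → ℝ} (hρ : ∀ x, 0 ≤ ρ x) {w : Policy H X A → ℝ}
    (hw : ∀ π, 0 ≤ w π) {M : MDP H X A} (hM : ∀ y, M y ∈ stdSimplex ℝ (Outcome X))
    (τ : Trajectory H X A) : 0 ≤ mixProb ρ w M τ :=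
  Finset.sum_nonneg fun π _ => mul_nonneg (hw π) (trajProb_nonneg hρ hM π τ)

theorem predProb_nonneg {ρ : X → ℝ} (hρ : ∀ x, 0 ≤ ρ x) {α : Fin H × X × A → Outcome X → ℝ}
    (hs : ∀ y, 0 < ∑ o, α y o) {agent : Agent H X A}
    (hag : ∀ (ℓ : ℕ) (h : History H X A ℓ) π, 0 ≤ agent ℓ h π) {ℓ : ℕ} (h : History H X A ℓ) :
    0 ≤ predProb ρ α agent h := by
  refine integral_nonneg_of_ae ?_
  filter_upwards [prior_ae_mem_stdSimplex hs] with M hM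
  exact Finset.prod_nonneg fun k _ => mixProb_nonneg hρ (hag _ _) hM _

/-- The Bayesian regret as a finite sum over histories: given the history, the unknown MDP may be
replaced by the posterior mean in the value of the policy that is followed. -/
theorem bayesRegret_eq [Nonempty A] {α : Fin H × X × A → Outcome X → ℝ}
    (hα : ∀ y o, 0 ≤ α y o) (hs : ∀ y, 0 < ∑ o, α y o) (ρ : X → ℝ) (agent : Agent H X A) (L : ℕ) :
    bayesRegret ρ α agent L = ∑ ℓ ∈ Finset.range L, ∑ h : History H X A ℓ,
      predProb ρ α agent h * ∑ π, agent ℓ h π * ∑ x, ρ x *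
        (∫ M, optValue M x ∂prior (postParam α h) - value (meanMDP (postParam α h)) π x) := by
  unfold bayesRegret regret
  have hc : ∀ (ℓ : ℕ) (h : History H X A ℓ), Continuous fun M : MDP H X A =>
      ∑ π, agent ℓ h π * ∑ x, ρ x * (optValue M x - value M π x) := fun ℓ h =>
    continuous_finsetSum _ fun π _ =>
      continuous_const.mul (continuous_finsetSum _ fun x _ => continuous_const.mul
        ((continuous_optValue x).sub (continuous_value π x)))
  rw [integral_finsetSum (f := fun ℓ (M : MDP H X A) => ∑ h : History H X A ℓ,
    historyProb ρ agent M h * ∑ π, agent ℓ h π * ∑ x, ρ x * (optValue M x - value M π x)) _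
    fun ℓ _ => integrable_prior_of_continuous hs (continuous_finsetSum _ fun h _ =>
      (continuous_historyProb ρ agent h).mul (hc ℓ h))]
  refine Finset.sum_congr rfl fun ℓ _ => ?_
  rw [integral_finsetSum (f := fun h (M : MDP H X A) =>
    historyProb ρ agent M h * ∑ π, agent ℓ h π * ∑ x, ρ x * (optValue M x - value M π x)) _
    fun h _ => integrable_prior_of_continuous hs
      ((continuous_historyProb ρ agent h).mul (hc ℓ h))]
  refine Finset.sum_congr rfl fun h _ => ?_
  rw [integral_historyProb_mul hα hs ρ agent h (hc ℓ h)]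
  congr 1
  have hs' := sum_postParam_pos hs h
  rw [integral_finsetSum (f := fun π (M : MDP H X A) =>
    agent ℓ h π * ∑ x, ρ x * (optValue M x - value M π x)) _
    fun π _ => integrable_prior_of_continuous hs' (continuous_const.mul
      (continuous_finsetSum _ fun x _ => continuous_const.mul
        ((continuous_optValue x).sub (continuous_value π x))))]
  refine Finset.sum_congr rfl fun π _ => ?_
  rw [integral_const_mul, integral_finsetSum (f := fun x (M : MDP H X A) =>
    ρ x * (optValue M x - value M π x)) _
    fun x _ => integrable_prior_of_continuous hs' (continuous_const.mul
        ((continuous_optValue x).sub (continuous_value π x)))]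
  congr 1
  refine Finset.sum_congr rfl fun x _ => ?_
  rw [integral_const_mul, integral_sub (integrable_prior_of_continuous hs' (continuous_optValue x))
    (integrable_prior_of_continuous hs' (continuous_value π x)),
    integral_value_prior (postParam_nonneg hα h) hs']

end Posterior

/-! ### Increasing convex order of product laws -/

section IncreasingConvexOrder

open scoped NNReal

variable {ι : Type*} [Fintype ι]

theorem LipschitzWith.integrable_pi {μ : ι → Measure ℝ} [∀ i, IsProbabilityMeasure (μ i)]
    (hμ : ∀ i, Integrable (fun x => x) (μ i)) {u : (ι → ℝ) → ℝ} {C : ℝ≥0}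
    (hu : LipschitzWith C u) : Integrable u (Measure.pi μ) := by
  have h1 : ∀ i, Integrable (fun x : ι → ℝ => x i) (Measure.pi μ) := fun i =>
    integrable_eval (hμ i)
  refine Integrable.mono' ((integrable_const |u 0|).add
    ((integrable_finsetSum Finset.univ fun i _ => (h1 i).abs).const_mul (C : ℝ)))
    hu.continuous.aestronglyMeasurable (Filter.Eventually.of_forall fun x => ?_)
  have h := hu.dist_le_mul x 0
  rw [Real.dist_eq, dist_zero_right] at h
  have h2 := abs_sub_abs_le_abs_sub (u x) (u 0)
  have h3 : ‖x‖ ≤ ∑ i, |x i| :=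
    (pi_norm_le_iff_of_nonneg (Finset.sum_nonneg fun i _ => abs_nonneg (x i))).2 fun i =>
      Finset.single_le_sum (f := fun i => |x i|) (fun i _ => abs_nonneg _) (Finset.mem_univ i)
  have h4 := mul_le_mul_of_nonneg_left h3 C.2
  simp only [Pi.add_apply, Real.norm_eq_abs, NNReal.val_eq_coe] at *
  linarith

theorem lipschitzWith_update [DecidableEq ι] (x : ι → ℝ) (i : ι) :
    LipschitzWith 1 fun z : ℝ => Function.update x i z := by
  refine LipschitzWith.of_dist_le_mul fun a b => ?_
  rw [NNReal.coe_one, one_mul, dist_pi_le_iff dist_nonneg]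
  intro j
  by_cases h : j = i
  · subst h; simp
  · simp [Function.update_of_ne h]

/-- If every factor of a product of laws on `ℝ` is dominated in the increasing convex order, then
so is the product. -/
theorem integral_pi_le_of_forall [DecidableEq ι] {κ ν : ι → Measure ℝ}
    [∀ i, IsProbabilityMeasure (κ i)] [∀ i, IsProbabilityMeasure (ν i)]
    (hκ : ∀ i, Integrable (fun x => x) (κ i)) (hν : ∀ i, Integrable (fun x => x) (ν i))
    (h : ∀ i (w : ℝ → ℝ) (C : ℝ≥0), ConvexOn ℝ Set.univ w → Monotone w → LipschitzWith C w →
      ∫ z, w z ∂κ i ≤ ∫ z, w z ∂ν i)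
    {u : (ι → ℝ) → ℝ} {C : ℝ≥0} (huc : ConvexOn ℝ Set.univ u) (hum : Monotone u)
    (hul : LipschitzWith C u) : ∫ x, u x ∂Measure.pi κ ≤ ∫ x, u x ∂Measure.pi ν := by
  have main : ∀ T : Finset ι, ∫ x, u x ∂Measure.pi κ ≤
      ∫ x, u x ∂Measure.pi fun i => if i ∈ T then ν i else κ i := by
    intro T
    induction T using Finset.induction_on with
    | empty => simp
    | insert i T hi ih =>
      refine ih.trans ?_
      have hp : ∀ (T : Finset ι) (j : ι), IsProbabilityMeasure (if j ∈ T then ν j else κ j) :=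
        fun T j => by split_ifs <;> infer_instance
      have hI : ∀ (T : Finset ι), Integrable u (Measure.pi fun j => if j ∈ T then ν j else κ j) :=
        fun T => hul.integrable_pi fun j => by
          split_ifs
          · exact hν j
          · exact hκ j
      have e : ∀ j, j ≠ i → (if j ∈ insert i T then ν j else κ j) = if j ∈ T then ν j else κ j :=
        fun j hj => by simp [hj]
      rw [integral_pi_update (fun j => if j ∈ T then ν j else κ j)
          (fun j => if j ∈ T then ν j else κ j) i (fun _ _ => rfl) (hI T),
        integral_pi_update (fun j => if j ∈ T then ν j else κ j)
          (fun j => if j ∈ insert i T then ν j else κ j) i e (hI (insert i T))]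
      refine integral_mono
        (integrable_pi_update (fun j => if j ∈ T then ν j else κ j)
          (fun j => if j ∈ T then ν j else κ j) i (fun _ _ => rfl) (hI T))
        (integrable_pi_update (fun j => if j ∈ T then ν j else κ j)
          (fun j => if j ∈ insert i T then ν j else κ j) i e (hI (insert i T))) fun x => ?_
      simp only [if_neg hi, if_pos (Finset.mem_insert_self i T)]
      refine h i _ (C * 1) ⟨convex_univ, fun a _ b _ p q hp hq hpq => ?_⟩ (fun a b hab => ?_)
        (hul.comp (lipschitzWith_update x i))
      · refine le_trans (le_of_eq (congrArg u ?_)) (huc.2 (Set.mem_univ (Function.update x i a))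
          (Set.mem_univ (Function.update x i b)) hp hq hpq)
        ext j
        by_cases hj : j = i
        · subst hj; simp
        · simp [Function.update_of_ne hj, ← add_mul, hpq]
      · exact hum (Function.update_mono hab)
  simpa using main Finset.univ

end IncreasingConvexOrder

/-! ### Maxima over finite types -/

section FiniteMaxima

variable {A : Type*} [Fintype A]

theorem le_iSup_fintype (q : A → ℝ) (a : A) : q a ≤ ⨆ a, q a :=
  le_ciSup (Set.finite_range q).bddAbove a

theorem iSup_fintype_mono [Nonempty A] {q r : A → ℝ} (h : ∀ a, q a ≤ r a) :
    ⨆ a, q a ≤ ⨆ a, r a :=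
  ciSup_le fun a => (h a).trans (le_iSup_fintype r a)

theorem abs_iSup_sub_iSup_le [Nonempty A] {q r : A → ℝ} {c : ℝ} (h : ∀ a, |q a - r a| ≤ c) :
    |(⨆ a, q a) - ⨆ a, r a| ≤ c := by
  rw [abs_sub_le_iff]
  constructor
  · rw [sub_le_iff_le_add]
    exact ciSup_le fun a => by linarith [le_iSup_fintype r a, (abs_sub_le_iff.1 (h a)).1]
  · rw [sub_le_iff_le_add]
    exact ciSup_le fun a => by linarith [le_iSup_fintype q a, (abs_sub_le_iff.1 (h a)).2]

theorem iSup_convexComb_le [Nonempty A] (q r : A → ℝ) {c d : ℝ} (hc : 0 ≤ c) (hd : 0 ≤ d) :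
    ⨆ a, (c * q a + d * r a) ≤ c * (⨆ a, q a) + d * ⨆ a, r a :=
  ciSup_le fun a => add_le_add (mul_le_mul_of_nonneg_left (le_iSup_fintype q a) hc)
    (mul_le_mul_of_nonneg_left (le_iSup_fintype r a) hd)

end FiniteMaxima

/-! ### Backward induction for the optimal values -/

section OptimalValue

variable {H : ℕ} {X A : Type*} [Fintype X] [DecidableEq X] [Fintype A] [DecidableEq A]

/-- The optimal state-action values of `M` in period `t`, computed backwards in time. -/
def optQ (M : MDP H X A) (t : ℕ) (x : X) (a : A) : ℝ :=
  if ht : t < H then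
    ∑ o, M (⟨t, ht⟩, x, a) o * (reward o + ⨆ a' : A, optQ M (t + 1) o.2 a')
  else 0
termination_by H - t

theorem optQ_of_lt (M : MDP H X A) {t : ℕ} (ht : t < H) (x : X) (a : A) :
    optQ M t x a = ∑ o, M (⟨t, ht⟩, x, a) o * (reward o + ⨆ a' : A, optQ M (t + 1) o.2 a') := by
  rw [optQ, dif_pos ht]

theorem optQ_of_le (M : MDP H X A) {t : ℕ} (ht : H ≤ t) (x : X) (a : A) : optQ M t x a = 0 := by
  rw [optQ, dif_neg (not_lt.2 ht)]

/-- Backward induction over the periods. -/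
theorem backward_induction {H : ℕ} {P : ℕ → Prop} (h0 : ∀ t, H ≤ t → P t)
    (hstep : ∀ t, t < H → P (t + 1) → P t) (t : ℕ) : P t := by
  induction hk : H - t generalizing t with
  | zero => exact h0 t (by omega)
  | succ k ih => exact hstep t (by omega) (ih (t + 1) (by omega))

theorem optQ_congr {M M' : MDP H X A} (t : ℕ) :
    (∀ y, t ≤ y.1.val → M y = M' y) → ∀ x a, optQ M t x a = optQ M' t x a := by
  induction t using backward_induction (H := H) with
  | h0 t ht => intro _ x a; rw [optQ_of_le M ht, optQ_of_le M' ht]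
  | hstep t ht ih =>
    intro h x a
    rw [optQ_of_lt M ht, optQ_of_lt M' ht, h _ le_rfl]
    have := ih fun y hy => h y (by omega)
    simp_rw [this]

theorem continuous_optQ [Nonempty A] (t : ℕ) :
    ∀ (x : X) (a : A), Continuous fun M : MDP H X A => optQ M t x a := by
  induction t using backward_induction (H := H) with
  | h0 t ht => intro x a; simp_rw [optQ_of_le _ ht]; fun_prop
  | hstep t ht ih =>
    intro x a
    simp_rw [optQ_of_lt _ ht]
    exact continuous_finsetSum _ fun o _ => Continuous.mul (by fun_prop)
      (continuous_const.add (continuous_ciSup_fintype fun a' => ih o.2 a'))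

theorem optQ_nonneg [Nonempty A] {M : MDP H X A} (hM : ∀ y, M y ∈ stdSimplex ℝ (Outcome X))
    (t : ℕ) : ∀ x a, 0 ≤ optQ M t x a := by
  induction t using backward_induction (H := H) with
  | h0 t ht => intro x a; rw [optQ_of_le _ ht]
  | hstep t ht ih =>
    intro x a
    rw [optQ_of_lt _ ht]
    refine Finset.sum_nonneg fun o _ => mul_nonneg ((hM _).1 o) (add_nonneg (reward_nonneg o) ?_)
    exact (ih o.2 (Classical.arbitrary A)).trans (le_iSup_fintype _ _)

theorem optQ_le [Nonempty A] {M : MDP H X A} (hM : ∀ y, M y ∈ stdSimplex ℝ (Outcome X))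
    (t : ℕ) : ∀ x a, optQ M t x a ≤ (H - t : ℕ) := by
  induction t using backward_induction (H := H) with
  | h0 t ht => intro x a; rw [optQ_of_le _ ht]; positivity
  | hstep t ht ih =>
    intro x a
    rw [optQ_of_lt _ ht]
    calc _ ≤ ∑ o, M (⟨t, ht⟩, x, a) o * ((H - t : ℕ) : ℝ) := by
          refine Finset.sum_le_sum fun o _ => mul_le_mul_of_nonneg_left ?_ ((hM _).1 o)
          have h1 : ⨆ a', optQ M (t + 1) o.2 a' ≤ ((H - (t + 1) : ℕ) : ℝ) :=
            ciSup_le fun a' => ih o.2 a'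
          have h2 : ((H - t : ℕ) : ℝ) = ((H - (t + 1) : ℕ) : ℝ) + 1 := by
            rw [← Nat.cast_add_one]; congr 1; omega
          linarith [reward_le_one o]
      _ = _ := by rw [← Finset.sum_mul, (hM _).2, one_mul]

/-- Backward induction computes an upper bound of the value of every policy. -/
theorem optValue_le_iSup_optQ [Nonempty A] {M : MDP H X A}
    (hM : ∀ y, M y ∈ stdSimplex ℝ (Outcome X)) (x : X) :
    optValue M x ≤ ⨆ a, optQ M 0 x a := by
  refine ciSup_le fun π => ?_
  set δ : X → ℝ := fun x' => if x' = x then 1 else 0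
  have h := sum_trajProb_mul_return δ hM π (fun t x => ⨆ a, optQ M t x a)
    (fun x => by simp [optQ_of_le])
  have h2 : ∑ x', δ x' * ⨆ a, optQ M 0 x' a = ⨆ a, optQ M 0 x a := by simp [δ]
  rw [h2] at h
  unfold value
  rw [h, sub_le_self_iff]
  refine Finset.sum_nonneg fun τ _ => mul_nonneg
    (trajProb_nonneg (fun x' => by simp only [δ]; split_ifs <;> norm_num) hM π τ)
    (Finset.sum_nonneg fun t _ => ?_)
  rw [sub_nonneg]
  have := le_iSup_fintype (fun a => optQ M t (τ.state t) a) (τ.action t)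
  rwa [optQ_of_lt M t.isLt] at this

end OptimalValue

/-! ### Stochastic optimism of the sampled values -/

section Optimism

open scoped NNReal

variable {H : ℕ} {X A : Type*} [Fintype X] [DecidableEq X] [Fintype A] [DecidableEq A]

theorem rlsviQ_of_le (θbar : Fin H × X × A → ℝ) (v lam : ℝ) {ℓ : ℕ} (h : History H X A ℓ)
    (ξ : Fin H × X × A → ℝ) {t : ℕ} (ht : H ≤ t) (x : X) (a : A) :
    rlsviQ θbar v lam h ξ t x a = 0 := by
  rw [rlsviQ, dif_neg (not_lt.2 ht)]

/-- The regression step of RLSVI for noise variance `H ^ 2`, prior mean `H` and prior weight `β`: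
the next value function `V` enters through the empirical outcomes, mixed with `β` fictitious
observations of the maximal return `H`. -/
def optimisticMean (β : ℝ) {ℓ : ℕ} (h : History H X A ℓ) (y : Fin H × X × A) (V : X → ℝ) : ℝ :=
  (β * H + ∑ k ∈ visits h y, (reward ((h k).outcome y.1) + V ((h k).outcome y.1).2)) /
    (β + (visits h y).card)

theorem rlsviQ_of_lt {β : ℝ} (hβ : 0 < β) {θbar : Fin H × X × A → ℝ} {v lam : ℝ}
    (hθ : ∀ y, θbar y = H) (hv : v = (H : ℝ) ^ 2) (hlam : v / lam = β) {ℓ : ℕ}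
    (h : History H X A ℓ) (ξ : Fin H × X × A → ℝ) {t : ℕ} (ht : t < H) (x : X) (a : A) :
    rlsviQ θbar v lam h ξ t x a =
      optimisticMean β h (⟨t, ht⟩, x, a) (fun x' => ⨆ a', rlsviQ θbar v lam h ξ (t + 1) x' a') +
        H / √(β + (visits h (⟨t, ht⟩, x, a)).card) * ξ (⟨t, ht⟩, x, a) := by
  have hH : (0 : ℝ) < H := by exact_mod_cast (Nat.zero_le t).trans_lt ht
  have hv0 : 0 < v := by rw [hv]; positivity
  have hl0 : lam ≠ 0 := by
    rintro rfl
    rw [div_zero] at hlam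
    exact hβ.ne hlam
  have hc : (0 : ℝ) < β + (visits h (⟨t, ht⟩, x, a)).card := by positivity
  have hvar : rlsviVar v lam h (⟨t, ht⟩, x, a) =
      (H : ℝ) ^ 2 / (β + (visits h (⟨t, ht⟩, x, a)).card) := by
    unfold rlsviVar
    rw [← hlam, ← hv]
    have : v / lam + ((visits h (⟨t, ht⟩, x, a)).card : ℝ) ≠ 0 := by rw [hlam]; exact hc.ne'
    rw [show 1 / lam + ((visits h (⟨t, ht⟩, x, a)).card : ℝ) / v =
      (v / lam + ((visits h (⟨t, ht⟩, x, a)).card : ℝ)) / v by field_simp, inv_div]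
  rw [rlsviQ, dif_pos ht, hvar, Real.sqrt_div (by positivity), Real.sqrt_sq hH.le, hθ]
  congr 1
  unfold optimisticMean
  have h1 : (H : ℝ) / lam = β * H / v := by rw [← hlam]; field_simp
  rw [h1, hv]
  simp only
  field_simp

theorem optimisticMean_convexComb {β : ℝ} (hβ : 0 < β) {ℓ : ℕ} (h : History H X A ℓ)
    (y : Fin H × X × A) (V W : X → ℝ) {p q : ℝ} (hpq : p + q = 1) :
    optimisticMean β h y (fun x => p * V x + q * W x) =
      p * optimisticMean β h y V + q * optimisticMean β h y W := by
  unfold optimisticMean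
  have hc : β + ((visits h y).card : ℝ) ≠ 0 := by positivity
  rw [← mul_div_assoc, ← mul_div_assoc, ← add_div]
  congr 1
  have : q = 1 - p := by linarith
  subst this
  simp only [mul_add, Finset.sum_add_distrib, Finset.mul_sum]
  rw [← Finset.mul_sum, ← Finset.mul_sum, ← Finset.mul_sum, ← Finset.mul_sum]
  ring

theorem optimisticMean_mono {β : ℝ} (hβ : 0 < β) {ℓ : ℕ} (h : History H X A ℓ)
    (y : Fin H × X × A) {V W : X → ℝ} (hVW : ∀ x, V x ≤ W x) :
    optimisticMean β h y V ≤ optimisticMean β h y W := by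
  unfold optimisticMean
  have hc : 0 < β + ((visits h y).card : ℝ) := by positivity
  gcongr
  exact hVW _

theorem abs_optimisticMean_sub_le {β : ℝ} (hβ : 0 < β) {ℓ : ℕ} (h : History H X A ℓ)
    (y : Fin H × X × A) {V W : X → ℝ} {c : ℝ} (hc : 0 ≤ c) (hVW : ∀ x, |V x - W x| ≤ c) :
    |optimisticMean β h y V - optimisticMean β h y W| ≤ c := by
  unfold optimisticMean
  have hn : 0 < β + ((visits h y).card : ℝ) := by positivity
  rw [← sub_div, abs_div, abs_of_pos hn, div_le_iff₀ hn, add_sub_add_left_eq_sub,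
    ← Finset.sum_sub_distrib]
  refine (Finset.abs_sum_le_sum_abs _ _).trans ?_
  calc _ ≤ ∑ _k ∈ visits h y, c := Finset.sum_le_sum fun k _ => by
        rw [add_sub_add_left_eq_sub]; exact hVW _
    _ ≤ _ := by rw [Finset.sum_const, nsmul_eq_mul]; nlinarith

/-- The posterior mean of `reward + V` is at most the regression target of RLSVI, as long as `V`
leaves room for one more reward below `H`. -/
theorem sum_postParam_mul_le_optimisticMean {β : ℝ} (hβ : 0 < β)
    {α : Fin H × X × A → Outcome X → ℝ} (hα : ∀ y o, 0 ≤ α y o) (hαβ : ∀ y, ∑ o, α y o = β)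
    {ℓ : ℕ} (h : History H X A ℓ) (y : Fin H × X × A) {V : X → ℝ} (hV : ∀ x, V x ≤ H - 1) :
    (∑ o, postParam α h y o * (reward o + V o.2)) / (∑ o, postParam α h y o) ≤
      optimisticMean β h y V := by
  rw [sum_postParam, hαβ, sum_postParam_mul]
  unfold optimisticMean
  have hn : 0 < β + ((visits h y).card : ℝ) := by positivity
  gcongr
  rw [← hαβ y, Finset.sum_mul]
  refine Finset.sum_le_sum fun o _ => mul_le_mul_of_nonneg_left ?_ (hα y o)
  linarith [hV o.2, reward_le_one o]

theorem rlsviQ_congr {β : ℝ} (hβ : 0 < β) {θbar : Fin H × X × A → ℝ} {v lam : ℝ}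
    (hθ : ∀ y, θbar y = H) (hv : v = (H : ℝ) ^ 2) (hlam : v / lam = β) {ℓ : ℕ}
    (h : History H X A ℓ) {ξ ξ' : Fin H × X × A → ℝ} (t : ℕ) :
    (∀ y, t ≤ y.1.val → ξ y = ξ' y) →
      ∀ x a, rlsviQ θbar v lam h ξ t x a = rlsviQ θbar v lam h ξ' t x a := by
  induction t using backward_induction (H := H) with
  | h0 t ht => intro _ x a; rw [rlsviQ_of_le _ _ _ _ _ ht, rlsviQ_of_le _ _ _ _ _ ht]
  | hstep t ht ih =>
    intro hξ x a
    rw [rlsviQ_of_lt hβ hθ hv hlam h ξ ht, rlsviQ_of_lt hβ hθ hv hlam h ξ' ht, hξ _ le_rfl]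
    have := ih fun y hy => hξ y (by omega)
    simp_rw [this]

theorem exists_lipschitzWith_rlsviQ [Nonempty A] {β : ℝ} (hβ : 1 ≤ β)
    {θbar : Fin H × X × A → ℝ} {v lam : ℝ}
    (hθ : ∀ y, θbar y = H) (hv : v = (H : ℝ) ^ 2) (hlam : v / lam = β) {ℓ : ℕ}
    (h : History H X A ℓ) (t : ℕ) :
    ∃ C, LipschitzWith C fun (ξ : Fin H × X × A → ℝ) (z : X × A) =>
      rlsviQ θbar v lam h ξ t z.1 z.2 := by
  have hβ0 : 0 < β := one_pos.trans_le hβ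
  induction t using backward_induction (H := H) with
  | h0 t ht =>
    simp_rw [rlsviQ_of_le _ _ _ _ _ ht]
    exact ⟨0, LipschitzWith.const _⟩
  | hstep t ht ih =>
    obtain ⟨C, hC⟩ := ih
    refine ⟨C + H, LipschitzWith.of_dist_le_mul fun ξ ξ' => ?_⟩
    rw [dist_pi_le_iff (by positivity)]
    rintro ⟨x, a⟩
    simp only
    rw [rlsviQ_of_lt hβ0 hθ hv hlam h ξ ht, rlsviQ_of_lt hβ0 hθ hv hlam h ξ' ht, Real.dist_eq,
      add_sub_add_comm, ← mul_sub, NNReal.coe_add, add_mul]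
    refine (abs_add_le _ _).trans (add_le_add ?_ ?_)
    · refine abs_optimisticMean_sub_le hβ0 h _ (by positivity) fun x' =>
        abs_iSup_sub_iSup_le fun a' => ?_
      have := (dist_le_pi_dist _ _ (x', a')).trans (hC.dist_le_mul ξ ξ')
      rwa [Real.dist_eq] at this
    · rw [abs_mul, abs_of_nonneg (by positivity)]
      have h1 : (1 : ℝ) ≤ √(β + (visits h (⟨t, ht⟩, x, a)).card) := by
        rw [Real.one_le_sqrt]
        have : (0 : ℝ) ≤ (visits h (⟨t, ht⟩, x, a)).card := by positivity
        linarith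
      have h2 := dist_le_pi_dist ξ ξ' (⟨t, ht⟩, x, a)
      rw [Real.dist_eq] at h2
      have h3 : (H : ℝ) / √(β + (visits h (⟨t, ht⟩, x, a)).card) ≤ H :=
        div_le_self (by positivity) h1
      rw [NNReal.coe_natCast]
      exact mul_le_mul h3 h2 (abs_nonneg _) (by positivity)

/-- The comparison for a single triple: a Bellman backup under a Dirichlet law against its
randomized regression target. Monotonicity allows the target to have a larger mean `m`. -/
theorem integral_dirichlet_le_gaussian {α : Outcome X → ℝ} (hα : ∀ o, 0 ≤ α o)
    (hs : 0 < ∑ o, α o) {R : ℝ} (hR : 0 < R) {f : Outcome X → ℝ} (hf0 : ∀ o, 0 ≤ f o)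
    (hfR : ∀ o, f o ≤ R) {m : ℝ} (hm : (∑ o, α o * f o) / ∑ o, α o ≤ m) {w : ℝ → ℝ} {C : ℝ≥0}
    (hwc : ConvexOn ℝ Set.univ w) (hwm : Monotone w) (hwl : LipschitzWith C w) :
    ∫ p, w (∑ o, p o * f o) ∂dirichlet α ≤
      ∫ z, w (m + R / √(∑ o, α o) * z) ∂gaussianReal 0 1 := by
  have hl : LipschitzWith (C * ‖R‖₊) fun z => w (0 + R * z) := hwl.comp (lipschitzWith_affine 0 R)
  have h1 := integral_dirichlet_le_stdGaussian (hwc.comp_affine_real 0 R) hl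
    (f := fun o => f o / R) (fun o => div_nonneg (hf0 o) hR.le)
    (fun o => (div_le_one hR).2 (hfR o)) hα hs
  have e1 : ∀ p : Outcome X → ℝ, 0 + R * ∑ o, p o * (f o / R) = ∑ o, p o * f o := fun p => by
    rw [zero_add, Finset.mul_sum]
    exact Finset.sum_congr rfl fun o _ => by field_simp
  have e2 : ∀ z : ℝ, 0 + R * ((∑ o, α o * (f o / R)) / (∑ o, α o) + 1 / √(∑ o, α o) * z) =
      (∑ o, α o * f o) / (∑ o, α o) + R / √(∑ o, α o) * z := fun z => by
    rw [← e1 α]; ring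
  simp_rw [e1, e2] at h1
  refine h1.trans (integral_mono (hwl.comp (lipschitzWith_affine _ _)).integrable_stdGaussian
    (hwl.comp (lipschitzWith_affine _ _)).integrable_stdGaussian fun z => hwm ?_)
  linarith

theorem integrable_id_map_affine_stdGaussian (m s : ℝ) :
    Integrable (fun x => x) ((gaussianReal 0 1).map fun z => m + s * z) := by
  rw [integrable_map_measure (by fun_prop) (by fun_prop)]
  exact (integrable_const m).add (integrable_id_stdGaussian.const_mul s)

theorem integrable_id_map_dirichlet {α : Outcome X → ℝ}
    (hs : 0 < ∑ o, α o) (f : Outcome X → ℝ) :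
    Integrable (fun x => x) ((dirichlet α).map fun p => ∑ o, p o * f o) := by
  rw [integrable_map_measure (by fun_prop) (Measurable.aemeasurable (by fun_prop))]
  exact integrable_dirichlet_of_continuous hs (by fun_prop)

/-- All Bellman backups of a fixed next value function, under the posterior, are jointly dominated
by the randomized regression targets in the increasing convex order. -/
theorem integral_prior_le_gaussian {α : Fin H × X × A → Outcome X → ℝ}
    (hα : ∀ y o, 0 ≤ α y o) (hs : ∀ y, 0 < ∑ o, α y o) {R : ℝ} (hR : 0 < R)
    {f : Outcome X → ℝ} (hf0 : ∀ o, 0 ≤ f o) (hfR : ∀ o, f o ≤ R) {m : Fin H × X × A → ℝ}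
    (hm : ∀ y, (∑ o, α y o * f o) / ∑ o, α y o ≤ m y)
    {u : (Fin H × X × A → ℝ) → ℝ} {C : ℝ≥0} (huc : ConvexOn ℝ Set.univ u) (hum : Monotone u)
    (hul : LipschitzWith C u) :
    ∫ M, u (fun y => ∑ o, M y o * f o) ∂prior α ≤
      ∫ ξ, u (fun y => m y + R / √(∑ o, α y o) * ξ y)
        ∂(Measure.pi fun _ : Fin H × X × A => gaussianReal 0 1) := by
  have hk : ∀ y, IsProbabilityMeasure ((dirichlet (α y)).map fun p => ∑ o, p o * f o) := fun y =>
    Measure.isProbabilityMeasure_map (Measurable.aemeasurable (by fun_prop))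
  have hn : ∀ y, IsProbabilityMeasure
      ((gaussianReal 0 1).map fun z => m y + R / √(∑ o, α y o) * z) := fun y =>
    Measure.isProbabilityMeasure_map (Measurable.aemeasurable (by fun_prop))
  have h1 : ∫ M, u (fun y => ∑ o, M y o * f o) ∂prior α =
      ∫ g, u g ∂(Measure.pi fun y => (dirichlet (α y)).map fun p => ∑ o, p o * f o) := by
    rw [← Measure.pi_map_pi (f := fun _ (p : Outcome X → ℝ) => ∑ o, p o * f o)
      fun y => Measurable.aemeasurable (by fun_prop),
      integral_map (Measurable.aemeasurable (by fun_prop)) hul.continuous.aestronglyMeasurable]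
    rfl
  have h2 : ∫ ξ, u (fun y => m y + R / √(∑ o, α y o) * ξ y)
        ∂(Measure.pi fun _ : Fin H × X × A => gaussianReal 0 1) =
      ∫ g, u g ∂(Measure.pi fun y =>
        (gaussianReal 0 1).map fun z => m y + R / √(∑ o, α y o) * z) := by
    rw [← Measure.pi_map_pi (f := fun y (z : ℝ) => m y + R / √(∑ o, α y o) * z)
      fun y => Measurable.aemeasurable (by fun_prop),
      integral_map (Measurable.aemeasurable (by fun_prop)) hul.continuous.aestronglyMeasurable]
  rw [h1, h2]
  refine integral_pi_le_of_forall (fun y => integrable_id_map_dirichlet (hs y) f)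
    (fun y => integrable_id_map_affine_stdGaussian _ _) (fun y w C' hwc hwm hwl => ?_) huc hum hul
  rw [integral_map (Measurable.aemeasurable (by fun_prop)) hwl.continuous.aestronglyMeasurable,
    integral_map (Measurable.aemeasurable (by fun_prop)) hwl.continuous.aestronglyMeasurable]
  exact integral_dirichlet_le_gaussian (hα y) (hs y) hR hf0 hfR (hm y) hwc hwm hwl

set_option maxHeartbeats 2000000 in
/-- **Stochastic optimism.** The state-action values sampled by RLSVI dominate the optimal
state-action values under the posterior in the increasing convex order. -/
theorem integral_optQ_le_integral_rlsviQ [Nonempty A] {β : ℝ} (hβ : 1 ≤ β)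
    {α : Fin H × X × A → Outcome X → ℝ} (hα : ∀ y o, 0 ≤ α y o) (hαβ : ∀ y, ∑ o, α y o = β)
    {θbar : Fin H × X × A → ℝ} {v lam : ℝ}
    (hθ : ∀ y, θbar y = H) (hv : v = (H : ℝ) ^ 2) (hlam : v / lam = β) {ℓ : ℕ}
    (h : History H X A ℓ) (t : ℕ) :
    ∀ {u : (X × A → ℝ) → ℝ} {C : ℝ≥0}, ConvexOn ℝ Set.univ u → Monotone u → LipschitzWith C u →
      ∫ M, u (fun z => optQ M t z.1 z.2) ∂prior (postParam α h) ≤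
        ∫ ξ, u (fun z => rlsviQ θbar v lam h ξ t z.1 z.2)
          ∂(Measure.pi fun _ : Fin H × X × A => gaussianReal 0 1) := by
  have hβ0 : 0 < β := one_pos.trans_le hβ
  have hs : ∀ y, 0 < ∑ o, α y o := fun y => by rw [hαβ]; exact hβ0
  have hs' := sum_postParam_pos hs h
  have hα' := postParam_nonneg hα h
  set μ := Measure.pi fun _ : Fin H × X × A => gaussianReal 0 1 with hμ
  induction t using backward_induction (H := H) with
  | h0 t ht =>
    intro u C _ _ _
    simp_rw [optQ_of_le _ ht, rlsviQ_of_le _ _ _ _ _ ht]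
    simp
  | hstep t ht ih =>
    intro u C huc hum hul
    have hH : (0 : ℝ) < H := by exact_mod_cast (Nat.zero_le t).trans_lt ht
    -- the randomized backup of the next state-action values `q`
    set G : (X × A → ℝ) → (Fin H × X × A → ℝ) → X × A → ℝ := fun q ξ z =>
      optimisticMean β h (⟨t, ht⟩, z) (fun x' => ⨆ a', q (x', a')) +
        H / √(β + (visits h (⟨t, ht⟩, z)).card) * ξ (⟨t, ht⟩, z) with hG
    have hG1 : ∀ ξ, LipschitzWith 1 fun q => G q ξ := fun ξ =>
      LipschitzWith.of_dist_le_mul fun q q' => by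
        rw [NNReal.coe_one, one_mul, dist_pi_le_iff dist_nonneg]
        intro z
        simp only [hG]
        rw [Real.dist_eq, add_sub_add_right_eq_sub]
        refine abs_optimisticMean_sub_le hβ0 h _ dist_nonneg fun x' =>
          abs_iSup_sub_iSup_le fun a' => ?_
        rw [← Real.dist_eq]
        exact dist_le_pi_dist q q' (x', a')
    have hG2 : ∀ q, ∃ C, LipschitzWith C fun ξ => G q ξ := fun q =>
      ⟨H, LipschitzWith.of_dist_le_mul fun ξ ξ' => by
        rw [dist_pi_le_iff (by positivity)]
        intro z
        simp only [hG]
        rw [Real.dist_eq, add_sub_add_left_eq_sub, ← mul_sub, abs_mul,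
          abs_of_nonneg (by positivity), NNReal.coe_natCast]
        have h1 : (1 : ℝ) ≤ √(β + (visits h (⟨t, ht⟩, z)).card) := by
          rw [Real.one_le_sqrt]
          have : (0 : ℝ) ≤ (visits h (⟨t, ht⟩, z)).card := by positivity
          linarith
        have h2 := dist_le_pi_dist ξ ξ' (⟨t, ht⟩, z)
        rw [Real.dist_eq] at h2
        exact mul_le_mul (div_le_self (by positivity) h1) h2 (abs_nonneg _) (by positivity)⟩
    have hint : ∀ q, Integrable (fun ξ => u (G q ξ)) μ := fun q => by
      obtain ⟨C', hC'⟩ := hG2 q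
      exact (hul.comp hC').integrable_pi fun _ => integrable_id_stdGaussian
    set F : (X × A → ℝ) → ℝ := fun q => ∫ ξ, u (G q ξ) ∂μ with hF
    have hFl : LipschitzWith C F := LipschitzWith.of_dist_le_mul fun q q' => by
      rw [Real.dist_eq, hF, ← integral_sub (hint q) (hint q')]
      refine abs_integral_le_integral_abs.trans ?_
      calc _ ≤ ∫ _, C * dist q q' ∂μ := by
            refine integral_mono ((hint q).sub (hint q')).abs (integrable_const _) fun ξ => ?_
            have := (hul.comp (hG1 ξ)).dist_le_mul q q'
            rwa [mul_one, Real.dist_eq] at this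
        _ = _ := by simp [μ]
    have hFm : Monotone F := fun q q' hqq => by
      refine integral_mono (hint q) (hint q') fun ξ => hum fun z => ?_
      simp only [hG]
      gcongr
      exact optimisticMean_mono hβ0 h _ fun x' => iSup_fintype_mono fun a' => hqq (x', a')
    have hFc : ConvexOn ℝ Set.univ F := by
      refine ⟨convex_univ, fun q _ q' _ c d hc hd hcd => ?_⟩
      simp only [hF, smul_eq_mul]
      rw [← integral_const_mul, ← integral_const_mul,
        ← integral_add ((hint q).const_mul c) ((hint q').const_mul d)]
      refine integral_mono (hint _) (((hint q).const_mul c).add ((hint q').const_mul d))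
        fun ξ => ?_
      refine le_trans (hum ?_) (huc.2 (Set.mem_univ (G q ξ)) (Set.mem_univ (G q' ξ)) hc hd hcd)
      intro z
      simp only [hG, Pi.add_apply, Pi.smul_apply, smul_eq_mul]
      have h1 : optimisticMean β h (⟨t, ht⟩, z)
          (fun x' => ⨆ a', (c * q (x', a') + d * q' (x', a'))) ≤ _ :=
        optimisticMean_mono hβ0 h _ fun x' =>
          iSup_convexComb_le (fun a' => q (x', a')) (fun a' => q' (x', a')) hc hd
      rw [optimisticMean_convexComb hβ0 h _ _ _ hcd] at h1
      have h2 : ∀ e : ℝ, e = c * e + d * e := fun e => by rw [← add_mul, hcd, one_mul]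
      linarith [h2 (H / √(β + (visits h (⟨t, ht⟩, z)).card) * ξ (⟨t, ht⟩, z))]
    -- the restriction of a family of values to period `t`
    have hrl : LipschitzWith 1 fun (g : Fin H × X × A → ℝ) (z : X × A) => g (⟨t, ht⟩, z) :=
      LipschitzWith.of_dist_le_mul fun g g' => by
        rw [NNReal.coe_one, one_mul, dist_pi_le_iff dist_nonneg]
        exact fun z => dist_le_pi_dist g g' (⟨t, ht⟩, z)
    have hcM : Continuous fun M : MDP H X A => u fun z => optQ M t z.1 z.2 :=
      hul.continuous.comp (continuous_pi fun z => continuous_optQ t z.1 z.2)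
    calc ∫ M, u (fun z => optQ M t z.1 z.2) ∂prior (postParam α h)
        = ∫ M, ∫ M', u (fun z => ∑ o, M' (⟨t, ht⟩, z) o *
            (reward o + ⨆ a', optQ M (t + 1) o.2 a')) ∂prior (postParam α h)
            ∂prior (postParam α h) := by
          -- the outcome distributions of period `t` are independent of the later values
          have e := integral_pi_piecewise (fun y => dirichlet (postParam α h y))
            (fun y => t + 1 ≤ y.1.val)
            (F := fun M : MDP H X A => u fun z => optQ M t z.1 z.2)
            (integrable_prior_of_continuous hs' hcM)
          refine e.trans ?_
          refine integral_congr_ae (Filter.Eventually.of_forall fun M => ?_)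
          refine integral_congr_ae (Filter.Eventually.of_forall fun M' => ?_)
          simp only
          congr 1
          ext z
          rw [optQ_of_lt _ ht, if_neg (by simp)]
          refine Finset.sum_congr rfl fun o _ => ?_
          congr 3
          ext a'
          exact optQ_congr (t + 1) (fun y hy => if_pos hy) _ _
      _ ≤ ∫ M, F (fun z => optQ M (t + 1) z.1 z.2) ∂prior (postParam α h) := by
          have hcF : Continuous fun M : MDP H X A => F fun z => optQ M (t + 1) z.1 z.2 :=
            hFl.continuous.comp (continuous_pi fun z => continuous_optQ (t + 1) z.1 z.2)
          refine integral_mono_ae ?_ (integrable_prior_of_continuous hs' hcF) ?_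
          · have hcc : Continuous fun q : MDP H X A × MDP H X A =>
                u fun z => ∑ o, q.2 (⟨t, ht⟩, z) o *
                  (reward o + ⨆ a', optQ q.1 (t + 1) o.2 a') := by
              refine hul.continuous.comp (continuous_pi fun z => continuous_finsetSum _ fun o _ =>
                Continuous.mul (by fun_prop) (continuous_const.add
                  (continuous_ciSup_fintype fun a' =>
                    (continuous_optQ (t + 1) o.2 a').comp continuous_fst)))
            obtain ⟨K, hK⟩ := ((isCompact_univ_pi fun _ : Fin H × X × A =>
              isCompact_stdSimplex ℝ (Outcome X)).prod (isCompact_univ_pi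
                fun _ : Fin H × X × A => isCompact_stdSimplex ℝ
                  (Outcome X))).exists_bound_of_continuousOn hcc.continuousOn
            refine Integrable.of_bound
              (hcc.stronglyMeasurable.integral_prod_right').aestronglyMeasurable K ?_
            filter_upwards [prior_ae_mem_stdSimplex hs'] with M hM
            refine (norm_integral_le_of_norm_le_const (C := K) ?_).trans (by simp)
            filter_upwards [prior_ae_mem_stdSimplex hs'] with M' hM'
            exact hK (M, M') ⟨fun y _ => hM y, fun y _ => hM' y⟩
          · filter_upwards [prior_ae_mem_stdSimplex hs'] with M hM
            set V : X → ℝ := fun x' => ⨆ a', optQ M (t + 1) x' a' with hV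
            have hV0 : ∀ x', 0 ≤ V x' := fun x' =>
              (optQ_nonneg hM (t + 1) x' (Classical.arbitrary A)).trans (le_iSup_fintype _ _)
            have hV1 : ∀ x', V x' ≤ H - 1 := fun x' => by
              refine (ciSup_le fun a' => optQ_le hM (t + 1) x' a').trans ?_
              rw [Nat.cast_sub (by omega)]
              push_cast
              linarith [(Nat.cast_nonneg t : (0 : ℝ) ≤ t)]
            have h3 := integral_prior_le_gaussian hα' hs' hH
              (f := fun o => reward o + V o.2)
              (fun o => add_nonneg (reward_nonneg o) (hV0 o.2))
              (fun o => by linarith [reward_le_one o, hV1 o.2])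
              (m := fun y => optimisticMean β h y V)
              (fun y => sum_postParam_mul_le_optimisticMean hβ0 hα hαβ h y hV1)
              (u := fun g => u fun z => g (⟨t, ht⟩, z)) (C := C * 1)
              ⟨convex_univ, fun g _ g' _ c d hc hd hcd =>
                huc.2 (Set.mem_univ fun z => g (⟨t, ht⟩, z))
                  (Set.mem_univ fun z => g' (⟨t, ht⟩, z)) hc hd hcd⟩
              (fun g g' hgg => hum fun z => hgg _) (hul.comp hrl)
            simp_rw [sum_postParam, hαβ] at h3
            exact h3
      _ ≤ ∫ ξ', F (fun z => rlsviQ θbar v lam h ξ' (t + 1) z.1 z.2) ∂μ := ih hFc hFm hFl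
      _ = ∫ ξ, u (fun z => rlsviQ θbar v lam h ξ t z.1 z.2) ∂μ := by
          obtain ⟨C', hC'⟩ := exists_lipschitzWith_rlsviQ hβ hθ hv hlam h t
          -- the perturbations of period `t` are independent of the later values
          have e := integral_pi_piecewise (fun _ : Fin H × X × A => gaussianReal 0 1)
            (fun y => t + 1 ≤ y.1.val)
            (F := fun ξ => u fun z => rlsviQ θbar v lam h ξ t z.1 z.2)
            ((hul.comp hC').integrable_pi fun _ => integrable_id_stdGaussian)
          refine Eq.trans ?_ e.symm
          refine integral_congr_ae (Filter.Eventually.of_forall fun ξ' => ?_)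
          refine integral_congr_ae (Filter.Eventually.of_forall fun ξ => ?_)
          simp only
          congr 1
          ext z
          rw [rlsviQ_of_lt hβ0 hθ hv hlam h _ ht, if_neg (by simp)]
          simp only [hG]
          congr 3
          ext x'
          congr 1
          ext a'
          exact rlsviQ_congr hβ0 hθ hv hlam h (t + 1) (fun y hy => (if_pos hy).symm) _ _

theorem integral_optValue_le [Nonempty A] {β : ℝ} (hβ : 1 ≤ β)
    {α : Fin H × X × A → Outcome X → ℝ} (hα : ∀ y o, 0 ≤ α y o) (hαβ : ∀ y, ∑ o, α y o = β)
    {θbar : Fin H × X × A → ℝ} {v lam : ℝ}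
    (hθ : ∀ y, θbar y = H) (hv : v = (H : ℝ) ^ 2) (hlam : v / lam = β) {ℓ : ℕ}
    (h : History H X A ℓ) (x : X) :
    ∫ M, optValue M x ∂prior (postParam α h) ≤
      ∫ ξ, ⨆ a, rlsviQ θbar v lam h ξ 0 x a
        ∂(Measure.pi fun _ : Fin H × X × A => gaussianReal 0 1) := by
  have hs : ∀ y, 0 < ∑ o, α y o := fun y => by rw [hαβ]; exact one_pos.trans_le hβ
  have hs' := sum_postParam_pos hs h
  refine le_trans (integral_mono_ae (integrable_prior_of_continuous hs' (continuous_optValue x))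
    (integrable_prior_of_continuous hs' (continuous_ciSup_fintype fun a => continuous_optQ 0 x a))
    ?_) (integral_optQ_le_integral_rlsviQ hβ hα hαβ hθ hv hlam h 0
      (u := fun q => ⨆ a, q (x, a)) (C := 1) ⟨convex_univ, fun q _ q' _ c d hc hd _ =>
        iSup_convexComb_le (fun a => q (x, a)) (fun a => q' (x, a)) hc hd⟩
      (fun q q' hqq => iSup_fintype_mono fun a => hqq (x, a))
      (LipschitzWith.of_dist_le_mul fun q q' => ?_))
  · filter_upwards [prior_ae_mem_stdSimplex hs'] with M hM
    exact optValue_le_iSup_optQ hM x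
  · rw [NNReal.coe_one, one_mul, Real.dist_eq]
    refine abs_iSup_sub_iSup_le fun a => ?_
    rw [← Real.dist_eq]
    exact dist_le_pi_dist q q' (x, a)

end Optimism

/-! ### Almost sure uniqueness of the greedy policy -/

section GreedyPolicies

variable {H : ℕ} {X A : Type*} [Fintype X] [DecidableEq X] [Fintype A] [DecidableEq A]

theorem continuous_rlsviQ [Nonempty A] {β : ℝ} (hβ : 1 ≤ β)
    {θbar : Fin H × X × A → ℝ} {v lam : ℝ}
    (hθ : ∀ y, θbar y = H) (hv : v = (H : ℝ) ^ 2) (hlam : v / lam = β) {ℓ : ℕ}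
    (h : History H X A ℓ) (t : ℕ) (x : X) (a : A) :
    Continuous fun ξ => rlsviQ θbar v lam h ξ t x a := by
  obtain ⟨C, hC⟩ := exists_lipschitzWith_rlsviQ hβ hθ hv hlam h t
  exact (continuous_apply (x, a)).comp hC.continuous

theorem integrable_iSup_rlsviQ [Nonempty A] {β : ℝ} (hβ : 1 ≤ β)
    {θbar : Fin H × X × A → ℝ} {v lam : ℝ}
    (hθ : ∀ y, θbar y = H) (hv : v = (H : ℝ) ^ 2) (hlam : v / lam = β) {ℓ : ℕ}
    (h : History H X A ℓ) (t : ℕ) (x : X) :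
    Integrable (fun ξ => ⨆ a, rlsviQ θbar v lam h ξ t x a)
      (Measure.pi fun _ : Fin H × X × A => gaussianReal 0 1) := by
  obtain ⟨C, hC⟩ := exists_lipschitzWith_rlsviQ hβ hθ hv hlam h t
  refine LipschitzWith.integrable_pi (C := C) (fun _ => integrable_id_stdGaussian)
    (LipschitzWith.of_dist_le_mul fun ξ ξ' => ?_)
  rw [Real.dist_eq]
  refine abs_iSup_sub_iSup_le fun a => le_trans ?_ (hC.dist_le_mul ξ ξ')
  rw [← Real.dist_eq]
  exact dist_le_pi_dist (fun z : X × A => rlsviQ θbar v lam h ξ t z.1 z.2)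
    (fun z => rlsviQ θbar v lam h ξ' t z.1 z.2) (x, a)

/-- Two actions have distinct sampled values almost surely, because the perturbation of one of
them has a continuous law and does not influence the other. -/
theorem ae_rlsviQ_ne [Nonempty A] {β : ℝ} (hβ : 1 ≤ β)
    {θbar : Fin H × X × A → ℝ} {v lam : ℝ}
    (hθ : ∀ y, θbar y = H) (hv : v = (H : ℝ) ^ 2) (hlam : v / lam = β) {ℓ : ℕ}
    (h : History H X A ℓ) (t : Fin H) (x : X) {a a' : A} (haa : a ≠ a') :
    ∀ᵐ ξ ∂(Measure.pi fun _ : Fin H × X × A => gaussianReal 0 1),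
      rlsviQ θbar v lam h ξ t x a ≠ rlsviQ θbar v lam h ξ t x a' := by
  have hβ0 : 0 < β := one_pos.trans_le hβ
  have hH : (0 : ℝ) < H := by exact_mod_cast (Nat.zero_le _).trans_lt t.isLt
  set S : Set (Fin H × X × A → ℝ) :=
    {ξ | rlsviQ θbar v lam h ξ t x a = rlsviQ θbar v lam h ξ t x a'} with hS
  have hSm : MeasurableSet S := (isClosed_eq (continuous_rlsviQ hβ hθ hv hlam h t x a)
    (continuous_rlsviQ hβ hθ hv hlam h t x a')).measurableSet
  have key : ∀ ξ : Fin H × X × A → ℝ, ∫⁻ z, S.indicator (fun _ => (1 : ENNReal))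
      (Function.update ξ (t, x, a) z) ∂(gaussianReal 0 1) = 0 := by
    intro ξ
    have hs : 0 < H / √(β + ((visits h (t, x, a)).card : ℝ)) := by positivity
    have hQ : ∀ z x' b, rlsviQ θbar v lam h (Function.update ξ (t, x, a) z) (t + 1) x' b =
        rlsviQ θbar v lam h ξ (t + 1) x' b := fun z x' b =>
      rlsviQ_congr hβ0 hθ hv hlam h _ (fun y hy => Function.update_of_ne
        (fun he => by rw [he] at hy; simp at hy) _ _) _ _
    have hsub : (Function.update ξ (t, x, a) ⁻¹' S).Subsingleton := by
      intro z hz z' hz'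
      simp only [hS, Set.mem_preimage, Set.mem_ofPred_eq] at hz hz'
      have hne : ((t, x, a') : Fin H × X × A) ≠ (t, x, a) := fun he => haa (by simpa using he.symm)
      rw [rlsviQ_of_lt hβ0 hθ hv hlam h _ t.isLt, rlsviQ_of_lt hβ0 hθ hv hlam h _ t.isLt] at hz hz'
      simp only [hQ, Fin.eta, Function.update_self, Function.update_of_ne hne] at hz hz'
      exact mul_left_cancel₀ hs.ne' (by linarith)
    have hnull : (gaussianReal 0 1) (Function.update ξ (t, x, a) ⁻¹' S) = 0 := by
      have := nullSingletonClass_gaussianReal (μ := 0) (v := 1) one_ne_zero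
      exact hsub.measure_zero _
    have hm : Measurable fun z : ℝ => Function.update ξ (t, x, a) z := measurable_update ξ
    have e : (fun z => S.indicator (fun _ => (1 : ENNReal)) (Function.update ξ (t, x, a) z)) =
        (Function.update ξ (t, x, a) ⁻¹' S).indicator fun _ => 1 := rfl
    rw [e, lintegral_indicator (hm hSm)]
    simpa using hnull
  have h0 : (Measure.pi fun _ : Fin H × X × A => gaussianReal 0 1) S = 0 := by
    rw [← lintegral_indicator_one hSm]
    refine (lintegral_pi_update (fun _ => gaussianReal 0 1) (fun _ => gaussianReal 0 1)
      (t, x, a) (fun _ _ => rfl) (measurable_const.indicator hSm)).trans ?_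
    exact (lintegral_congr fun ξ => key ξ).trans lintegral_zero
  exact measure_eq_zero_iff_ae_notMem.1 h0

/-- The noise vectors for which `π` is greedy. -/
def greedySet (θbar : Fin H × X × A → ℝ) (v lam : ℝ) {ℓ : ℕ} (h : History H X A ℓ)
    (π : Policy H X A) : Set (Fin H × X × A → ℝ) :=
  {ξ | ∀ (t : Fin H) (x : X) (a : A),
    rlsviQ θbar v lam h ξ t.val x a ≤ rlsviQ θbar v lam h ξ t.val x (π t x)}

theorem measurableSet_greedySet [Nonempty A] {β : ℝ} (hβ : 1 ≤ β)
    {θbar : Fin H × X × A → ℝ} {v lam : ℝ}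
    (hθ : ∀ y, θbar y = H) (hv : v = (H : ℝ) ^ 2) (hlam : v / lam = β) {ℓ : ℕ}
    (h : History H X A ℓ) (π : Policy H X A) : MeasurableSet (greedySet θbar v lam h π) := by
  unfold greedySet
  simp_rw [Set.ofPred_forall]
  exact (isClosed_iInter fun t : Fin H => isClosed_iInter fun x => isClosed_iInter fun a =>
    isClosed_le (continuous_rlsviQ hβ hθ hv hlam h t x a)
      (continuous_rlsviQ hβ hθ hv hlam h t x (π t x))).measurableSet

theorem ae_existsUnique_greedy [Nonempty A] {β : ℝ} (hβ : 1 ≤ β)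
    {θbar : Fin H × X × A → ℝ} {v lam : ℝ}
    (hθ : ∀ y, θbar y = H) (hv : v = (H : ℝ) ^ 2) (hlam : v / lam = β) {ℓ : ℕ}
    (h : History H X A ℓ) :
    ∀ᵐ ξ ∂(Measure.pi fun _ : Fin H × X × A => gaussianReal 0 1),
      ∃! π, ξ ∈ greedySet θbar v lam h π := by
  have h1 : ∀ᵐ ξ ∂(Measure.pi fun _ : Fin H × X × A => gaussianReal 0 1),
      ∀ (t : Fin H) (x : X) (a a' : A), a ≠ a' →
        rlsviQ θbar v lam h ξ t x a ≠ rlsviQ θbar v lam h ξ t x a' := by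
    refine ae_all_iff.2 fun t => ae_all_iff.2 fun x => ae_all_iff.2 fun a => ae_all_iff.2 fun a' =>
      ae_all_iff.2 fun haa => ae_rlsviQ_ne hβ hθ hv hlam h t x haa
  filter_upwards [h1] with ξ hξ
  have h2 : ∀ (t : Fin H) (x : X), ∃ a', ∀ a,
      rlsviQ θbar v lam h ξ t.val x a ≤ rlsviQ θbar v lam h ξ t.val x a' := fun t x =>
    Finite.exists_max _
  choose π hπ using h2
  refine ⟨π, hπ, fun π' hπ' => ?_⟩
  ext t x
  by_contra hne
  exact hξ t x _ _ hne (le_antisymm (hπ t x _) (hπ' t x _))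

theorem rlsvi_nonneg (θbar : Fin H × X × A → ℝ) (v lam : ℝ) {ℓ : ℕ} (h : History H X A ℓ)
    (π : Policy H X A) : 0 ≤ rlsvi θbar v lam ℓ h π := measureReal_nonneg

theorem sum_indicator_greedySet {θbar : Fin H × X × A → ℝ} {v lam : ℝ} {ℓ : ℕ}
    {h : History H X A ℓ} {ξ : Fin H × X × A → ℝ} {π : Policy H X A}
    (hπ : ξ ∈ greedySet θbar v lam h π) (hu : ∀ π', ξ ∈ greedySet θbar v lam h π' → π' = π)
    (c : Policy H X A → ℝ) :
    ∑ π, (greedySet θbar v lam h π).indicator (fun _ => c π) ξ = c π := by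
  rw [Finset.sum_eq_single π (fun π' _ hne => Set.indicator_of_notMem (fun h' => hne (hu π' h')) _)
    (fun hn => absurd (Finset.mem_univ π) hn), Set.indicator_of_mem hπ]

/-- Averages over the policy of RLSVI are averages over the noise of its greedy policy. -/
theorem sum_rlsvi_mul [Nonempty A] {β : ℝ} (hβ : 1 ≤ β)
    {θbar : Fin H × X × A → ℝ} {v lam : ℝ}
    (hθ : ∀ y, θbar y = H) (hv : v = (H : ℝ) ^ 2) (hlam : v / lam = β) {ℓ : ℕ}
    (h : History H X A ℓ) (c : Policy H X A → ℝ) :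
    ∑ π, rlsvi θbar v lam ℓ h π * c π =
      ∫ ξ, ∑ π, (greedySet θbar v lam h π).indicator (fun _ => c π) ξ
        ∂(Measure.pi fun _ : Fin H × X × A => gaussianReal 0 1) := by
  rw [integral_finsetSum _ fun π _ => (integrable_const (c π)).indicator
    (measurableSet_greedySet hβ hθ hv hlam h π)]
  refine Finset.sum_congr rfl fun π _ => ?_
  rw [integral_indicator_const _ (measurableSet_greedySet hβ hθ hv hlam h π), smul_eq_mul]
  rfl

theorem integrable_sum_indicator_greedySet [Nonempty A] {β : ℝ} (hβ : 1 ≤ β)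
    {θbar : Fin H × X × A → ℝ} {v lam : ℝ}
    (hθ : ∀ y, θbar y = H) (hv : v = (H : ℝ) ^ 2) (hlam : v / lam = β) {ℓ : ℕ}
    (h : History H X A ℓ) (c : Policy H X A → ℝ) :
    Integrable (fun ξ => ∑ π, (greedySet θbar v lam h π).indicator (fun _ => c π) ξ)
      (Measure.pi fun _ : Fin H × X × A => gaussianReal 0 1) :=
  integrable_finsetSum _ fun π _ => (integrable_const (c π)).indicator
    (measurableSet_greedySet hβ hθ hv hlam h π)

theorem sum_rlsvi [Nonempty A] {β : ℝ} (hβ : 1 ≤ β)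
    {θbar : Fin H × X × A → ℝ} {v lam : ℝ}
    (hθ : ∀ y, θbar y = H) (hv : v = (H : ℝ) ^ 2) (hlam : v / lam = β) {ℓ : ℕ}
    (h : History H X A ℓ) : ∑ π, rlsvi θbar v lam ℓ h π = 1 := by
  have e := sum_rlsvi_mul hβ hθ hv hlam h fun _ => 1
  simp only [mul_one] at e
  rw [e, integral_congr_ae (g := fun _ => (1 : ℝ)) ?_]
  · simp
  · filter_upwards [ae_existsUnique_greedy hβ hθ hv hlam h] with ξ ⟨π, hπ, hu⟩
    exact sum_indicator_greedySet hπ hu fun _ => 1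

end GreedyPolicies

/-! ### Bellman errors of the sampled values -/

section BellmanErrors

variable {H : ℕ} {X A : Type*} [Fintype X] [DecidableEq X] [Fintype A] [DecidableEq A]

/-- The sampled values are bounded below by a multiple of the largest downward perturbation. -/
theorem neg_mul_le_rlsviQ [Nonempty A] {β : ℝ} (hβ : 1 ≤ β)
    {θbar : Fin H × X × A → ℝ} {v lam : ℝ}
    (hθ : ∀ y, θbar y = H) (hv : v = (H : ℝ) ^ 2) (hlam : v / lam = β) {ℓ : ℕ}
    (h : History H X A ℓ) {ξ : Fin H × X × A → ℝ} {m : ℝ} (hm : 0 ≤ m) (hξ : ∀ y, -m ≤ ξ y)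
    (t : ℕ) : ∀ x a, -(((H - t : ℕ) : ℝ) * (H / √β * m)) ≤ rlsviQ θbar v lam h ξ t x a := by
  have hβ0 : 0 < β := one_pos.trans_le hβ
  induction t using backward_induction (H := H) with
  | h0 t ht => intro x a; rw [rlsviQ_of_le _ _ _ _ _ ht, Nat.sub_eq_zero_of_le ht]; simp
  | hstep t ht ih =>
    intro x a
    rw [rlsviQ_of_lt hβ0 hθ hv hlam h ξ ht]
    set K := H / √β * m with hK
    have hK0 : 0 ≤ K := by positivity
    have e : ((H - t : ℕ) : ℝ) = ((H - (t + 1) : ℕ) : ℝ) + 1 := by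
      rw [← Nat.cast_succ]; congr 1; omega
    set d : ℝ := ((H - (t + 1) : ℕ) : ℝ) with hd
    have hd0 : 0 ≤ d := Nat.cast_nonneg _
    set c : ℝ := ((visits h (⟨t, ht⟩, x, a)).card : ℝ) with hc
    have hc0 : 0 ≤ c := Nat.cast_nonneg _
    have h1 : -(d * K) ≤ optimisticMean β h (⟨t, ht⟩, x, a)
        fun x' => ⨆ a', rlsviQ θbar v lam h ξ (t + 1) x' a' := by
      unfold optimisticMean
      rw [le_div_iff₀ (by positivity)]
      have h3 : c * (-(d * K)) ≤ ∑ k ∈ visits h (⟨t, ht⟩, x, a),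
          (reward ((h k).outcome ⟨t, ht⟩) +
            ⨆ a', rlsviQ θbar v lam h ξ (t + 1) ((h k).outcome ⟨t, ht⟩).2 a') := by
        rw [hc, ← nsmul_eq_mul, ← Finset.sum_const]
        refine Finset.sum_le_sum fun k _ => ?_
        have h4 := ih ((h k).outcome ⟨t, ht⟩).2 (Classical.arbitrary A)
        have h5 := le_iSup_fintype
          (fun a' => rlsviQ θbar v lam h ξ (t + 1) ((h k).outcome ⟨t, ht⟩).2 a')
          (Classical.arbitrary A)
        have h6 := reward_nonneg ((h k).outcome ⟨t, ht⟩)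
        linarith
      have : 0 ≤ β * H := by positivity
      have : 0 ≤ β * (d * K) := by positivity
      linarith
    have h2 : -K ≤ H / √(β + c) * ξ (⟨t, ht⟩, x, a) := by
      have h3 : H / √(β + c) ≤ H / √β := by
        gcongr
        linarith
      have h4 : 0 ≤ H / √(β + c) := by positivity
      have h5 := mul_le_mul_of_nonneg_left (hξ (⟨t, ht⟩, x, a)) h4
      have h6 := mul_le_mul_of_nonneg_right h3 hm
      linarith
    rw [e]
    linarith

/-- The Bellman error of the sampled values in the posterior mean model consists of the optimism
put into the prior data and of the perturbation. -/
theorem rlsviQ_sub_le [Nonempty A] {β : ℝ} (hβ : 1 ≤ β)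
    {α : Fin H × X × A → Outcome X → ℝ} (hα : ∀ y o, 0 ≤ α y o) (hαβ : ∀ y, ∑ o, α y o = β)
    {θbar : Fin H × X × A → ℝ} {v lam : ℝ}
    (hθ : ∀ y, θbar y = H) (hv : v = (H : ℝ) ^ 2) (hlam : v / lam = β) {ℓ : ℕ}
    (h : History H X A ℓ) {ξ : Fin H × X × A → ℝ} {m : ℝ} (hm : 0 ≤ m) (hξ : ∀ y, -m ≤ ξ y)
    (t : Fin H) (x : X) (a : A) :
    rlsviQ θbar v lam h ξ t x a - ∑ o, meanMDP (postParam α h) (t, x, a) o *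
        (reward o + ⨆ a', rlsviQ θbar v lam h ξ (t + 1) o.2 a') ≤
      β / (β + (visits h (t, x, a)).card) * (H + (H - 1) * (H / √β * m)) +
        H / √(β + (visits h (t, x, a)).card) * ξ (t, x, a) := by
  have hβ0 : 0 < β := one_pos.trans_le hβ
  rw [rlsviQ_of_lt hβ0 hθ hv hlam h ξ t.isLt]
  simp only [Fin.eta]
  set V : X → ℝ := fun x' => ⨆ a', rlsviQ θbar v lam h ξ (t + 1) x' a' with hV
  set c : ℝ := ((visits h (t, x, a)).card : ℝ) with hc
  have hc0 : 0 ≤ c := Nat.cast_nonneg _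
  have hH : (1 : ℝ) ≤ H := by exact_mod_cast (Nat.zero_le _).trans_lt t.isLt
  have hVl : ∀ x', -((H - 1) * (H / √β * m)) ≤ V x' := fun x' => by
    have h1 := neg_mul_le_rlsviQ hβ hθ hv hlam h hm hξ (t + 1) x' (Classical.arbitrary A)
    have h2 := le_iSup_fintype (fun a' => rlsviQ θbar v lam h ξ (t + 1) x' a')
      (Classical.arbitrary A)
    have h3 : ((H - (t + 1) : ℕ) : ℝ) ≤ H - 1 := by
      rw [Nat.cast_sub (by omega)]
      push_cast
      linarith [(Nat.cast_nonneg (t : ℕ) : (0 : ℝ) ≤ (t : ℕ))]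
    have h4 : 0 ≤ H / √β * m := by positivity
    have h5 := mul_le_mul_of_nonneg_right h3 h4
    exact le_trans (by linarith) h2
  have e1 : ∑ o, meanMDP (postParam α h) (t, x, a) o * (reward o + V o.2) =
      (∑ o, α (t, x, a) o * (reward o + V o.2) + ∑ k ∈ visits h (t, x, a),
        (reward ((h k).outcome t) + V ((h k).outcome t).2)) / (β + c) := by
    rw [← sum_postParam_mul α h (t, x, a) fun o => reward o + V o.2, Finset.sum_div]
    refine Finset.sum_congr rfl fun o _ => ?_
    rw [meanMDP, sum_postParam, hαβ, div_mul_eq_mul_div]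
  have e2 : -(β * ((H - 1) * (H / √β * m))) ≤ ∑ o, α (t, x, a) o * (reward o + V o.2) := by
    calc _ = ∑ o, α (t, x, a) o * -((H - 1) * (H / √β * m)) := by
          rw [← Finset.sum_mul, hαβ, mul_neg]
      _ ≤ _ := Finset.sum_le_sum fun o _ => mul_le_mul_of_nonneg_left
          (by linarith [hVl o.2, reward_nonneg o]) (hα _ o)
  rw [e1]
  unfold optimisticMean
  simp only
  rw [add_sub_right_comm, ← sub_div, div_mul_eq_mul_div β]
  refine add_le_add (div_le_div_of_nonneg_right (c := β + c) ?_ (by positivity)) le_rfl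
  linarith

end BellmanErrors

/-! ### Gaussian tails -/

section GaussianExcess

/-- The expected excess of a standard Gaussian over the level `a`. -/
def gaussExcess (a : ℝ) : ℝ := ∫ z, max (z - a) 0 ∂gaussianReal 0 1

theorem integrable_max_sub_stdGaussian (a : ℝ) :
    Integrable (fun z : ℝ => max (z - a) 0) (gaussianReal 0 1) :=
  (integrable_id_stdGaussian.sub (integrable_const a)).sup (integrable_zero _ _ _)

theorem integrable_max_mul_exp {b : ℝ} (hb : 0 < b) :
    Integrable fun u : ℝ => max u 0 * Real.exp (-(b * u)) := by
  have e : (fun u : ℝ => max u 0 * Real.exp (-(b * u))) =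
      (Set.Ioi 0).indicator fun u => u * Real.exp (-(b * u)) := by
    ext u
    by_cases hu : 0 < u
    · rw [Set.indicator_of_mem (Set.mem_Ioi.2 hu), max_eq_left hu.le]
    · rw [Set.indicator_of_notMem (by simpa using hu), max_eq_right (not_lt.1 hu), zero_mul]
  rw [e, integrable_indicator_iff measurableSet_Ioi]
  have := integrableOn_rpow_mul_exp_neg_mul_rpow (p := 1) (s := 1) (b := b) (by norm_num)
    one_pos hb
  simpa using this

theorem integral_max_mul_exp {b : ℝ} (hb : 0 < b) :
    ∫ u : ℝ, max u 0 * Real.exp (-(b * u)) = 1 / b ^ 2 := by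
  have e : (fun u : ℝ => max u 0 * Real.exp (-(b * u))) =
      (Set.Ioi 0).indicator fun u => u ^ ((2 : ℝ) - 1) * Real.exp (-(b * u)) := by
    ext u
    by_cases hu : 0 < u
    · rw [Set.indicator_of_mem (Set.mem_Ioi.2 hu), max_eq_left hu.le]
      norm_num
    · rw [Set.indicator_of_notMem (by simpa using hu), max_eq_right (not_lt.1 hu), zero_mul]
  rw [e, integral_indicator measurableSet_Ioi,
    Real.integral_rpow_mul_exp_neg_mul_Ioi two_pos hb]
  simp

/-- The Gaussian tail, estimated by the exponential tangent of rate `b` to the density. -/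
theorem gaussExcess_le {b : ℝ} (hb : 0 < b) (a : ℝ) :
    gaussExcess a ≤ Real.exp (b ^ 2 / 2 - b * a) / (√(2 * Real.pi) * b ^ 2) := by
  have hI := (integrable_max_mul_exp hb).comp_sub_right a
  have h1 : ∫ z, Real.exp (b ^ 2 / 2 - b * a) / √(2 * Real.pi) *
      (max (z - a) 0 * Real.exp (-(b * (z - a)))) =
      Real.exp (b ^ 2 / 2 - b * a) / (√(2 * Real.pi) * b ^ 2) := by
    rw [integral_const_mul, integral_sub_right_eq_self
      (fun u => max u 0 * Real.exp (-(b * u))) a, integral_max_mul_exp hb]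
    field_simp
  rw [gaussExcess, integral_gaussianReal_eq_integral_smul one_ne_zero, ← h1]
  refine integral_mono_of_nonneg (Filter.Eventually.of_forall fun z =>
    mul_nonneg (gaussianPDFReal_nonneg _ _ _) (le_max_right _ _)) (hI.const_mul _)
    (Filter.Eventually.of_forall fun z => ?_)
  simp only [smul_eq_mul, gaussianPDFReal, NNReal.coe_one, mul_one, sub_zero]
  have h2 : Real.exp (-z ^ 2 / 2) ≤
      Real.exp (b ^ 2 / 2 - b * a) * Real.exp (-(b * (z - a))) := by
    rw [← Real.exp_add, Real.exp_le_exp]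
    nlinarith [sq_nonneg (z - b)]
  have h3 : 0 ≤ (√(2 * Real.pi))⁻¹ * max (z - a) 0 :=
    mul_nonneg (by positivity) (le_max_right _ _)
  have h4 := mul_le_mul_of_nonneg_left h2 h3
  rw [div_eq_mul_inv (Real.exp (b ^ 2 / 2 - b * a))]
  linarith

theorem integral_max_neg_sub_stdGaussian (a : ℝ) :
    ∫ z, max (-z - a) 0 ∂gaussianReal 0 1 = gaussExcess a := by
  have := integral_neg_stdGaussian (fun z => max (z - a) 0)
  simpa [gaussExcess] using this

end GaussianExcess

/-! ### The regret of one episode, given the history -/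

section EpisodeRegret

variable {H : ℕ} {X A : Type*} [Fintype X] [DecidableEq X] [Fintype A] [DecidableEq A]

/-- The number of data for `y`, the prior weight `β` included. -/
def dataCount (β : ℝ) {ℓ : ℕ} (h : History H X A ℓ) (y : Fin H × X × A) : ℝ :=
  β + (visits h y).card

/-- The bound on the Bellman error at `y` if every perturbation is at least `-c` and the
perturbation at `y` is at most `a y`. -/
def visitCost (β c : ℝ) (a : Fin H × X × A → ℝ) {ℓ : ℕ} (h : History H X A ℓ)
    (y : Fin H × X × A) : ℝ :=
  β / dataCount β h y * (H + (H - 1) * (H / √β * c)) + H / √(dataCount β h y) * a y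

/-- The value gap of a greedy policy in the posterior mean model, for fixed perturbations. -/
theorem sum_mul_iSup_rlsviQ_sub_value_le [Nonempty A] {ρ : X → ℝ} (hρ : ρ ∈ stdSimplex ℝ X)
    {β : ℝ} (hβ : 1 ≤ β)
    {α : Fin H × X × A → Outcome X → ℝ} (hα : ∀ y o, 0 ≤ α y o) (hαβ : ∀ y, ∑ o, α y o = β)
    {θbar : Fin H × X × A → ℝ} {v lam : ℝ}
    (hθ : ∀ y, θbar y = H) (hv : v = (H : ℝ) ^ 2) (hlam : v / lam = β) {ℓ : ℕ}
    (h : History H X A ℓ) {c : ℝ} (hc : 0 ≤ c) (a : Fin H × X × A → ℝ)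
    {ξ : Fin H × X × A → ℝ} {π : Policy H X A} (hπ : ξ ∈ greedySet θbar v lam h π) :
    ∑ x, ρ x * (⨆ a, rlsviQ θbar v lam h ξ 0 x a) -
        ∑ x, ρ x * value (meanMDP (postParam α h)) π x ≤
      ∑ τ, trajProb ρ (meanMDP (postParam α h)) π τ *
          ∑ t, visitCost β c a h (t, τ.state t, τ.action t) +
        (H * (H * (H / √β) * ∑ y, max (-ξ y - c) 0) +
          H * ∑ y, max (ξ y - a y) 0 / √(dataCount β h y)) := by
  have hβ0 : 0 < β := one_pos.trans_le hβ
  have hs : ∀ y, 0 < ∑ o, α y o := fun y => by rw [hαβ]; exact hβ0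
  have hn : ∀ y, β ≤ dataCount β h y := fun y =>
    le_add_of_nonneg_right (Nat.cast_nonneg _)
  have hM := meanMDP_mem_stdSimplex (postParam_nonneg hα h) (sum_postParam_pos hs h)
  set M := meanMDP (postParam α h) with hMdef
  set m := ∑ y, max (-ξ y - c) 0 with hm
  have hm1 : ∀ y, max (-ξ y - c) 0 ≤ m := fun y =>
    Finset.single_le_sum (f := fun y => max (-ξ y - c) 0) (fun _ _ => le_max_right _ _)
      (Finset.mem_univ y)
  have hm0 : 0 ≤ m := Finset.sum_nonneg fun _ _ => le_max_right _ _
  have hξ : ∀ y, -(c + m) ≤ ξ y := fun y => by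
    linarith [hm1 y, le_max_left (-ξ y - c) 0]
  set V : ℕ → X → ℝ := fun t x => ⨆ a, rlsviQ θbar v lam h ξ t x a with hV
  have hVH : ∀ x, V H x = 0 := fun x => by
    simp only [hV, rlsviQ_of_le θbar v lam h ξ le_rfl, ciSup_const]
  set E : Fin H → ℝ := fun t => H * (H / √β) * m +
    H * ∑ z : X × A, max (ξ (t, z) - a (t, z)) 0 / √(dataCount β h (t, z)) with hE
  have hEsum : ∑ t, E t = H * (H * (H / √β) * m) +
      H * ∑ y, max (ξ y - a y) 0 / √(dataCount β h y) := by
    simp only [hE]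
    rw [Finset.sum_add_distrib, ← Finset.mul_sum, Fintype.sum_prod_type,
      Finset.sum_const, Finset.card_univ, Fintype.card_fin, nsmul_eq_mul, ← Finset.mul_sum]
    ring
  have hT : ∀ (t : Fin H) (x : X),
      V t x - ∑ o, M (t, x, π t x) o * (reward o + V (t + 1) o.2) ≤
        visitCost β c a h (t, x, π t x) + E t := fun t x => by
    have e : V t x = rlsviQ θbar v lam h ξ t x (π t x) :=
      le_antisymm (ciSup_le fun b => hπ t x b)
        (le_iSup_fintype (fun b => rlsviQ θbar v lam h ξ t x b) _)
    have h1 := rlsviQ_sub_le hβ hα hαβ hθ hv hlam h (add_nonneg hc hm0) hξ t x (π t x)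
    have h1' : V t x - ∑ o, M (t, x, π t x) o * (reward o + V (t + 1) o.2) ≤
        β / dataCount β h (t, x, π t x) * (H + (H - 1) * (H / √β * (c + m))) +
        H / √(dataCount β h (t, x, π t x)) * ξ (t, x, π t x) := by rw [e]; exact h1
    set n := dataCount β h (t, x, π t x) with hndef
    have hn0 : 0 < n := hβ0.trans_le (hn _)
    have h2 : β / n ≤ 1 := (div_le_one hn0).2 (hn _)
    have hH : (1 : ℝ) ≤ H := by exact_mod_cast (Nat.zero_le _).trans_lt t.isLt
    have h3 : β / n * ((H - 1) * (H / √β * m)) ≤ H * (H / √β) * m := by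
      have h4 : 0 ≤ H / √β * m := by positivity
      have h5 : 0 ≤ (H - 1) * (H / √β * m) := mul_nonneg (by linarith) h4
      nlinarith
    have h6 : max (ξ (t, x, π t x) - a (t, x, π t x)) 0 / √n ≤
        ∑ z : X × A, max (ξ (t, z) - a (t, z)) 0 / √(dataCount β h (t, z)) :=
      Finset.single_le_sum
        (f := fun z : X × A => max (ξ (t, z) - a (t, z)) 0 / √(dataCount β h (t, z)))
        (fun _ _ => div_nonneg (le_max_right _ _) (Real.sqrt_nonneg _))
        (Finset.mem_univ (x, π t x))
    have h7 : ξ (t, x, π t x) ≤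
        a (t, x, π t x) + max (ξ (t, x, π t x) - a (t, x, π t x)) 0 := by
      linarith [le_max_left (ξ (t, x, π t x) - a (t, x, π t x)) 0]
    have h8 : 0 ≤ H / √n := by positivity
    have h9 := mul_le_mul_of_nonneg_left h7 h8
    have h10 := mul_le_mul_of_nonneg_left h6 (by linarith : (0 : ℝ) ≤ H)
    have h11 : H / √n * max (ξ (t, x, π t x) - a (t, x, π t x)) 0 =
      H * (max (ξ (t, x, π t x) - a (t, x, π t x)) 0 / √n) := by ring
    rw [visitCost, ← hndef]
    simp only [hE]
    refine h1'.trans ?_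
    rw [mul_add (H / √n)] at h9
    linear_combination h9 + h10 + h3 + h11
  rw [sum_mul_value, sum_trajProb_mul_return ρ hM π V hVH, sub_sub_cancel, ← hEsum]
  calc ∑ τ, trajProb ρ M π τ * ∑ t : Fin H, (V t (τ.state t) -
        ∑ o, M (t, τ.state t, τ.action t) o * (reward o + V (t + 1) o.2))
      ≤ ∑ τ, trajProb ρ M π τ *
          ∑ t : Fin H, (visitCost β c a h (t, τ.state t, τ.action t) + E t) := by
        refine Finset.sum_le_sum fun τ _ => ?_
        by_cases hτ : ∀ t, τ.action t = π t (τ.state t)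
        · refine mul_le_mul_of_nonneg_left (Finset.sum_le_sum fun t _ => ?_)
            (trajProb_nonneg hρ.1 hM π τ)
          rw [hτ t]
          exact hT t _
        · push Not at hτ
          obtain ⟨t, ht⟩ := hτ
          rw [trajProb_eq_zero ht, zero_mul, zero_mul]
    _ = _ := by
        simp_rw [Finset.sum_add_distrib, mul_add]
        rw [Finset.sum_add_distrib, ← Finset.sum_mul, sum_trajProb ρ hM, hρ.2, one_mul]

/-- The expected regret of one episode, given the history: the costs of the visits, and the
contributions of unusually large and unusually small perturbations. -/
theorem sum_rlsvi_regret_le [Nonempty A] {ρ : X → ℝ} (hρ : ρ ∈ stdSimplex ℝ X)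
    {β : ℝ} (hβ : 1 ≤ β)
    {α : Fin H × X × A → Outcome X → ℝ} (hα : ∀ y o, 0 ≤ α y o) (hαβ : ∀ y, ∑ o, α y o = β)
    {θbar : Fin H × X × A → ℝ} {v lam : ℝ}
    (hθ : ∀ y, θbar y = H) (hv : v = (H : ℝ) ^ 2) (hlam : v / lam = β) {ℓ : ℕ}
    (h : History H X A ℓ) {c : ℝ} (hc : 0 ≤ c) (a : Fin H × X × A → ℝ) :
    ∑ π, rlsvi θbar v lam ℓ h π * ∑ x, ρ x *
        (∫ M, optValue M x ∂prior (postParam α h) - value (meanMDP (postParam α h)) π x) ≤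
      ∑ τ, mixProb ρ (rlsvi θbar v lam ℓ h) (meanMDP (postParam α h)) τ *
          ∑ t, visitCost β c a h (t, τ.state t, τ.action t) +
        (H * (H * (H / √β) * (Fintype.card (Fin H × X × A) * gaussExcess c)) +
          H * ∑ y, gaussExcess (a y) / √(dataCount β h y)) := by
  set μ := Measure.pi fun _ : Fin H × X × A => gaussianReal 0 1 with hμ
  set M := meanMDP (postParam α h) with hMdef
  set S : (Fin H × X × A → ℝ) → ℝ := fun ξ => H * (H * (H / √β) * ∑ y, max (-ξ y - c) 0) +
    H * ∑ y, max (ξ y - a y) 0 / √(dataCount β h y) with hS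
  have i1 : ∀ y : Fin H × X × A, Integrable (fun ξ : Fin H × X × A → ℝ => max (-ξ y - c) 0) μ :=
    fun y => integrable_comp_eval (i := y) (f := fun z : ℝ => max (-z - c) 0)
      (μ := fun _ => gaussianReal 0 1)
      ((integrable_id_stdGaussian.neg.sub (integrable_const c)).sup (integrable_zero _ _ _))
  have i2 : ∀ y : Fin H × X × A, Integrable (fun ξ : Fin H × X × A → ℝ =>
      max (ξ y - a y) 0 / √(dataCount β h y)) μ :=
    fun y => (integrable_comp_eval (i := y) (f := fun z : ℝ => max (z - a y) 0)
      (μ := fun _ => gaussianReal 0 1) (integrable_max_sub_stdGaussian (a y))).div_const _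
  have iS : Integrable S μ :=
    (((integrable_finsetSum _ fun y _ => i1 y).const_mul _).const_mul _).add
      ((integrable_finsetSum _ fun y _ => i2 y).const_mul _)
  have eS : ∫ ξ, S ξ ∂μ = H * (H * (H / √β) * (Fintype.card (Fin H × X × A) * gaussExcess c)) +
      H * ∑ y, gaussExcess (a y) / √(dataCount β h y) := by
    simp only [hS]
    rw [integral_add (((integrable_finsetSum _ fun y _ => i1 y).const_mul _).const_mul _)
      ((integrable_finsetSum _ fun y _ => i2 y).const_mul _), integral_const_mul,
      integral_const_mul, integral_const_mul, integral_finsetSum _ fun y _ => i1 y,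
      integral_finsetSum _ fun y _ => i2 y]
    have e1 : ∀ y : Fin H × X × A, ∫ ξ, max (-ξ y - c) 0 ∂μ = gaussExcess c := fun y => by
      rw [← integral_max_neg_sub_stdGaussian]
      exact integral_comp_eval (i := y) (f := fun z : ℝ => max (-z - c) 0)
        (μ := fun _ => gaussianReal 0 1)
        (Measurable.aestronglyMeasurable (by fun_prop))
    have e2 : ∀ y : Fin H × X × A, ∫ ξ, max (ξ y - a y) 0 / √(dataCount β h y) ∂μ =
        gaussExcess (a y) / √(dataCount β h y) := fun y => by
      rw [integral_div]
      congr 1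
      exact integral_comp_eval (i := y) (f := fun z : ℝ => max (z - a y) 0)
        (μ := fun _ => gaussianReal 0 1)
        (Measurable.aestronglyMeasurable (by fun_prop))
    simp_rw [e1, e2]
    simp
  have iQ : ∀ x, Integrable (fun ξ => ⨆ a, rlsviQ θbar v lam h ξ 0 x a) μ :=
    integrable_iSup_rlsviQ hβ hθ hv hlam h 0
  -- the value of the policy and the costs along its trajectories, as averages over the noise
  set val : Policy H X A → ℝ := fun π => ∑ x, ρ x * value M π x with hval
  set cost : Policy H X A → ℝ := fun π => ∑ τ, trajProb ρ M π τ *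
    ∑ t, visitCost β c a h (t, τ.state t, τ.action t) with hcost
  have c1 : ∑ τ, mixProb ρ (rlsvi θbar v lam ℓ h) M τ *
      ∑ t, visitCost β c a h (t, τ.state t, τ.action t) =
      ∑ π, rlsvi θbar v lam ℓ h π * cost π := by
    simp only [mixProb, hcost, Finset.sum_mul, Finset.mul_sum (Finset.univ : Finset
      (Trajectory H X A))]
    rw [Finset.sum_comm]
    simp_rw [mul_assoc]
  have c2 : ∑ π, rlsvi θbar v lam ℓ h π * ∑ x, ρ x *
        (∫ M, optValue M x ∂prior (postParam α h) - value M π x) =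
      ∑ x, ρ x * ∫ M, optValue M x ∂prior (postParam α h) -
        ∑ π, rlsvi θbar v lam ℓ h π * val π := by
    simp only [hval, mul_sub, Finset.sum_sub_distrib]
    rw [← Finset.sum_mul, sum_rlsvi hβ hθ hv hlam h, one_mul]
  have c3 : ∑ x, ρ x * ∫ M, optValue M x ∂prior (postParam α h) ≤
      ∫ ξ, ∑ x, ρ x * ⨆ a, rlsviQ θbar v lam h ξ 0 x a ∂μ := by
    rw [integral_finsetSum _ fun x _ => (iQ x).const_mul _]
    refine Finset.sum_le_sum fun x _ => ?_
    rw [integral_const_mul]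
    exact mul_le_mul_of_nonneg_left (integral_optValue_le hβ hα hαβ hθ hv hlam h x) (hρ.1 x)
  have i3 := integrable_sum_indicator_greedySet hβ hθ hv hlam h cost
  have i4 := integrable_sum_indicator_greedySet hβ hθ hv hlam h val
  have e3 := integral_add (f := fun ξ =>
    ∑ π, (greedySet θbar v lam h π).indicator (fun _ => cost π) ξ + S ξ) (i3.add iS) i4
  rw [integral_add i3 iS, eS, ← sum_rlsvi_mul hβ hθ hv hlam h cost,
    ← sum_rlsvi_mul hβ hθ hv hlam h val] at e3
  rw [c2, c1, sub_le_iff_le_add, ← e3]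
  refine c3.trans (integral_mono_ae (integrable_finsetSum _ fun x _ => (iQ x).const_mul _)
    ((i3.add iS).add i4) ?_)
  filter_upwards [ae_existsUnique_greedy hβ hθ hv hlam h] with ξ ⟨π, hπ, hu⟩
  have h1 := sum_mul_iSup_rlsviQ_sub_value_le hρ hβ hα hαβ hθ hv hlam h hc a hπ
  rw [sum_indicator_greedySet hπ hu, sum_indicator_greedySet hπ hu]
  simp only [hval, hcost, hS]
  linarith

end EpisodeRegret

/-! ### A potential function for the visits -/

section PotentialFunction

/-- `√(2 log N)`, the order of the maximum of `N` standard Gaussians. -/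
def maxScale (N : ℝ) : ℝ := √(2 * Real.log N)

/-- The rate of the exponential bound on the Gaussian tail; the offset makes
`gaussExcess_bonus_le` hold for all `N ≥ 2`. -/
def tiltRate (N : ℝ) : ℝ := maxScale N + 3 / 5

/-- The coefficient of the logarithm in `bonus` and `widthPotential`. -/
def logCoeff (N : ℝ) : ℝ := 2 / tiltRate N

/-- The constant term of `widthPotential`. -/
def baseCoeff (N : ℝ) : ℝ := 2 * maxScale N - maxScale N ^ 2 / tiltRate N

/-- The level above which a perturbation at a triple with `n` data counts as unusually large,
when `t` data are available in its period: it grows when the triple is sampled rarely. -/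
def bonus (N n t : ℝ) : ℝ :=
  baseCoeff N / 2 - logCoeff N + logCoeff N / 2 * Real.log ((t + 1) / n)

/-- A potential whose increment from `n - 1` to `n` pays for `bonus N n t / √n`. -/
def widthPotential (N n t : ℝ) : ℝ := √n * (baseCoeff N + logCoeff N * Real.log (t / n))

theorem maxScale_ge {N : ℝ} (hN : 2 ≤ N) : 1177 / 1000 ≤ maxScale N := by
  apply Real.le_sqrt_of_sq_le
  have := Real.log_two_gt_d9
  have := Real.log_le_log (by norm_num) hN
  linarith

theorem maxScale_sq {N : ℝ} (hN : 2 ≤ N) : maxScale N ^ 2 = 2 * Real.log N :=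
  Real.sq_sqrt (mul_nonneg two_pos.le (Real.log_nonneg (by linarith)))

theorem tiltRate_pos {N : ℝ} (hN : 2 ≤ N) : 0 < tiltRate N := by
  have := maxScale_ge hN
  unfold tiltRate
  linarith

theorem logCoeff_pos {N : ℝ} (hN : 2 ≤ N) : 0 < logCoeff N := div_pos two_pos (tiltRate_pos hN)

theorem logCoeff_le {N : ℝ} (hN : 2 ≤ N) : logCoeff N ≤ 2 := by
  have := maxScale_ge hN
  refine div_le_self two_pos.le ?_
  unfold tiltRate
  linarith

theorem logCoeff_le_maxScale {N : ℝ} (hN : 2 ≤ N) : logCoeff N ≤ maxScale N := by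
  have := maxScale_ge hN
  rw [logCoeff, div_le_iff₀ (tiltRate_pos hN), tiltRate]
  nlinarith

theorem baseCoeff_add {N : ℝ} (hN : 2 ≤ N) :
    baseCoeff N + logCoeff N * Real.log N = 2 * maxScale N := by
  have h := maxScale_sq hN
  unfold baseCoeff logCoeff
  rw [h]
  ring

theorem baseCoeff_nonneg {N : ℝ} (hN : 2 ≤ N) : 0 ≤ baseCoeff N := by
  have h := maxScale_ge hN
  have h1 : maxScale N ^ 2 / tiltRate N ≤ maxScale N := by
    rw [div_le_iff₀ (tiltRate_pos hN), tiltRate]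
    nlinarith
  unfold baseCoeff
  linarith

/-- The excess over the level `bonus` is so small that it is summable against the potential. The
numerical constants leave little room at `N = 2`. -/
theorem gaussExcess_bonus_le {N n t : ℝ} (hN : 2 ≤ N) (hn : 0 < n) (ht : 0 ≤ t) :
    gaussExcess (bonus N n t) ≤ logCoeff N * n / (t + 1) := by
  have hb := tiltRate_pos hN
  have hm := maxScale_ge hN
  refine (gaussExcess_le hb _).trans ?_
  -- the exponent is `(tiltRate N - maxScale N) ^ 2 / 2 + 2 - log ((t + 1) / n)`
  have e : tiltRate N ^ 2 / 2 - tiltRate N * bonus N n t =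
      2 + 9 / 50 - Real.log ((t + 1) / n) := by
    have e1 : tiltRate N * baseCoeff N = 2 * maxScale N * tiltRate N - maxScale N ^ 2 := by
      unfold baseCoeff
      field_simp
    have e2 : tiltRate N * logCoeff N = 2 := by unfold logCoeff; field_simp
    have e3 : tiltRate N * bonus N n t = tiltRate N * baseCoeff N / 2 - tiltRate N * logCoeff N +
        tiltRate N * logCoeff N / 2 * Real.log ((t + 1) / n) := by unfold bonus; ring
    rw [e3, e2, e1]
    unfold tiltRate
    ring
  rw [e, Real.exp_sub, Real.exp_log (by positivity), Real.exp_add]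
  have h1 : Real.exp 2 ≤ 7.38906 := by
    have := Real.exp_one_lt_d9
    have h : Real.exp 2 = Real.exp 1 ^ 2 := by rw [← Real.exp_nat_mul]; norm_num
    rw [h]
    nlinarith [Real.exp_pos 1]
  have h2 : Real.exp (9 / 50) ≤ 1.1974 := by
    have := Real.exp_bound' (x := 9 / 50) (by norm_num) (by norm_num) (n := 4) (by norm_num)
    refine this.trans ?_
    norm_num [Finset.sum_range_succ, Nat.factorial]
  have h3 : 2.506 ≤ √(2 * Real.pi) := by
    apply Real.le_sqrt_of_sq_le
    have := Real.pi_gt_d4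
    norm_num at this ⊢
    linarith
  have h4 : Real.exp 2 * Real.exp (9 / 50) ≤ 2 * tiltRate N * √(2 * Real.pi) := by
    have h5 : Real.exp 2 * Real.exp (9 / 50) ≤ 7.38906 * 1.1974 :=
      mul_le_mul h1 h2 (Real.exp_pos _).le (by norm_num)
    have h6 : 2 * 1.777 * 2.506 ≤ 2 * tiltRate N * √(2 * Real.pi) := by
      refine mul_le_mul (mul_le_mul_of_nonneg_left ?_ (by norm_num)) h3 (by norm_num)
        (by positivity)
      unfold tiltRate
      norm_num at hm ⊢
      linarith
    refine h5.trans (le_trans (by norm_num) h6)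
  have hp : 0 < √(2 * Real.pi) := by positivity
  have e4 : Real.exp 2 * Real.exp (9 / 50) / ((t + 1) / n) / (√(2 * Real.pi) * tiltRate N ^ 2) =
      (Real.exp 2 * Real.exp (9 / 50)) * (n / ((t + 1) * (√(2 * Real.pi) * tiltRate N ^ 2))) := by
    field_simp
  have e5 : logCoeff N * n / (t + 1) = (2 * tiltRate N * √(2 * Real.pi)) *
      (n / ((t + 1) * (√(2 * Real.pi) * tiltRate N ^ 2))) := by
    unfold logCoeff
    field_simp
  rw [e4, e5]
  exact mul_le_mul_of_nonneg_right h4 (by positivity)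

theorem sqrt_sub_sqrt_sub_one_ge {n : ℝ} (hn : 1 ≤ n) : 1 / (2 * √n) ≤ √n - √(n - 1) := by
  have h1 : 0 < √n := Real.sqrt_pos.2 (by linarith)
  have h2 : √n ^ 2 = n := Real.sq_sqrt (by linarith)
  have h3 : √(n - 1) ^ 2 = n - 1 := Real.sq_sqrt (by linarith)
  rw [div_le_iff₀ (by positivity)]
  nlinarith [sq_nonneg (√n - √(n - 1))]

theorem sqrt_le_sqrt_sub_one_add {n : ℝ} (hn : 2 ≤ n) : √n ≤ √(n - 1) + 1 / 2 := by
  have h1 : 1 ≤ √(n - 1) := Real.one_le_sqrt.2 (by linarith)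
  have h3 : √(n - 1) ^ 2 = n - 1 := Real.sq_sqrt (by linarith)
  rw [Real.sqrt_le_left (by linarith)]
  nlinarith

/-- The classical bound `log x ≤ √x - 1/√x`, in the form in which it is used. -/
theorem sqrt_mul_log_div_le {n : ℝ} (hn : 1 < n) :
    √(n - 1) * Real.log (n / (n - 1)) ≤ 1 / √n := by
  have hn1 : 0 < n - 1 := by linarith
  set r := √(n - 1) with hr
  set s := √n with hs
  have hr0 : 0 < r := Real.sqrt_pos.2 hn1
  have hs0 : 0 < s := Real.sqrt_pos.2 (by linarith)
  have hs2 : s ^ 2 = n := Real.sq_sqrt (by linarith)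
  have hr2 : r ^ 2 = n - 1 := Real.sq_sqrt hn1.le
  have hrs : r ≤ s := Real.sqrt_le_sqrt (by linarith)
  have hx : 1 ≤ s / r := (one_le_div hr0).2 hrs
  have e : Real.log (n / (n - 1)) = 2 * Real.log (s / r) := by
    rw [← hr2, ← hs2, ← div_pow, Real.log_pow]
    norm_num
  have h1 : 2 * Real.log (s / r) ≤ s / r - r / s := by
    have h := Real.self_le_sinh_iff.2 (Real.log_nonneg hx)
    rw [Real.sinh_eq, Real.exp_neg, Real.exp_log (by positivity), inv_div] at h
    linarith
  rw [e]
  calc r * (2 * Real.log (s / r)) ≤ r * (s / r - r / s) := mul_le_mul_of_nonneg_left h1 hr0.le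
    _ = (s ^ 2 - r ^ 2) / s := by field_simp
    _ = 1 / s := by rw [hs2, hr2]; ring

/-- The increment of `widthPotential` in the number of data pays for the level of a visit. -/
theorem bonus_div_sqrt_le {N n t : ℝ} (hN : 2 ≤ N) (hn : 2 ≤ n) (ht : n ≤ t + 1) :
    bonus N n t / √n ≤ widthPotential N n (t + 1) - widthPotential N (n - 1) (t + 1) := by
  have hk := logCoeff_pos hN
  have hk0 := baseCoeff_nonneg hN
  have hs0 : 0 < √n := Real.sqrt_pos.2 (by linarith)
  have e : Real.log ((t + 1) / (n - 1)) = Real.log ((t + 1) / n) + Real.log (n / (n - 1)) := by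
    rw [← Real.log_mul (div_pos (by linarith) (by linarith)).ne'
      (div_pos (by linarith) (by linarith)).ne']
    congr 1
    have : n - 1 ≠ 0 := by linarith
    field_simp
  have hl : 0 ≤ Real.log ((t + 1) / n) :=
    Real.log_nonneg ((one_le_div (by linarith)).2 ht)
  have h1 := sqrt_sub_sqrt_sub_one_ge (n := n) (by linarith)
  have h2 := sqrt_mul_log_div_le (n := n) (by linarith)
  unfold widthPotential bonus
  rw [e]
  have h3 := mul_le_mul_of_nonneg_left h1
    (add_nonneg hk0 (mul_nonneg hk.le hl))
  have h4 := mul_le_mul_of_nonneg_left h2 hk.le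
  have e2 : (baseCoeff N / 2 - logCoeff N + logCoeff N / 2 * Real.log ((t + 1) / n)) / √n =
      (baseCoeff N + logCoeff N * Real.log ((t + 1) / n)) * (1 / (2 * √n)) -
        logCoeff N * (1 / √n) := by
    field_simp
    ring
  rw [e2]
  linear_combination h3 + h4

theorem one_div_add_one_le_log_sub_log {t : ℝ} (ht : 0 < t) :
    1 / (t + 1) ≤ Real.log (t + 1) - Real.log t := by
  rw [← Real.log_div (by linarith) ht.ne']
  have := Real.one_sub_inv_le_log_of_pos (x := (t + 1) / t) (by positivity)
  refine le_trans (le_of_eq ?_) this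
  field_simp
  ring

/-- As time passes, `widthPotential` grows even without a visit, at the rate of the excess
bounded in `gaussExcess_bonus_le`. -/
theorem widthPotential_mono {N n t : ℝ} (hN : 2 ≤ N) (hn : 0 < n) (ht : 0 < t) :
    widthPotential N n t + logCoeff N * √n / (t + 1) ≤ widthPotential N n (t + 1) := by
  have h1 := one_div_add_one_le_log_sub_log ht
  have h2 := mul_le_mul_of_nonneg_left h1 (mul_nonneg (logCoeff_pos hN).le (Real.sqrt_nonneg n))
  unfold widthPotential
  rw [Real.log_div ht.ne' hn.ne', Real.log_div (by linarith) hn.ne']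
  linear_combination h2

/-- The potential of a triple with `n` data when its period has `t` data. The logarithm of `n - 1`
pays for the optimism of the prior data, and the last term for the difference of `√n` and
`√(n - 1)` in the excess. -/
def potential (K R N n t : ℝ) : ℝ :=
  K * Real.log (n - 1) + R * widthPotential N (n - 1) t + R * logCoeff N / 2 * Real.log t

theorem potential_step {K R N n t : ℝ} (hR : 0 ≤ R) (hN : 2 ≤ N)
    (hn : 2 ≤ n) (ht : 0 < t) :
    potential K R N n t + R * (logCoeff N * √n / (t + 1)) ≤ potential K R N n (t + 1) := by
  have hk := logCoeff_pos hN
  have h1 := mul_le_mul_of_nonneg_left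
    (widthPotential_mono hN (n := n - 1) (by linarith) ht) hR
  have h2 := mul_le_mul_of_nonneg_left (one_div_add_one_le_log_sub_log ht)
    (by positivity : 0 ≤ R * logCoeff N / 2)
  have h3 := mul_le_mul_of_nonneg_left (sqrt_le_sqrt_sub_one_add hn)
    (by positivity : 0 ≤ R * logCoeff N / (t + 1))
  unfold potential
  linear_combination h1 + h2 + h3

theorem potential_step_visit {K R N n t : ℝ} (hK : 0 ≤ K) (hR : 0 ≤ R) (hN : 2 ≤ N)
    (hn : 2 ≤ n) (ht : n ≤ t + 1) :
    potential K R N n t + R * (logCoeff N * √n / (t + 1)) + (K / n + R / √n * bonus N n t) ≤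
      potential K R N (n + 1) (t + 1) := by
  have h1 := potential_step (K := K) hR hN hn (t := t) (by linarith)
  have h2 := mul_le_mul_of_nonneg_left (bonus_div_sqrt_le hN hn ht) hR
  have h3 := mul_le_mul_of_nonneg_left
    (one_div_add_one_le_log_sub_log (t := n - 1) (by linarith)) hK
  unfold potential at h1 ⊢
  rw [add_sub_cancel_right]
  rw [sub_add_cancel] at h3
  linear_combination h1 + h2 + h3

end PotentialFunction

/-! ### Totals of the potential over a period -/

section Concavity

variable {ι : Type*} [Fintype ι]

theorem sum_log_one_add_le [Nonempty ι] {m : ι → ℝ} (hm : ∀ i, 0 ≤ m i) {S : ℝ}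
    (hS : ∑ i, m i ≤ S) :
    ∑ i, Real.log (1 + m i) ≤ Fintype.card ι * Real.log (1 + S / Fintype.card ι) := by
  have hc : (0 : ℝ) < Fintype.card ι := by exact_mod_cast Fintype.card_pos
  have hS0 : 0 ≤ S := (Finset.sum_nonneg fun i _ => hm i).trans hS
  set q := 1 + S / Fintype.card ι with hq
  have hq0 : 0 < q := by positivity
  calc ∑ i, Real.log (1 + m i) ≤ ∑ i, (Real.log q + ((1 + m i) / q - 1)) := by
        refine Finset.sum_le_sum fun i _ => ?_
        have h1 : 0 < 1 + m i := by linarith [hm i]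
        have h2 := Real.log_le_sub_one_of_pos (div_pos h1 hq0)
        rw [Real.log_div h1.ne' hq0.ne'] at h2
        linarith
    _ = Fintype.card ι * Real.log q + ((Fintype.card ι + ∑ i, m i) / q - Fintype.card ι) := by
        simp only [Finset.sum_add_distrib, Finset.sum_sub_distrib, ← Finset.sum_div]
        simp
    _ ≤ Fintype.card ι * Real.log q := by
        have : (Fintype.card ι + ∑ i, m i) / q ≤ Fintype.card ι := by
          rw [div_le_iff₀ hq0, hq, mul_add, mul_div_cancel₀ _ hc.ne']
          linarith
        linarith

theorem widthPotential_le {N n t : ℝ} (hN : 2 ≤ N) (hn : 0 < n) (ht : 0 < t) :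
    widthPotential N n t ≤
      (maxScale N - logCoeff N) * (n / √(t / N) + √(t / N)) + 2 * logCoeff N * √(t / N) := by
  have hk := logCoeff_pos hN
  set q := √(t / N) with hq
  have hq0 : 0 < q := Real.sqrt_pos.2 (by positivity)
  have hs0 : 0 < √n := Real.sqrt_pos.2 hn
  have hn2 : √n ^ 2 = n := Real.sq_sqrt hn.le
  have hq2 : q ^ 2 = t / N := Real.sq_sqrt (by positivity)
  have e : Real.log (t / n) = Real.log N + 2 * Real.log (q / √n) := by
    have : t / n = N * (q / √n) ^ 2 := by
      rw [div_pow, hn2, hq2]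
      field_simp
    rw [this, Real.log_mul (by positivity) (by positivity), Real.log_pow]
    norm_num
  have h1 := Real.log_le_sub_one_of_pos (div_pos hq0 hs0)
  have h2 : widthPotential N n t ≤ 2 * (maxScale N - logCoeff N) * √n + 2 * logCoeff N * q := by
    unfold widthPotential
    rw [e]
    have h3 := mul_le_mul_of_nonneg_left h1 (by positivity : 0 ≤ 2 * logCoeff N * √n)
    have e3 : 2 * logCoeff N * √n * (q / √n - 1) = 2 * logCoeff N * (q - √n) := by field_simp
    rw [e3] at h3
    linear_combination h3 + √n * baseCoeff_add hN
  have h4 : 2 * √n ≤ n / q + q := by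
    have : n / q + q - 2 * √n = (√n - q) ^ 2 / q := by
      rw [sub_sq, hn2]
      field_simp
      ring
    have : 0 ≤ (√n - q) ^ 2 / q := by positivity
    linarith
  have h5 := mul_le_mul_of_nonneg_left h4 (sub_nonneg.2 (logCoeff_le_maxScale hN))
  linarith

theorem sum_widthPotential_le {N : ℝ} (hN : 2 ≤ N) (hcard : (Fintype.card ι : ℝ) = N)
    {m : ι → ℝ} (hm : ∀ i, 0 < m i) {t : ℝ} (ht : 0 < t) (hS : ∑ i, m i ≤ t) :
    ∑ i, widthPotential N (m i) t ≤ 2 * maxScale N * √(N * t) := by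
  have hN0 : 0 < N := by linarith
  refine (Finset.sum_le_sum fun i _ => widthPotential_le hN (hm i) ht).trans ?_
  have hq0 : 0 < √(t / N) := Real.sqrt_pos.2 (by positivity)
  have hq2 : √(t / N) ^ 2 = t / N := Real.sq_sqrt (by positivity)
  have hq3 : √(N * t) = N * √(t / N) := by
    rw [Real.sqrt_eq_iff_mul_self_eq (by positivity) (by positivity)]
    have : t = N * √(t / N) ^ 2 := by rw [hq2]; field_simp
    linear_combination N * this
  rw [Finset.sum_add_distrib, ← Finset.mul_sum, Finset.sum_add_distrib, ← Finset.sum_div]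
  simp only [Finset.sum_const, Finset.card_univ, nsmul_eq_mul, hcard]
  have h1 : (∑ i, m i) / √(t / N) ≤ N * √(t / N) := by
    rw [div_le_iff₀ hq0]
    have : N * √(t / N) * √(t / N) = t := by
      rw [mul_assoc, ← sq, hq2]
      field_simp
    linarith
  rw [hq3]
  have h2 := mul_le_mul_of_nonneg_left h1 (sub_nonneg.2 (logCoeff_le_maxScale hN))
  linarith

end Concavity

/-! ### Counting visits -/

section VisitCounts

variable {H : ℕ} {X A : Type*} [Fintype X] [DecidableEq X] [Fintype A] [DecidableEq A]

theorem dataCount_snoc (β : ℝ) {ℓ : ℕ} (h : History H X A ℓ) (τ : Trajectory H X A)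
    (y : Fin H × X × A) :
    dataCount β (Fin.snoc h τ : History H X A (ℓ + 1)) y = dataCount β h y +
      if τ.state y.1 = y.2.1 ∧ τ.action y.1 = y.2.2 then 1 else 0 := by
  have h1 := sum_postParam (fun _ _ => 0) (Fin.snoc h τ : History H X A (ℓ + 1)) y
  have h2 := sum_postParam (fun _ _ => 0) h y
  have h3 := sum_visitCount_mul τ y fun _ => 1
  simp only [postParam_snoc, Finset.sum_add_distrib, Finset.sum_const_zero, zero_add, mul_one]
    at h1 h2 h3
  rw [h2, h3] at h1
  rw [dataCount, dataCount, ← h1, add_assoc]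

theorem card_visits_le {ℓ : ℕ} (h : History H X A ℓ) (y : Fin H × X × A) :
    (visits h y).card ≤ ℓ := by
  simpa using Finset.card_le_univ (visits h y)

theorem sum_card_visits {ℓ : ℕ} (h : History H X A ℓ) (t : Fin H) :
    ∑ z : X × A, ((visits h (t, z)).card : ℝ) = ℓ := by
  have : ∀ k : Fin ℓ, ∑ z : X × A,
      (if (h k).state t = z.1 ∧ (h k).action t = z.2 then (1 : ℝ) else 0) = 1 := fun k => by
    rw [Finset.sum_eq_single ((h k).state t, (h k).action t)]
    · simp
    · intro z _ hz
      rw [if_neg fun h' => hz (Prod.ext h'.1.symm h'.2.symm)]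
    · simp
  simp_rw [visits, Finset.card_filter, Nat.cast_sum, Nat.cast_ite, Nat.cast_one, Nat.cast_zero]
  rw [Finset.sum_comm]
  simp_rw [this]
  simp

theorem sum_ite_visited (τ : Trajectory H X A) (f : Fin H × X × A → ℝ) :
    ∑ y : Fin H × X × A, (if τ.state y.1 = y.2.1 ∧ τ.action y.1 = y.2.2 then f y else 0) =
      ∑ t, f (t, τ.state t, τ.action t) := by
  rw [Fintype.sum_prod_type]
  refine Finset.sum_congr rfl fun t _ => ?_
  rw [Finset.sum_eq_single (τ.state t, τ.action t)]
  · simp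
  · intro z _ hz
    rw [if_neg fun h' => hz (Prod.ext h'.1.symm h'.2.symm)]
  · simp

end VisitCounts

/-! ### The potential along random histories -/

section PotentialArgument

variable {H : ℕ} {X A : Type*} [Fintype X] [DecidableEq X] [Fintype A] [DecidableEq A]

theorem sum_mixProb {ρ : X → ℝ} (hρ : ρ ∈ stdSimplex ℝ X) {w : Policy H X A → ℝ}
    (hw : ∑ π, w π = 1) {M : MDP H X A} (hM : ∀ y, M y ∈ stdSimplex ℝ (Outcome X)) :
    ∑ τ, mixProb ρ w M τ = 1 := by
  unfold mixProb
  rw [Finset.sum_comm]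
  simp_rw [← Finset.mul_sum, sum_trajProb ρ hM, hρ.2, mul_one]
  exact hw

theorem sum_predProb {α : Fin H × X × A → Outcome X → ℝ}
    (hα : ∀ y o, 0 ≤ α y o) (hs : ∀ y, 0 < ∑ o, α y o) {ρ : X → ℝ} (hρ : ρ ∈ stdSimplex ℝ X)
    {agent : Agent H X A} (hag : ∀ (ℓ : ℕ) (h : History H X A ℓ), ∑ π, agent ℓ h π = 1) (ℓ : ℕ) :
    ∑ h : History H X A ℓ, predProb ρ α agent h = 1 := by
  induction ℓ with
  | zero => simp [predProb_zero]
  | succ ℓ ih =>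
    rw [sum_history_succ, ← ih]
    refine Finset.sum_congr rfl fun h _ => ?_
    simp_rw [predProb_snoc hα hs]
    rw [← Finset.mul_sum, sum_mixProb hρ (hag ℓ h)
      (meanMDP_mem_stdSimplex (postParam_nonneg hα h) (sum_postParam_pos hs h)), mul_one]

/-- The total potential of the data collected so far; period by period, the `N * β` prior data
are counted along with the `ℓ` observations. -/
def histPotential (K β : ℝ) {ℓ : ℕ} (h : History H X A ℓ) : ℝ :=
  ∑ y, potential K H (Fintype.card (X × A)) (dataCount β h y) (Fintype.card (X × A) * β + ℓ)

/-- The levels that separate usual from unusually large perturbations. -/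
def bonusLevel (β : ℝ) {ℓ : ℕ} (h : History H X A ℓ) (y : Fin H × X × A) : ℝ :=
  bonus (Fintype.card (X × A)) (dataCount β h y) (Fintype.card (X × A) * β + ℓ)

theorem le_dataCount (β : ℝ) {ℓ : ℕ} (h : History H X A ℓ) (y : Fin H × X × A) :
    β ≤ dataCount β h y := le_add_of_nonneg_right (Nat.cast_nonneg _)

theorem dataCount_le {β : ℝ} (hβ : 0 ≤ β) (hN : 1 ≤ Fintype.card (X × A)) {ℓ : ℕ}
    (h : History H X A ℓ) (y : Fin H × X × A) :
    dataCount β h y ≤ Fintype.card (X × A) * β + ℓ := by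
  have h1 : ((visits h y).card : ℝ) ≤ ℓ := by exact_mod_cast card_visits_le h y
  have h2 : (1 : ℝ) ≤ Fintype.card (X × A) := by exact_mod_cast hN
  unfold dataCount
  nlinarith

/-- One episode increases the potential by at least the costs of its visits and of unusually large
perturbations. -/
theorem histPotential_add_le {β c : ℝ} (hβ : 2 ≤ β) (hc : 0 ≤ c)
    (hN : 2 ≤ Fintype.card (X × A)) {ℓ : ℕ} (h : History H X A ℓ) (τ : Trajectory H X A) :
    histPotential (β * (H + (H - 1) * (H / √β * c))) β h +
        H * ∑ y, gaussExcess (bonusLevel β h y) / √(dataCount β h y) +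
        ∑ t, visitCost β c (bonusLevel β h) h (t, τ.state t, τ.action t) ≤
      histPotential (β * (H + (H - 1) * (H / √β * c))) β
        (Fin.snoc h τ : History H X A (ℓ + 1)) := by
  have hN' : (2 : ℝ) ≤ Fintype.card (X × A) := by exact_mod_cast hN
  rw [← sum_ite_visited τ, Finset.mul_sum, histPotential, histPotential,
    ← Finset.sum_add_distrib, ← Finset.sum_add_distrib]
  refine Finset.sum_le_sum fun y _ => ?_
  have hH : (1 : ℝ) ≤ H := by exact_mod_cast (Nat.zero_le _).trans_lt y.1.isLt
  have hK : 0 ≤ β * (H + (H - 1) * (H / √β * c)) := by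
    have : 0 ≤ (H - 1) * (H / √β * c) := mul_nonneg (by linarith) (by positivity)
    exact mul_nonneg (by linarith) (by linarith)
  have hn := le_dataCount β h y
  have ht := dataCount_le (β := β) (by linarith) (by omega) h y
  rw [dataCount_snoc, Nat.cast_succ, ← add_assoc ((Fintype.card (X × A) : ℝ) * β)]
  simp only [visitCost, bonusLevel]
  set n := dataCount β h y
  set t : ℝ := Fintype.card (X × A) * β + ℓ
  set N : ℝ := ((Fintype.card (X × A) : ℕ) : ℝ)
  have hn0 : 0 < n := by linarith
  have hs0 : 0 < √n := Real.sqrt_pos.2 hn0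
  have ht0 : 0 < t := by linarith
  have h1 : H * (gaussExcess (bonus N n t) / √n) ≤ H * (logCoeff N * √n / (t + 1)) := by
    refine mul_le_mul_of_nonneg_left ?_ (by linarith)
    rw [div_le_iff₀ hs0]
    refine (gaussExcess_bonus_le hN' hn0 ht0.le).trans (le_of_eq ?_)
    rw [div_mul_eq_mul_div, mul_assoc, Real.mul_self_sqrt hn0.le]
  split_ifs with hv
  · have h2 := potential_step_visit hK (by linarith : (0 : ℝ) ≤ H) hN' (by linarith : 2 ≤ n)
      (by linarith : n ≤ t + 1)
    have e : β / n * (H + (H - 1) * (H / √β * c)) =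
      β * (H + (H - 1) * (H / √β * c)) / n := by ring
    rw [e]
    linarith
  · have h2 := potential_step (K := β * (H + (H - 1) * (H / √β * c)))
      (by linarith : (0 : ℝ) ≤ H) hN' (by linarith : 2 ≤ n) ht0
    rw [add_zero, add_zero]
    linarith

/-- The increase of the potential over `L` episodes. -/
theorem histPotential_le {K β : ℝ} (hK : 0 ≤ K) (hβ : 2 ≤ β) (hN : 2 ≤ Fintype.card (X × A))
    {L : ℕ} (h : History H X A L) (h₀ : History H X A 0) :
    histPotential K β h ≤ histPotential K β h₀ +
      (K * (H * (Fintype.card (X × A) * Real.log (1 + L / Fintype.card (X × A)))) +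
        H * (H * (2 * maxScale (Fintype.card (X × A)) *
          √(Fintype.card (X × A) * (Fintype.card (X × A) * β + L)))) +
        H * logCoeff (Fintype.card (X × A)) / 2 * (H * (Fintype.card (X × A) *
          Real.log (1 + L / (Fintype.card (X × A) * β))))) := by
  have hne : Nonempty (X × A) := Fintype.card_pos_iff.1 (by omega)
  have hN' : (2 : ℝ) ≤ Fintype.card (X × A) := by exact_mod_cast hN
  set N : ℝ := ((Fintype.card (X × A) : ℕ) : ℝ) with hNdef
  have hL : (0 : ℝ) ≤ L := Nat.cast_nonneg L
  have hT : 0 < N * β := by positivity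
  have h0 : ∀ y, dataCount β h₀ y = β := fun y => by
    simp [dataCount, Nat.le_zero.1 (card_visits_le h₀ y)]
  have hn := le_dataCount β h
  have hW0 : 0 ≤ widthPotential N (β - 1) (N * β) := by
    refine mul_nonneg (Real.sqrt_nonneg _) (add_nonneg (baseCoeff_nonneg hN')
      (mul_nonneg (logCoeff_pos hN').le (Real.log_nonneg ?_)))
    rw [one_le_div (by linarith)]
    nlinarith
  have hlog : Real.log (N * β + L) = Real.log (N * β) + Real.log (1 + L / (N * β)) := by
    rw [← Real.log_mul hT.ne' (by positivity)]
    congr 1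
    field_simp
  have hy : ∀ y, potential K H N (dataCount β h y) (N * β + L) ≤
      potential K H N (dataCount β h₀ y) (N * β + (0 : ℕ)) +
        (K * Real.log (1 + (visits h y).card) +
          H * widthPotential N (dataCount β h y - 1) (N * β + L) +
          H * logCoeff N / 2 * Real.log (1 + L / (N * β))) := fun y => by
    rw [h0 y, Nat.cast_zero, add_zero]
    unfold potential
    rw [hlog]
    have h1 : Real.log (dataCount β h y - 1) ≤
        Real.log (β - 1) + Real.log (1 + (visits h y).card) := by
      rw [← Real.log_mul (by linarith) (by positivity)]
      refine Real.log_le_log (by linarith [hn y]) ?_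
      unfold dataCount
      have : (0 : ℝ) ≤ (visits h y).card := Nat.cast_nonneg _
      nlinarith
    have h2 := mul_le_mul_of_nonneg_left h1 hK
    have h3 := mul_nonneg (Nat.cast_nonneg H : (0 : ℝ) ≤ H) hW0
    linarith
  have hlogsum : ∀ t : Fin H, ∑ z : X × A, Real.log (1 + (visits h (t, z)).card) ≤
      N * Real.log (1 + L / N) := fun t =>
    sum_log_one_add_le (fun _ => Nat.cast_nonneg _) (sum_card_visits h t).le
  have hwsum : ∀ t : Fin H, ∑ z : X × A, widthPotential N (dataCount β h (t, z) - 1)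
      (N * β + L) ≤ 2 * maxScale N * √(N * (N * β + L)) := fun t => by
    refine sum_widthPotential_le hN' rfl (fun z => by linarith [hn (t, z)]) (by positivity) ?_
    simp only [dataCount, Finset.sum_sub_distrib, Finset.sum_add_distrib, sum_card_visits]
    simp only [Finset.sum_const, Finset.card_univ, nsmul_eq_mul, ← hNdef]
    linarith
  refine (Finset.sum_le_sum fun y _ => hy y).trans ?_
  rw [Finset.sum_add_distrib, Finset.sum_add_distrib, Finset.sum_add_distrib, ← Finset.mul_sum,
    ← Finset.mul_sum, Fintype.sum_prod_type (f := fun y => Real.log (1 + (visits h y).card)),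
    Fintype.sum_prod_type (f := fun y => widthPotential N (dataCount β h y - 1) (N * β + L))]
  have s1 := mul_le_mul_of_nonneg_left (Finset.sum_le_sum fun t (_ : t ∈ Finset.univ) =>
    hlogsum t) hK
  have s2 := mul_le_mul_of_nonneg_left (Finset.sum_le_sum fun t (_ : t ∈ Finset.univ) =>
    hwsum t) (Nat.cast_nonneg H : (0 : ℝ) ≤ H)
  simp only [Finset.sum_const, Finset.card_univ, Fintype.card_fin, nsmul_eq_mul,
    Fintype.card_prod (Fin H)] at s1 s2 ⊢
  unfold histPotential
  rw [Nat.cast_mul, ← hNdef]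
  linarith

theorem bayesRegret_rlsvi_le_potential [Nonempty A] {ρ : X → ℝ} (hρ : ρ ∈ stdSimplex ℝ X)
    {β : ℝ} (hβ : 2 ≤ β)
    {α : Fin H × X × A → Outcome X → ℝ} (hα : ∀ y o, 0 ≤ α y o) (hαβ : ∀ y, ∑ o, α y o = β)
    {θbar : Fin H × X × A → ℝ} {v lam : ℝ}
    (hθ : ∀ y, θbar y = H) (hv : v = (H : ℝ) ^ 2) (hlam : v / lam = β)
    (hH : 1 ≤ H) (hN : 2 ≤ Fintype.card (X × A)) {c : ℝ} (hc : 0 ≤ c) (L : ℕ) :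
    bayesRegret ρ α (rlsvi θbar v lam) L ≤
      (β * (H + (H - 1) * (H / √β * c))) *
          (H * (Fintype.card (X × A) * Real.log (1 + L / Fintype.card (X × A)))) +
        H * (H * (2 * maxScale (Fintype.card (X × A)) *
          √(Fintype.card (X × A) * (Fintype.card (X × A) * β + L)))) +
        H * logCoeff (Fintype.card (X × A)) / 2 * (H * (Fintype.card (X × A) *
          Real.log (1 + L / (Fintype.card (X × A) * β)))) +
        L * (H * (H * (H / √β) * (Fintype.card (Fin H × X × A) * gaussExcess c))) := by
  have hβ1 : 1 ≤ β := by linarith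
  have hs : ∀ y, 0 < ∑ o, α y o := fun y => by rw [hαβ]; linarith
  have hH' : (1 : ℝ) ≤ H := by exact_mod_cast hH
  have hag : ∀ (ℓ : ℕ) (h : History H X A ℓ), ∑ π, rlsvi θbar v lam ℓ h π = 1 := fun ℓ h =>
    sum_rlsvi hβ1 hθ hv hlam h
  set K := β * (H + (H - 1) * (H / √β * c)) with hK
  have hK0 : 0 ≤ K := by
    have : 0 ≤ (H - 1) * (H / √β * c) := mul_nonneg (by linarith) (by positivity)
    exact mul_nonneg (by linarith) (by linarith)
  set B := H * (H * (H / √β) * (Fintype.card (Fin H × X × A) * gaussExcess c)) with hB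
  set p : ∀ ℓ : ℕ, History H X A ℓ → ℝ := fun _ h => predProb ρ α (rlsvi θbar v lam) h with hp
  set P : ℕ → ℝ := fun ℓ => ∑ h : History H X A ℓ, p ℓ h * histPotential K β h with hP
  have hp0 : ∀ {ℓ : ℕ} (h : History H X A ℓ), 0 ≤ p ℓ h := fun h =>
    predProb_nonneg hρ.1 hs (fun ℓ h π => rlsvi_nonneg θbar v lam h π) h
  have hp1 : ∀ ℓ, ∑ h : History H X A ℓ, p ℓ h = 1 := sum_predProb hα hs hρ hag
  have hstep : ∀ ℓ, ∑ h : History H X A ℓ, p ℓ h * ∑ π, rlsvi θbar v lam ℓ h π * ∑ x, ρ x *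
      (∫ M, optValue M x ∂prior (postParam α h) - value (meanMDP (postParam α h)) π x) ≤
      (P (ℓ + 1) - P ℓ) + B := fun ℓ => by
    have e : P (ℓ + 1) - P ℓ + B = ∑ h : History H X A ℓ, p ℓ h *
        (∑ τ, mixProb ρ (rlsvi θbar v lam ℓ h) (meanMDP (postParam α h)) τ *
          histPotential K β (Fin.snoc h τ : History H X A (ℓ + 1)) - histPotential K β h + B) := by
      simp only [mul_add, mul_sub, Finset.sum_add_distrib, Finset.sum_sub_distrib]
      rw [← Finset.sum_mul, hp1, one_mul]
      simp only [hP]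
      rw [sum_history_succ]
      congr 2
      refine Finset.sum_congr rfl fun h _ => ?_
      rw [Finset.mul_sum]
      refine Finset.sum_congr rfl fun τ _ => ?_
      simp only [hp]
      rw [predProb_snoc hα hs, mul_assoc]
    rw [e]
    refine Finset.sum_le_sum fun h _ => mul_le_mul_of_nonneg_left ?_ (hp0 h)
    refine (sum_rlsvi_regret_le hρ hβ1 hα hαβ hθ hv hlam h hc (bonusLevel β h)).trans ?_
    have hM := meanMDP_mem_stdSimplex (postParam_nonneg hα h) (sum_postParam_pos hs h)
    set q := mixProb ρ (rlsvi θbar v lam ℓ h) (meanMDP (postParam α h)) with hq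
    have hq0 : ∀ τ, 0 ≤ q τ := mixProb_nonneg hρ.1 (rlsvi_nonneg θbar v lam h) hM
    have hq1 : ∑ τ, q τ = 1 := sum_mixProb hρ (hag ℓ h) hM
    have h1 : ∑ τ, q τ * (∑ t, visitCost β c (bonusLevel β h) h (t, τ.state t, τ.action t) +
        (H * ∑ y, gaussExcess (bonusLevel β h y) / √(dataCount β h y) + histPotential K β h)) ≤
        ∑ τ, q τ * histPotential K β (Fin.snoc h τ : History H X A (ℓ + 1)) :=
      Finset.sum_le_sum fun τ _ => mul_le_mul_of_nonneg_left
        (by linarith [histPotential_add_le hβ hc hN h τ]) (hq0 τ)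
    simp_rw [mul_add (q _)] at h1
    rw [Finset.sum_add_distrib, Finset.sum_add_distrib, ← Finset.sum_mul, ← Finset.sum_mul,
      hq1, one_mul, one_mul] at h1
    linarith
  rw [bayesRegret_eq hα hs]
  refine (Finset.sum_le_sum fun ℓ _ => hstep ℓ).trans ?_
  rw [Finset.sum_add_distrib, Finset.sum_range_sub, Finset.sum_const, Finset.card_range,
    nsmul_eq_mul]
  have h₀ : History H X A 0 := Fin.elim0
  have hP0 : P 0 = histPotential K β h₀ := by
    simp only [hP]
    rw [Fintype.sum_unique]
    simp only [hp]
    rw [predProb_zero, one_mul]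
    exact congrArg _ (Subsingleton.elim _ _)
  set Q := histPotential K β h₀ + _ with hQ
  have hPL : P L ≤ _ := calc
    P L ≤ ∑ h : History H X A L, p L h * _ := Finset.sum_le_sum fun h _ =>
        mul_le_mul_of_nonneg_left (histPotential_le hK0 hβ hN h h₀) (hp0 h)
    _ = _ := by rw [← Finset.sum_mul, hp1, one_mul]
  linarith

end PotentialArgument

/-! ### Arithmetic of the final bounds -/

section Arithmetic

theorem one_le_logPlus (x : ℝ) : 1 ≤ logPlus x := le_max_left _ _

theorem log_le_logPlus (x : ℝ) : Real.log x ≤ logPlus x := le_max_right _ _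

theorem gaussExcess_nonneg (a : ℝ) : 0 ≤ gaussExcess a :=
  integral_nonneg fun _ => le_max_right _ _

/-- At the level `√(2 log (1 + x))` the Gaussian excess is at most `1 / (1 + x)`. -/
theorem gaussExcess_sqrt_log_le {x : ℝ} (hx : 2 ≤ x) :
    gaussExcess √(2 * Real.log (1 + x)) ≤ 1 / (1 + x) := by
  have h1 : 1 / 2 ≤ Real.log (1 + x) := by
    have := Real.log_two_gt_d9
    have := Real.log_le_log (by norm_num : (0 : ℝ) < 2) (by linarith : 2 ≤ 1 + x)
    linarith
  have h2 : √(2 * Real.log (1 + x)) ^ 2 = 2 * Real.log (1 + x) := Real.sq_sqrt (by linarith)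
  have h0 : 0 < √(2 * Real.log (1 + x)) := Real.sqrt_pos.2 (by linarith)
  refine (gaussExcess_le h0 _).trans ?_
  rw [← sq, h2]
  have e : 2 * Real.log (1 + x) / 2 - 2 * Real.log (1 + x) = -Real.log (1 + x) := by ring
  rw [e, Real.exp_neg, Real.exp_log (by linarith), inv_eq_one_div]
  refine div_le_self (by positivity) ?_
  have h3 : 1 ≤ √(2 * Real.pi) := Real.one_le_sqrt.2 (by linarith [Real.pi_gt_three])
  nlinarith

/-- The terms of the potential bound, collected into the second regret bound. -/
theorem potential_bound_le {N H L β : ℝ} (hN : 2 ≤ N) (hH : 1 ≤ H) (hL : 1 ≤ L) (hβ : 2 ≤ β) :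
    (β * (H + (H - 1) * (H / √β * √(2 * Real.log (1 + N * H * L))))) *
        (H * (N * Real.log (1 + L / N))) +
      H * (H * (2 * maxScale N * √(N * (N * β + L)))) +
      H * logCoeff N / 2 * (H * (N * Real.log (1 + L / (N * β)))) +
      L * (H * (H * (H / √β) * (H * N * gaussExcess √(2 * Real.log (1 + N * H * L))))) ≤
    4 * β * H ^ 3 * N * √(logPlus (1 + N * H * L)) * logPlus (1 + L / N) +
      2 * H ^ 2 * √(2 * N * L * Real.log N) := by
  have hx : 2 ≤ N * H * L := by nlinarith [mul_le_mul hN hH zero_le_one (by linarith)]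
  set x := N * H * L with hxdef
  set g := √(logPlus (1 + x)) with hg
  set l := logPlus (1 + L / N) with hl
  have hg1 : 1 ≤ g := Real.one_le_sqrt.2 (one_le_logPlus _)
  have hl1 : 1 ≤ l := one_le_logPlus _
  have hlog : 0 ≤ Real.log (1 + x) := Real.log_nonneg (by linarith)
  have hsβ : 0 < √β := Real.sqrt_pos.2 (by linarith)
  have hsβ1 : 1 ≤ √β := Real.one_le_sqrt.2 (by linarith)
  -- the level `c = √(2 log (1 + x))` is at most `√β g`
  have hc : √(2 * Real.log (1 + x)) ≤ √β * g := by
    rw [hg, ← Real.sqrt_mul (by linarith)]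
    exact Real.sqrt_le_sqrt (mul_le_mul hβ (log_le_logPlus _) hlog (by linarith))
  have t1 : (β * (H + (H - 1) * (H / √β * √(2 * Real.log (1 + x))))) *
      (H * (N * Real.log (1 + L / N))) ≤ β * H ^ 3 * N * g * l := by
    have h1 : H / √β * √(2 * Real.log (1 + x)) ≤ H * g := by
      rw [div_mul_eq_mul_div, div_le_iff₀ hsβ]
      linarith [mul_le_mul_of_nonneg_left hc (by linarith : 0 ≤ H)]
    have h2 : H + (H - 1) * (H / √β * √(2 * Real.log (1 + x))) ≤ H ^ 2 * g := by
      have h3 := mul_le_mul_of_nonneg_left h1 (by linarith : 0 ≤ H - 1)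
      have h4 := mul_le_mul_of_nonneg_left hg1 (by linarith : 0 ≤ H)
      nlinarith
    calc _ ≤ (β * (H ^ 2 * g)) * (H * (N * l)) := by
          have h5 : 0 ≤ Real.log (1 + L / N) := Real.log_nonneg (by
            have : 0 ≤ L / N := by positivity
            linarith)
          have h6 := log_le_logPlus (1 + L / N)
          gcongr
      _ = _ := by ring
  have t2 : H * (H * (2 * maxScale N * √(N * (N * β + L)))) ≤
      2 * β * H ^ 3 * N * g * l + 2 * H ^ 2 * √(2 * N * L * Real.log N) := by
    have hlN : 0 ≤ Real.log N := Real.log_nonneg (by linarith)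
    have h1 : √(N * (N * β + L)) ≤ N * √β + √(N * L) := by
      rw [Real.sqrt_le_left (by positivity)]
      have e1 : √β ^ 2 = β := Real.sq_sqrt (by linarith)
      have e2 : √(N * L) ^ 2 = N * L := Real.sq_sqrt (by positivity)
      have : 0 ≤ N * √β * √(N * L) := by positivity
      rw [add_sq, mul_pow, e1, e2]
      linarith
    have h2 : maxScale N * √(N * L) = √(2 * N * L * Real.log N) := by
      rw [maxScale, ← Real.sqrt_mul (by positivity)]
      congr 1
      ring
    have h3 : maxScale N ≤ √β * g := by
      rw [maxScale, hg, ← Real.sqrt_mul (by linarith)]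
      refine Real.sqrt_le_sqrt (mul_le_mul hβ (le_trans (Real.log_le_log (by linarith) ?_)
        (log_le_logPlus _)) hlN (by linarith))
      nlinarith [mul_le_mul hH hL zero_le_one (by linarith)]
    have h4 : maxScale N * √β ≤ β * (H * (g * l)) := by
      calc maxScale N * √β ≤ √β * g * √β := mul_le_mul_of_nonneg_right h3 hsβ.le
        _ = β * (1 * (g * 1)) := by
          rw [mul_right_comm, Real.mul_self_sqrt (by linarith)]; ring
        _ ≤ _ := by gcongr
    have hm : 0 ≤ maxScale N := Real.sqrt_nonneg _
    calc H * (H * (2 * maxScale N * √(N * (N * β + L))))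
        ≤ H * (H * (2 * maxScale N * (N * √β + √(N * L)))) := by gcongr
      _ = 2 * H ^ 2 * N * (maxScale N * √β) + 2 * H ^ 2 * (maxScale N * √(N * L)) := by ring
      _ ≤ 2 * H ^ 2 * N * (β * (H * (g * l))) + 2 * H ^ 2 * √(2 * N * L * Real.log N) := by
          rw [h2]; gcongr
      _ = _ := by ring
  have t3 : H * logCoeff N / 2 * (H * (N * Real.log (1 + L / (N * β)))) ≤
      β * H ^ 3 * N * g * l / 2 := by
    have h1 : Real.log (1 + L / (N * β)) ≤ l := by
      refine le_trans (Real.log_le_log (by positivity) ?_) (log_le_logPlus _)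
      gcongr
      nlinarith
    have h2 := logCoeff_le hN
    have h3 := (logCoeff_pos hN).le
    have h4 : 0 ≤ Real.log (1 + L / (N * β)) := Real.log_nonneg (by
      have : 0 ≤ L / (N * β) := by positivity
      linarith)
    calc _ ≤ H * 2 / 2 * (H * (N * l)) := by gcongr
      _ = 2 * H ^ 2 * 1 * N * 1 * l / 2 := by ring
      _ ≤ β * H ^ 2 * H * N * g * l / 2 := by gcongr
      _ = _ := by ring
  have t4 : L * (H * (H * (H / √β) * (H * N * gaussExcess √(2 * Real.log (1 + x))))) ≤
      β * H ^ 3 * N * g * l / 2 := by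
    have h1 := gaussExcess_sqrt_log_le hx
    have h0 := gaussExcess_nonneg √(2 * Real.log (1 + x))
    have h2 : H / √β ≤ H := div_le_self (by linarith) hsβ1
    calc _ ≤ L * (H * (H * H * (H * N * (1 / (1 + x))))) := by gcongr
      _ = H ^ 3 * (x / (1 + x)) := by rw [hxdef]; ring
      _ ≤ H ^ 3 * 1 := by
          gcongr
          rw [div_le_one (by linarith)]
          linarith
      _ = 2 * H ^ 3 * 1 * 1 * 1 / 2 := by ring
      _ ≤ β * H ^ 3 * N * g * l / 2 := by
          have : 1 ≤ N := by linarith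
          gcongr
  linarith

/-- If the first regret bound `F` is smaller than the trivial bound `H * L`, then it dominates the
second one. -/
theorem second_bound_le_first {N H L β G l : ℝ} (hN : 1 ≤ N) (hH : 1 ≤ H) (hL : 0 < L)
    (hβ : 2 ≤ β) (hG : 1 ≤ G) (hGN : Real.log N ≤ G) (hl : 1 ≤ l)
    (hF : 4 * H ^ 2 * √(β * N * L * G) * l ≤ H * L) :
    4 * β * H ^ 3 * N * √G * l + 2 * H ^ 2 * √(2 * N * L * Real.log N) ≤
      4 * H ^ 2 * √(β * N * L * G) * l := by
  have hlN : 0 ≤ Real.log N := Real.log_nonneg hN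
  have e : √(β * N * L * G) = √(β * N) * √L * √G := by
    rw [← Real.sqrt_mul (by positivity), ← Real.sqrt_mul (by positivity)]
  have hG1 : 1 ≤ √G := Real.one_le_sqrt.2 hG
  have h1 : 2 * H ^ 2 * √(2 * N * L * Real.log N) ≤ 2 * H ^ 2 * √(β * N * L * G) * l := by
    have h2 : √(2 * N * L * Real.log N) ≤ √(β * N * L * G) := by gcongr
    calc _ = 2 * H ^ 2 * √(2 * N * L * Real.log N) * 1 := by ring
      _ ≤ _ := by gcongr
  have hs : 0 < √(β * N) := Real.sqrt_pos.2 (by positivity)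
  have hs2 : √(β * N) * √(β * N) = β * N := Real.mul_self_sqrt (by positivity)
  have hsL : 0 < √L := Real.sqrt_pos.2 hL
  have hsL2 : √L * √L = L := Real.mul_self_sqrt hL.le
  have h3 : 4 * H * √(β * N) ≤ √L := by
    rw [e] at hF
    have h4 : (4 * H * √(β * N)) * (H * √L) ≤ √L * (H * √L) := by
      calc (4 * H * √(β * N)) * (H * √L) = 4 * H ^ 2 * (√(β * N) * √L * 1) * 1 := by ring
        _ ≤ 4 * H ^ 2 * (√(β * N) * √L * √G) * l := by gcongr
        _ ≤ H * L := hF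
        _ = √L * (H * √L) := by linear_combination -H * hsL2
    exact le_of_mul_le_mul_right h4 (by positivity)
  have h5 : 4 * β * H ^ 3 * N * √G * l ≤ 2 * H ^ 2 * √(β * N * L * G) * l := by
    rw [e]
    calc 4 * β * H ^ 3 * N * √G * l = (H ^ 2 * √(β * N) * √G * l) * (4 * H * √(β * N)) := by
          linear_combination (-4 * H ^ 3 * √G * l) * hs2
      _ ≤ (H ^ 2 * √(β * N) * √G * l) * √L := by gcongr
      _ ≤ _ := by
          have : 0 ≤ H ^ 2 * (√(β * N) * √L * √G) * l := by positivity
          linarith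
  linarith

end Arithmetic

/-! ### The regret bounds -/

section RegretBounds

variable {H : ℕ} {X A : Type*} [Fintype X] [DecidableEq X] [Fintype A] [DecidableEq A]

theorem bayesRegret_le_mul [Nonempty A] {ρ : X → ℝ} (hρ : ρ ∈ stdSimplex ℝ X)
    {α : Fin H × X × A → Outcome X → ℝ} (hα : ∀ y o, 0 ≤ α y o) (hs : ∀ y, 0 < ∑ o, α y o)
    {agent : Agent H X A} (hag0 : ∀ (ℓ : ℕ) (h : History H X A ℓ) π, 0 ≤ agent ℓ h π)
    (hag : ∀ (ℓ : ℕ) (h : History H X A ℓ), ∑ π, agent ℓ h π = 1) (L : ℕ) :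
    bayesRegret ρ α agent L ≤ H * L := by
  rw [bayesRegret_eq hα hs]
  calc _ ≤ ∑ ℓ ∈ Finset.range L, ∑ h : History H X A ℓ, predProb ρ α agent h *
        ∑ π, agent ℓ h π * ∑ x, ρ x * H := by
        refine Finset.sum_le_sum fun ℓ _ => Finset.sum_le_sum fun h _ =>
          mul_le_mul_of_nonneg_left (Finset.sum_le_sum fun π _ =>
            mul_le_mul_of_nonneg_left (Finset.sum_le_sum fun x _ =>
              mul_le_mul_of_nonneg_left ?_ (hρ.1 x)) (hag0 ℓ h π))
            (predProb_nonneg hρ.1 hs hag0 h)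
        have hs' := sum_postParam_pos hs h
        have h1 : ∫ M, optValue M x ∂prior (postParam α h) ≤ H := by
          calc _ ≤ ∫ _, (H : ℝ) ∂prior (postParam α h) := by
                refine integral_mono_ae
                  (integrable_prior_of_continuous hs' (continuous_optValue x))
                  (integrable_prior_of_continuous hs' continuous_const) ?_
                filter_upwards [prior_ae_mem_stdSimplex hs'] with M hM
                exact optValue_le hM x
            _ = H := by
                have := isProbabilityMeasure_prior (α := postParam α h)
                simp
        have h2 := value_nonneg (meanMDP_mem_stdSimplex (postParam_nonneg hα h) hs') π x
        linarith
    _ = H * L := by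
        simp_rw [← Finset.sum_mul, hρ.2, one_mul, hag, one_mul, ← Finset.sum_mul,
          sum_predProb hα hs hρ hag]
        simp [mul_comm]

/-- With one state and one action there is only one policy. -/
theorem bayesRegret_eq_zero [Nonempty X] [Nonempty A] (hN : Fintype.card (X × A) ≤ 1)
    (ρ : X → ℝ) (α : Fin H × X × A → Outcome X → ℝ) (agent : Agent H X A) (L : ℕ) :
    bayesRegret ρ α agent L = 0 := by
  have hs := Fintype.card_le_one_iff_subsingleton.1 hN
  have hA : Subsingleton A := ⟨fun a b => congrArg Prod.snd
    (Subsingleton.elim ((Classical.arbitrary X, a) : X × A) (Classical.arbitrary X, b))⟩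
  have h1 : ∀ (M : MDP H X A) (π : Policy H X A) (x : X), optValue M x = value M π x :=
    fun M π x => le_antisymm (ciSup_le fun π' => by rw [Subsingleton.elim π' π])
      (value_le_optValue M π x)
  unfold bayesRegret regret
  have h2 : ∀ (M : MDP H X A) (π : Policy H X A) (x : X), optValue M x - value M π x = 0 :=
    fun M π x => sub_eq_zero.2 (h1 M π x)
  simp [h2]

/-- The second regret bound. -/
theorem bayesRegret_rlsvi_le [Nonempty X] [Nonempty A] {ρ : X → ℝ} (hρ : ρ ∈ stdSimplex ℝ X)
    {β : ℝ} (hβ : 2 ≤ β)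
    {α : Fin H × X × A → Outcome X → ℝ} (hα : ∀ y o, 0 ≤ α y o) (hαβ : ∀ y, ∑ o, α y o = β)
    {θbar : Fin H × X × A → ℝ} {v lam : ℝ}
    (hθ : ∀ y, θbar y = H) (hv : v = (H : ℝ) ^ 2) (hlam : v / lam = β) (hH : 1 ≤ H) (L : ℕ) :
    bayesRegret ρ α (rlsvi θbar v lam) L ≤
      4 * β * H ^ 3 * Fintype.card (X × A) *
          √(logPlus (1 + Fintype.card (X × A) * H * L)) *
          logPlus (1 + L / Fintype.card (X × A)) +
        2 * H ^ 2 * √(2 * Fintype.card (X × A) * L * Real.log (Fintype.card (X × A))) := by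
  have hl : ∀ x, 0 ≤ logPlus x := fun x => zero_le_one.trans (one_le_logPlus x)
  have h0 : (0 : ℝ) ≤ 4 * β * H ^ 3 * Fintype.card (X × A) *
          √(logPlus (1 + Fintype.card (X × A) * H * L)) *
          logPlus (1 + L / Fintype.card (X × A)) +
        2 * H ^ 2 * √(2 * Fintype.card (X × A) * L * Real.log (Fintype.card (X × A))) :=
    add_nonneg (mul_nonneg (by positivity) (hl _)) (by positivity)
  rcases Nat.lt_or_ge (Fintype.card (X × A)) 2 with hN | hN
  · rwa [bayesRegret_eq_zero (by omega)]
  rcases Nat.eq_zero_or_pos L with rfl | hL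
  · refine le_trans (le_of_eq ?_) h0
    simp [bayesRegret, regret]
  have h1 := bayesRegret_rlsvi_le_potential hρ hβ hα hαβ hθ hv hlam hH hN
    (Real.sqrt_nonneg (2 * Real.log (1 + (Fintype.card (X × A) : ℝ) * H * L))) L
  have h2 := potential_bound_le (N := Fintype.card (X × A)) (H := H) (L := L)
    (by exact_mod_cast hN) (by exact_mod_cast hH) (by exact_mod_cast hL) hβ
  refine h1.trans (le_trans (le_of_eq ?_) h2)
  rw [Fintype.card_prod (Fin H), Fintype.card_fin, Nat.cast_mul]

end RegretBounds

end

theorem theorem1 {X A : Type*} [Fintype X] [DecidableEq X] [Nonempty X]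
    [Fintype A] [DecidableEq A] [Nonempty A]
    (H : ℕ) (hH : 1 ≤ H)
    (ρ : X → ℝ) (hρ : ρ ∈ stdSimplex ℝ X)
    (β : ℝ) (hβ : 2 ≤ β)
    (α : Fin H × X × A → Outcome X → ℝ)
    (hα : ∀ y o, 0 ≤ α y o) (hαβ : ∀ y, ∑ o, α y o = β)
    (θbar : Fin H × X × A → ℝ) (v lam : ℝ)
    (hθ : ∀ y, θbar y = H) (hv : v = (H : ℝ) ^ 2) (hlam : v / lam = β)
    (L : ℕ) :
    Integrable (fun M => regret ρ (rlsvi θbar v lam) L M) (prior α) ∧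
    bayesRegret ρ α (rlsvi θbar v lam) L ≤
      4 * (H : ℝ) ^ 2 *
          Real.sqrt (β * Fintype.card X * Fintype.card A * L *
            logPlus (1 + (Fintype.card X : ℝ) * Fintype.card A * H * L)) *
        logPlus (1 + (L : ℝ) / ((Fintype.card X : ℝ) * Fintype.card A)) ∧
    bayesRegret ρ α (rlsvi θbar v lam) L ≤
      4 * β * (H : ℝ) ^ 3 * Fintype.card X * Fintype.card A *
          Real.sqrt (logPlus (1 + (Fintype.card X : ℝ) * Fintype.card A * H * L)) *
          logPlus (1 + (L : ℝ) / ((Fintype.card X : ℝ) * Fintype.card A)) +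
        2 * (H : ℝ) ^ 2 *
          Real.sqrt (2 * Fintype.card X * Fintype.card A * L *
            Real.log ((Fintype.card X : ℝ) * Fintype.card A)) := by

  have hs : ∀ y, 0 < ∑ o, α y o := fun y => by rw [hαβ]; linarith
  have hN : (1 : ℝ) ≤ Fintype.card (X × A) := by exact_mod_cast Fintype.card_pos
  have hH' : (1 : ℝ) ≤ H := by exact_mod_cast hH
  have hc : ((Fintype.card (X × A) : ℕ) : ℝ) = Fintype.card X * Fintype.card A := by
    rw [Fintype.card_prod, Nat.cast_mul]
  have h2 := bayesRegret_rlsvi_le hρ hβ hα hαβ hθ hv hlam hH L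
  refine ⟨integrable_prior_of_continuous hs (continuous_regret ρ _ L), ?_, ?_⟩
  · have h1 := bayesRegret_le_mul hρ hα hs (fun _ h π => rlsvi_nonneg θbar v lam h π)
      (fun _ h => sum_rlsvi (by linarith) hθ hv hlam h) L
    rcases Nat.eq_zero_or_pos L with rfl | hL
    · simpa using h1
    have hL' : (1 : ℝ) ≤ L := by exact_mod_cast hL
    have hG : Real.log (Fintype.card (X × A)) ≤ logPlus (1 + Fintype.card (X × A) * H * L) := by
      refine le_trans (Real.log_le_log (by linarith) ?_) (log_le_logPlus _)
      nlinarith [mul_le_mul hH' hL' zero_le_one (by linarith)]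
    have h3 := second_bound_le_first hN hH' (zero_lt_one.trans_le hL') hβ (one_le_logPlus _) hG
      (one_le_logPlus (1 + (L : ℝ) / Fintype.card (X × A)))
    rw [hc] at h2 h3
    simp only [← mul_assoc] at h2 h3 ⊢
    rcases le_total (4 * (H : ℝ) ^ 2 * √(β * Fintype.card X * Fintype.card A * L *
      logPlus (1 + (Fintype.card X : ℝ) * Fintype.card A * H * L)) *
        logPlus (1 + (L : ℝ) / (Fintype.card X * Fintype.card A))) ((H : ℝ) * L) with h | h
    · exact h2.trans (h3 h)
    · exact h1.trans h
  · rw [hc] at h2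
    simpa only [← mul_assoc] using h2
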